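/- **Setting.** Let $\mathbb C[x,y,z]_n$ be the space of homogeneous polynomials of degree $n$, and let $z=0$ be the line at infinity. All topological notions (open, closed, irreducible, component, dimension) refer to the Zariski topology. A plane curve of degree $e$ is a point $C\in\mathbb P(\mathbb C[x,y,z]_e)$. A differential form of degree $d$ is $\omega=P\,dx+Q\,dy$ with $P,Q\in\mathbb C[x,y,z]_d$. The curve $C$ is an integral curve of $\omega$ if $C_xQ-C_yP=CK$ for some polynomial $K$. Let $\mathcal V_C(d)$ be the vector space of all forms of degree $d$ with integral curve $C$. Let $X=X_C\subset\mathbb P^2$ be the scheme defined by $C_x=C_y=C=0$. An irreducible (quasi-projective) variety $B\subset\mathbb P(\mathbb C[x,y,z]_e)$ is an *equi-singular family of plane curves of degree $e$ with modified Tjurina number $t$* if there is a nonempty Zariski open $U\subset B$ such that for all $D\in U$ the scheme $X_D$ is finite of degree $t$. Put $$\delta=\binom{d-e+3}{2}+\binom{d+1}{2}-(e-1)^2+t,$$ where the first summand is $0$ if $e>d+1$. For such a $B$ let $$\mathcal I_B=\{(D,[\eta]) : D\in B,\ 0\ne\eta\in\mathcal V_D(d)\}$$ and let $\Omega_B$ be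 its image under $(D,[\eta])\mapsto[\eta]$, that is, the set of differential forms of degree $d$, up to scaling, that admit at least one integral curve $D\in B$. **Proposition 4.14.** Let $B$ be an equi-singular family of plane curves of degree $e$ with modified Tjurina number $t$, let $C\in B$ and let $0\neq\omega\in\mathcal V_C(d)$. Assume that 1. $C$ is reduced, i.e. has no multiple factors; 2. $C$ has no components at infinity, i.e. $z\nmid C$; 3. $\omega$ has only finitely many integral curves of degree $e$ (it suffices to count those that are reduced and have no components at infinity); 4. $X_C$ is finite of degree $t$; 5. $\dim\mathcal V_C(d)=\delta$. Then $(C,[\omega])$ lies on exactly one irreducible component of $\mathcal I_B$. Let $\Omega_{B,\omega}\subset\Omega_B$ be the image of this component, i.e. the component of the family of forms with an integral curve in $B$ that contains $\omega$. Then $$\dim\Omega_{B,\omega}=\dim B+\delta-1 .$$ Moreover, let $T$ be an irreducible component of the set $\Omega_B$ with $[\omega]\in T$, and assume that $T$ is not contained in the closure of the set of those forms that admit an integral curve $D\in B$ violating one of the conditions 1, 2, 4, 5. Then $T=\overline{\Omega_{B,\omega}}\cap\Omega_B$, and $\dim T=\dim B+\delta-1$. -/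

import Mathlib

open MvPolynomial

noncomputable section

namespace PlaneForms

/-! ### Zariski topology on complex vector spaces and on their projectivizations -/

/-- The algebra of polynomial functions on a complex vector space: the functions generated by the
linear forms (in any basis of a finite dimensional space, the polynomials in the coordinates). -/
def polynomialFunctions (E : Type*) [AddCommGroup E] [Module ℂ E] : Subalgebra ℂ (E → ℂ) :=
  Algebra.adjoin ℂ {f | ∃ l : Module.Dual ℂ E, f = fun v => l v}

/-- The Zariski topology on a vector space; a basis is given by the non-vanishing loci of
polynomial functions. -/
abbrev zariskiTopology (E : Type*) [AddCommGroup E] [Module ℂ E] : TopologicalSpace E :=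
  TopologicalSpace.generateFrom {U | ∃ f ∈ polynomialFunctions E, U = {v | f v ≠ 0}}

/-! ### Curves and differential forms -/

/-- Homogeneous polynomials of degree `n` in `x = X 0`, `y = X 1`, `z = X 2`.
The line at infinity is `z = 0`. -/
abbrev Hom (n : ℕ) : Submodule ℂ (MvPolynomial (Fin 3) ℂ) := homogeneousSubmodule (Fin 3) ℂ n

/-- The projective space `ℙ(ℂ[x,y,z]_e)` of plane curves of degree `e`. -/
def Curve (e : ℕ) : Type := Projectivization ℂ (Hom e)

/-- The projective space of nonzero differential forms `P dx + Q dy` up to scaling, with `P`, `Q`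
homogeneous of degree `d`; a form is represented by the pair `(P, Q)`. -/
def Form (d : ℕ) : Type := Projectivization ℂ (Hom d × Hom d)

/-- Pairs of a curve and a form, i.e. the points of the product of two projective spaces. -/
def CurveForm (e d : ℕ) : Type := Curve e × Form d

/-- An equation of a curve. Everything below is independent of the choice of the scalar. -/
def Curve.eqn {e : ℕ} (C : Curve e) : MvPolynomial (Fin 3) ℂ := ((Projectivization.rep C : Hom e) : _)

/-- A nonzero pair `(P, Q)` representing a form; it is defined up to a nonzero scalar. -/
def Form.coeffs {d : ℕ} (ω : Form d) : Hom d × Hom d := Projectivization.rep ω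

/-- Zariski topology on a projective space: a set is closed iff its cone is closed away from `0`. -/
instance (e : ℕ) : TopologicalSpace (Curve e) :=
  TopologicalSpace.coinduced
    (fun v : {v : Hom e // v ≠ 0} => (Projectivization.mk ℂ v.1 v.2 : Projectivization ℂ (Hom e)))
    (TopologicalSpace.induced Subtype.val (zariskiTopology (Hom e)))

instance (d : ℕ) : TopologicalSpace (Form d) :=
  TopologicalSpace.coinduced
    (fun v : {v : Hom d × Hom d // v ≠ 0} =>
      (Projectivization.mk ℂ v.1 v.2 : Projectivization ℂ (Hom d × Hom d)))
    (TopologicalSpace.induced Subtype.val (zariskiTopology (Hom d × Hom d)))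

/-- Zariski topology on the product of the two projective spaces (it is finer than the product of
the two Zariski topologies): a set is closed iff its bihomogeneous cone is closed in the set of
pairs of nonzero vectors. -/
instance (e d : ℕ) : TopologicalSpace (CurveForm e d) :=
  TopologicalSpace.coinduced
    (fun v : {v : Hom e × (Hom d × Hom d) // v.1 ≠ 0 ∧ v.2 ≠ 0} =>
      ((Projectivization.mk ℂ v.1.1 v.2.1, Projectivization.mk ℂ v.1.2 v.2.2) :
        Projectivization ℂ (Hom e) × Projectivization ℂ (Hom d × Hom d)))
    (TopologicalSpace.induced Subtype.val (zariskiTopology (Hom e × (Hom d × Hom d))))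

/-- The space `V_C(d)` of the forms `P dx + Q dy` of degree `d` that admit `C` as an integral curve:
`dC ∧ ω = C · K dx ∧ dy`, i.e. `C_x Q - C_y P = C K`, for some cofactor `K`.
For `C ≠ 0` the cofactor is unique (and homogeneous of degree `d - 1`), so that this is
the degree `d` part of the kernel of the Darboux matrix `(C_x, C_y, C)`. -/
def integralForms (C : MvPolynomial (Fin 3) ℂ) (d : ℕ) : Submodule ℂ (Hom d × Hom d) where
  carrier := {ω | ∃ K : MvPolynomial (Fin 3) ℂ,
    pderiv 0 C * (ω.2 : MvPolynomial (Fin 3) ℂ) - pderiv 1 C * (ω.1 : MvPolynomial (Fin 3) ℂ)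
      = C * K}
  zero_mem' := ⟨0, by simp⟩
  add_mem' := by
    rintro a b ⟨K, hK⟩ ⟨L, hL⟩
    refine ⟨K + L, ?_⟩
    simp only [Prod.fst_add, Prod.snd_add, Submodule.coe_add]
    linear_combination hK + hL
  smul_mem' := by
    rintro c a ⟨K, hK⟩
    refine ⟨c • K, ?_⟩
    simp only [Prod.smul_fst, Prod.smul_snd, Submodule.coe_smul, mul_smul_comm, ← smul_sub, hK]

/-- The ideal `(C_x, C_y, C)` of the scheme `X ⊂ ℙ²`. -/
def singIdeal (C : MvPolynomial (Fin 3) ℂ) : Ideal (MvPolynomial (Fin 3) ℂ) :=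
  Ideal.span {pderiv 0 C, pderiv 1 C, C}

/-- The scheme `X ⊂ ℙ²` given by `C_x = C_y = C = 0` is finite of degree `t`: its
Hilbert polynomial is the constant `t`. -/
def SingSchemeFiniteOfDegree (C : MvPolynomial (Fin 3) ℂ) (t : ℕ) : Prop :=
  ∃ N : ℕ, ∀ n ≥ N,
    Module.finrank ℂ
      (Hom n ⧸ ((singIdeal C).restrictScalars ℂ).comap (Hom n).subtype) = t

/-- The expected dimension `δ`; the first summand is `0` if `e > d + 1`. -/
def expectedDim (d e t : ℕ) : ℤ :=
  ((d + 3 - e).choose 2 : ℤ) + ((d + 1).choose 2 : ℤ) - ((e : ℤ) - 1) ^ 2 + t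

/-- `B` is an equi-singular family of plane curves of degree `e` with modified Tjurina number `t`:
an irreducible (quasi-projective) variety in `ℙ(ℂ[x,y,z]_e)`, with a nonempty open subset over
which `X` is finite of degree `t`. -/
structure IsEquisingularFamily {e : ℕ} (B : Set (Curve e)) (t : ℕ) : Prop where
  isLocallyClosed : IsLocallyClosed B
  isIrreducible : IsIrreducible B
  exists_open : ∃ U : Set (Curve e), IsOpen U ∧ (B ∩ U).Nonempty ∧
    ∀ C ∈ B ∩ U, SingSchemeFiniteOfDegree C.eqn t

/-- `C` is an integral curve of `ω`. -/
def IsIntegralCurve {e d : ℕ} (C : Curve e) (ω : Form d) : Prop :=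
  ω.coeffs ∈ integralForms C.eqn d

/-- `C` is reduced and has no component at infinity. -/
def IsReducedAffine {e : ℕ} (C : Curve e) : Prop :=
  Squarefree C.eqn ∧ ¬ (X 2 ∣ C.eqn)

/-- The genericity conditions that only involve the curve: `C` is reduced, has no component at
infinity, `X` is finite of degree `t`, and `V_C(d)` has the expected dimension. -/
def IsGenericCurve {e : ℕ} (d t : ℕ) (C : Curve e) : Prop :=
  IsReducedAffine C ∧ SingSchemeFiniteOfDegree C.eqn t ∧
    (Module.finrank ℂ (integralForms C.eqn d) : ℤ) = expectedDim d e t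

/-- The pairs `(D, η)` of a member `D` of `B` and a form `η` of degree `d` with integral curve `D`. -/
def incidence {e : ℕ} (d : ℕ) (B : Set (Curve e)) : Set (CurveForm e d) :=
  {p | p.1 ∈ B ∧ IsIntegralCurve p.1 p.2}

/-- `Ω_B`: the forms of degree `d` (up to scaling) with at least one integral curve in `B`. -/
def formsOf {e : ℕ} (d : ℕ) (B : Set (Curve e)) : Set (Form d) :=
  {η | ∃ D ∈ B, IsIntegralCurve D η}

/-- The forms occurring in a set of pairs (image under the second projection). -/
def formsIn {e d : ℕ} (Z : Set (CurveForm e d)) : Set (Form d) :=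
  {η | ∃ D : Curve e, ((D, η) : CurveForm e d) ∈ Z}

/-- `Z` is an irreducible component of the subspace `F`. -/
def IsComponentOf {T : Type*} [TopologicalSpace T] (Z F : Set T) : Prop :=
  Maximal (fun S : Set T => IsIrreducible S ∧ S ⊆ F) Z

/-- The subspace `S` has (Krull) dimension `n`. -/
def HasDim {T : Type*} [TopologicalSpace T] (S : Set T) (n : ℕ) : Prop :=
  topologicalKrullDim S = (n : WithBot ℕ∞)

end PlaneForms

end

open MvPolynomial
noncomputable section
namespace PlaneForms

/-! ### Polynomial functions and polynomial maps -/

section PolynomialFunctions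

variable {E E' E'' : Type} [AddCommGroup E] [Module ℂ E] [AddCommGroup E'] [Module ℂ E']
  [AddCommGroup E''] [Module ℂ E'']

/-! Over the curves `D` where `dim V_D(d)` takes the constant value `δ`, the pairs form a
projectivized vector bundle. Two facts are needed: this locus is open in `B`, and the bundle does
not lose dimension when it is projected to the forms.

Openness. Kernel dimension is upper semicontinuous (`isOpen_finrank_le`), so `dim V_D(d) ≤ δ` near
`C`. The reverse inequality on all of `B` (`expectedDim_le_of_mem`) is the algebraic core. Write
`C_x = G A`, `C_y = G A'` with `A`, `A'` coprime of degree `a`. Separating a form from its cofactor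
gives `dim V_C(d) = dim R_(d-a) + dim J_(d+a-e)`, where `R` is the polynomial ring and `J = ((A, A')
: C)` (`finrank_integralForms_of_factorization`). The Hilbert function of `R/J` is nondecreasing,
because some linear form is a nonzerodivisor modulo `(A, A')` (`exists_linear_nonZeroDivisor`), and
in large degree it is determined by `t`. This bounds `dim V_C(d)` below by `δ`, except when `a = 0`
and `e ≥ d + 3`. In that case `dim V_C(d) < δ` (`finrank_lt_expectedDim`), so condition 5 at `C`
excludes it there, hence on a dense open subset of `B`. Semicontinuity then spreads the bound to
every member of `B`.

Component. The part of the incidence variety over this open locus is open and irreducible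
(`isIrreducible_bundle`, `isIrreducible_incidence`), and it contains `(C, ω)`. Its relative closure
is therefore the only component through that pair.

Dimension. Near `C` all curves are reduced and affine (`exists_forall_reduced`), so by condition 3
only finitely many of them are integral curves of `ω`. A single finite fibre makes the projection to
the forms generically finite, by Zariski's main theorem (`vdim_le_of_finite_fibre`). Counting on
affine cones gives `dim B + δ`, and projectivizing removes 1. Affine dimensions are transcendence
degrees of coordinate rings. They are compared with the Krull dimension of constructible sets in
`vdim_le_topologicalKrullDim` and `topologicalKrullDim_eq_vdim`.

The statement on `T` follows because `T` is irreducible and covered by two closed sets: the closure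
of the degenerate forms and the closure of the forms over the open locus. -/

theorem dual_mem_polynomialFunctions (l : Module.Dual ℂ E) :
    (fun v => l v) ∈ polynomialFunctions E :=
  Algebra.subset_adjoin ⟨l, rfl⟩

theorem const_mem_polynomialFunctions (c : ℂ) : (fun _ => c) ∈ polynomialFunctions E :=
  (polynomialFunctions E).algebraMap_mem c

theorem mul_mem_polynomialFunctions {f g : E → ℂ} (hf : f ∈ polynomialFunctions E)
    (hg : g ∈ polynomialFunctions E) : (fun v => f v * g v) ∈ polynomialFunctions E :=
  mul_mem hf hg

theorem polynomialFunctions_induction {P : (f : E → ℂ) → f ∈ polynomialFunctions E → Prop}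
    (dual : ∀ l : Module.Dual ℂ E, P (fun v => l v) (dual_mem_polynomialFunctions l))
    (const : ∀ c : ℂ, P (fun _ => c) (const_mem_polynomialFunctions c))
    (add : ∀ f g hf hg, P f hf → P g hg → P (fun v => f v + g v) (add_mem hf hg))
    (mul : ∀ f g hf hg, P f hf → P g hg → P (fun v => f v * g v) (mul_mem hf hg))
    {f : E → ℂ} (hf : f ∈ polynomialFunctions E) : P f hf := by
  induction hf using Algebra.adjoin_induction with
  | mem x hx => obtain ⟨l, rfl⟩ := hx; exact dual l
  | algebraMap r => exact const r
  | add x y hx hy h1 h2 => exact add x y hx hy h1 h2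
  | mul x y hx hy h1 h2 => exact mul x y hx hy h1 h2

/-- A map between vector spaces whose coordinates are polynomial functions. -/
def IsPolyMap (s : E → E') : Prop :=
  ∀ l : Module.Dual ℂ E', (fun v => l (s v)) ∈ polynomialFunctions E

theorem IsPolyMap.comp_mem {s : E → E'} (hs : IsPolyMap s) {f : E' → ℂ}
    (hf : f ∈ polynomialFunctions E') : (fun v => f (s v)) ∈ polynomialFunctions E := by
  induction hf using polynomialFunctions_induction with
  | dual l => exact hs l
  | const c => exact const_mem_polynomialFunctions c
  | add f g _ _ h1 h2 => exact add_mem h1 h2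
  | mul f g _ _ h1 h2 => exact mul_mem h1 h2

theorem isPolyMap_linear (s : E →ₗ[ℂ] E') : IsPolyMap s := fun l =>
  dual_mem_polynomialFunctions (l ∘ₗ s)

theorem isPolyMap_const (w : E') : IsPolyMap (fun _ : E => w) := fun l =>
  const_mem_polynomialFunctions (l w)

theorem IsPolyMap.add {s s' : E → E'} (hs : IsPolyMap s) (hs' : IsPolyMap s') :
    IsPolyMap (fun v => s v + s' v) := fun l => by
  simp only [map_add]; exact add_mem (hs l) (hs' l)

theorem IsPolyMap.sub {s s' : E → E'} (hs : IsPolyMap s) (hs' : IsPolyMap s') :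
    IsPolyMap (fun v => s v - s' v) := fun l => by
  simp only [map_sub]; exact sub_mem (hs l) (hs' l)

theorem IsPolyMap.smul {f : E → ℂ} (hf : f ∈ polynomialFunctions E) {s : E → E'}
    (hs : IsPolyMap s) : IsPolyMap (fun v => f v • s v) := fun l => by
  simp only [map_smul, smul_eq_mul]; exact mul_mem hf (hs l)

theorem IsPolyMap.comp {s : E' → E''} (hs : IsPolyMap s) {s' : E → E'} (hs' : IsPolyMap s') :
    IsPolyMap (fun v => s (s' v)) := fun l => hs'.comp_mem (hs l)

theorem IsPolyMap.prodMk {s : E → E'} (hs : IsPolyMap s) {s' : E → E''} (hs' : IsPolyMap s') :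
    IsPolyMap (fun v => (s v, s' v)) := fun l => by
  have : ∀ v, l (s v, s' v) = l.comp (LinearMap.inl ℂ E' E'') (s v)
      + l.comp (LinearMap.inr ℂ E' E'') (s' v) := fun v => by
    simp [← map_add]
  simp only [this]
  exact add_mem (hs _) (hs' _)

theorem exists_polynomial_on_line {f : E → ℂ} (hf : f ∈ polynomialFunctions E) (u w : E) :
    ∃ p : Polynomial ℂ, ∀ c, p.eval c = f (u + c • w) := by
  induction hf using polynomialFunctions_induction with
  | dual l =>
    exact ⟨Polynomial.C (l u) + Polynomial.C (l w) * Polynomial.X, fun c => by simp; ring⟩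
  | const c => exact ⟨Polynomial.C c, fun c => by simp⟩
  | add f g _ _ h1 h2 =>
    obtain ⟨p, hp⟩ := h1
    obtain ⟨q, hq⟩ := h2
    exact ⟨p + q, fun c => by simp [hp, hq]⟩
  | mul f g _ _ h1 h2 =>
    obtain ⟨p, hp⟩ := h1
    obtain ⟨q, hq⟩ := h2
    exact ⟨p * q, fun c => by simp [hp, hq]⟩

/-- Two polynomial functions that are not identically zero on a line have a common point of
non-vanishing on it, which can be chosen off a finite set. -/
theorem exists_ne_zero_on_line {f g : E → ℂ} (hf : f ∈ polynomialFunctions E)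
    (hg : g ∈ polynomialFunctions E) (u w : E) {a b : ℂ} (ha : f (u + a • w) ≠ 0)
    (hb : g (u + b • w) ≠ 0) :
    ∃ c : ℂ, c ≠ 0 ∧ f (u + c • w) ≠ 0 ∧ g (u + c • w) ≠ 0 := by
  obtain ⟨p, hp⟩ := exists_polynomial_on_line hf u w
  obtain ⟨q, hq⟩ := exists_polynomial_on_line hg u w
  have hp0 : p ≠ 0 := by rintro rfl; exact ha (by rw [← hp]; simp)
  have hq0 : q ≠ 0 := by rintro rfl; exact hb (by rw [← hq]; simp)
  have hne : Polynomial.X * (p * q) ≠ 0 := mul_ne_zero Polynomial.X_ne_zero (mul_ne_zero hp0 hq0)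
  obtain ⟨c, hc⟩ : ∃ c, (Polynomial.X * (p * q)).eval c ≠ 0 := by
    by_contra! h
    exact hne (Polynomial.funext (by simpa using h))
  simp only [Polynomial.eval_mul, Polynomial.eval_X, mul_ne_zero_iff, hp, hq] at hc
  exact ⟨c, hc.1, hc.2.1, hc.2.2⟩

/-- Clearing denominators after the substitution `w ↦ p w + μ(w)⁻¹ q w`. -/
theorem exists_homogenization (μ : Module.Dual ℂ E) (p q : E →ₗ[ℂ] E') {f : E' → ℂ}
    (hf : f ∈ polynomialFunctions E') :
    ∃ N : ℕ, ∃ F ∈ polynomialFunctions E,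
      ∀ w, μ w ≠ 0 → F w = μ w ^ N * f (p w + (μ w)⁻¹ • q w) := by
  have hμ : ∀ n : ℕ, (fun w => μ w ^ n) ∈ polynomialFunctions E := fun n =>
    pow_mem (dual_mem_polynomialFunctions μ) n
  induction hf using polynomialFunctions_induction with
  | dual l =>
    refine ⟨1, fun w => μ w * l (p w) + l (q w),
      add_mem (mul_mem (dual_mem_polynomialFunctions μ) (isPolyMap_linear p l))
        (isPolyMap_linear q l), fun w hw => ?_⟩
    simp only [map_add, map_smul, smul_eq_mul]
    field_simp
  | const c => exact ⟨0, fun _ => c, const_mem_polynomialFunctions c, fun w _ => by simp⟩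
  | add f g _ _ h1 h2 =>
    obtain ⟨N, F, hF, h1⟩ := h1
    obtain ⟨M, G, hG, h2⟩ := h2
    refine ⟨N + M, fun w => μ w ^ M * F w + μ w ^ N * G w,
      add_mem (mul_mem (hμ M) hF) (mul_mem (hμ N) hG), fun w hw => ?_⟩
    simp only [h1 w hw, h2 w hw]
    ring
  | mul f g _ _ h1 h2 =>
    obtain ⟨N, F, hF, h1⟩ := h1
    obtain ⟨M, G, hG, h2⟩ := h2
    refine ⟨N + M, fun w => F w * G w, mul_mem hF hG, fun w hw => ?_⟩
    simp only [h1 w hw, h2 w hw]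
    ring

end PolynomialFunctions

/-! ### The Zariski topology of a vector space -/

attribute [local instance] zariskiTopology

section Zariski

variable {E E' : Type} [AddCommGroup E] [Module ℂ E] [AddCommGroup E'] [Module ℂ E']

theorem isOpen_ne_zero {f : E → ℂ} (hf : f ∈ polynomialFunctions E) :
    IsOpen ({v | f v ≠ 0} : Set E) :=
  TopologicalSpace.isOpen_generateFrom_of_mem ⟨f, hf, rfl⟩

theorem exists_ne_zero_of_isOpen {U : Set E} (hU : IsOpen U) {v : E} (hv : v ∈ U) :
    ∃ f ∈ polynomialFunctions E, f v ≠ 0 ∧ ∀ w : E, f w ≠ 0 → w ∈ U := by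
  induction hU with
  | basic s hs => obtain ⟨f, hf, rfl⟩ := hs; exact ⟨f, hf, hv, fun w hw => hw⟩
  | univ => exact ⟨fun _ => 1, const_mem_polynomialFunctions 1, one_ne_zero, fun w _ => trivial⟩
  | inter s t _ _ h1 h2 =>
    obtain ⟨f, hf, hfv, hfs⟩ := h1 hv.1
    obtain ⟨g, hg, hgv, hgs⟩ := h2 hv.2
    refine ⟨fun w => f w * g w, mul_mem hf hg, mul_ne_zero hfv hgv, fun w hw => ?_⟩
    exact ⟨hfs w (left_ne_zero_of_mul hw), hgs w (right_ne_zero_of_mul hw)⟩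
  | sUnion S _ h =>
    obtain ⟨s, hs, hvs⟩ := hv
    obtain ⟨f, hf, hfv, hfs⟩ := h s hs hvs
    exact ⟨f, hf, hfv, fun w hw => ⟨s, hs, hfs w hw⟩⟩

theorem isOpen_zar_iff {U : Set E} : IsOpen U ↔
    ∀ v : E, v ∈ U → ∃ f ∈ polynomialFunctions E, f v ≠ 0 ∧ ∀ w : E, f w ≠ 0 → w ∈ U := by
  refine ⟨fun hU v hv => exists_ne_zero_of_isOpen hU hv, fun h => ?_⟩
  refine isOpen_iff_forall_mem_open.mpr fun v hv => ?_
  obtain ⟨f, hf, hfv, hfU⟩ := h v hv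
  exact ⟨{w | f w ≠ 0}, hfU, isOpen_ne_zero hf, hfv⟩

theorem mem_closure_zar_iff {S : Set E} {v : E} : v ∈ closure S ↔
    ∀ f ∈ polynomialFunctions E, (∀ s : E, s ∈ S → f s = 0) → f v = 0 := by
  rw [mem_closure_iff]
  refine ⟨fun h f hf hS => ?_, fun h o ho hv => ?_⟩
  · by_contra hfv
    obtain ⟨s, hs, hsS⟩ := h _ (isOpen_ne_zero hf) hfv
    exact hs (hS s hsS)
  · obtain ⟨f, hf, hfv, hfo⟩ := exists_ne_zero_of_isOpen ho hv
    by_contra hne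
    refine hfv (h f hf fun s hs => ?_)
    by_contra hfs
    exact hne ⟨s, hfo s hfs, hs⟩

theorem isPreirreducible_zar_iff {S : Set E} : IsPreirreducible S ↔
    ∀ f ∈ polynomialFunctions E, ∀ g ∈ polynomialFunctions E,
      (∃ v : E, v ∈ S ∧ f v ≠ 0) → (∃ v : E, v ∈ S ∧ g v ≠ 0) →
        ∃ v : E, v ∈ S ∧ f v ≠ 0 ∧ g v ≠ 0 := by
  refine ⟨fun h f hf g hg hfS hgS => ?_, fun h U V hU hV => ?_⟩
  · obtain ⟨v, hv, h1, h2⟩ := h _ _ (isOpen_ne_zero hf) (isOpen_ne_zero hg) hfS hgS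
    exact ⟨v, hv, h1, h2⟩
  · rintro ⟨v, hvS, hvU⟩ ⟨w, hwS, hwV⟩
    obtain ⟨f, hf, hfv, hfU⟩ := exists_ne_zero_of_isOpen hU hvU
    obtain ⟨g, hg, hgw, hgV⟩ := exists_ne_zero_of_isOpen hV hwV
    obtain ⟨x, hx, h1, h2⟩ := h f hf g hg ⟨v, hvS, hfv⟩ ⟨w, hwS, hgw⟩
    exact ⟨x, hx, hfU x h1, hgV x h2⟩

theorem IsPolyMap.continuous {s : E → E'} (hs : IsPolyMap s) :
    Continuous s := by
  refine continuous_generateFrom_iff.mpr ?_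
  rintro _ ⟨f, hf, rfl⟩
  exact isOpen_ne_zero (hs.comp_mem hf)

theorem isOpen_ne (E : Type) [AddCommGroup E] [Module ℂ E] : IsOpen ({v : E | v ≠ 0} : Set E) := by
  refine isOpen_zar_iff.mpr fun v hv => ?_
  obtain ⟨l, hl⟩ : ∃ l : Module.Dual ℂ E, l v ≠ 0 := by
    by_contra! h
    exact hv ((Module.forall_dual_apply_eq_zero_iff ℂ v).mp h)
  refine ⟨_, dual_mem_polynomialFunctions l, hl, ?_⟩
  rintro w hw rfl
  exact hw (map_zero l)

/-- Irreducibility is preserved by the rational map `w ↦ p w + μ(w)⁻¹ q w`. -/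
theorem isPreirreducible_normalization {S : Set E} (hS : IsPreirreducible S)
    (μ : Module.Dual ℂ E) (p q : E →ₗ[ℂ] E') :
    IsPreirreducible ({v | ∃ w : E, w ∈ S ∧ μ w ≠ 0 ∧ v = p w + (μ w)⁻¹ • q w} : Set E') := by
  rw [isPreirreducible_zar_iff] at hS ⊢
  rintro f hf g hg ⟨_, ⟨v, hv, hμv, rfl⟩, hfv⟩ ⟨_, ⟨w, hw, hμw, rfl⟩, hgw⟩
  obtain ⟨N, F, hF, hNF⟩ := exists_homogenization μ p q hf
  obtain ⟨M, G, hG, hMG⟩ := exists_homogenization μ p q hg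
  obtain ⟨x, hx, h1, h2⟩ := hS _ (mul_mem (dual_mem_polynomialFunctions μ) hF) _ hG
    ⟨v, hv, mul_ne_zero hμv (by rw [hNF v hμv]; exact mul_ne_zero (pow_ne_zero _ hμv) hfv)⟩
    ⟨w, hw, by rw [hMG w hμw]; exact mul_ne_zero (pow_ne_zero _ hμw) hgw⟩
  have hμx : μ x ≠ 0 := left_ne_zero_of_mul h1
  have h1' : F x ≠ 0 := right_ne_zero_of_mul h1
  rw [hNF x hμx] at h1'
  rw [hMG x hμx] at h2
  exact ⟨_, ⟨x, hx, hμx, rfl⟩, right_ne_zero_of_mul h1', right_ne_zero_of_mul h2⟩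

end Zariski

end PlaneForms

end

open MvPolynomial
noncomputable section
namespace PlaneForms

/-! ### Dimension theory of finitely generated algebras -/

section Algebras

open Cardinal Algebra

/-- Incomparability keeps chains of `B` strict after contraction; lying over and going up lift
chains of `A`. -/
theorem ringKrullDim_eq_of_isIntegral {A B : Type*} [CommRing A] [CommRing B] [IsDomain B] [Algebra A B]
    [Algebra.IsIntegral A B] (h : Function.Injective (algebraMap A B)) :
    ringKrullDim B = ringKrullDim A := by
  refine le_antisymm ?_ ?_
  · refine Order.krullDim_le_of_strictMono (PrimeSpectrum.comap (algebraMap A B)) ?_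
    intro P Q hPQ
    exact Ideal.IsIntegral.comap_lt_comap (R := A) hPQ
  · refine iSup_le fun l => ?_
    obtain ⟨P, hP, hPl⟩ := Ideal.exists_ideal_over_prime_of_isIntegral_of_isDomain (S := B)
      l.head.asIdeal (by rw [(RingHom.injective_iff_ker_eq_bot _).mp h]; exact bot_le)
    have : P.LiesOver l.head.asIdeal := ⟨hPl.symm⟩
    obtain ⟨L, hL, -⟩ := Ideal.exists_ltSeries_of_hasGoingUp l P
    rw [← hL]
    exact Order.LTSeries.length_le_krullDim L

/-- By Noether normalization `A` is integral over a polynomial ring, where both invariants count the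
variables. -/
theorem ringKrullDim_eq_trdeg (A : Type) [CommRing A] [IsDomain A] [Algebra ℂ A]
    [Algebra.FiniteType ℂ A] : ringKrullDim A = ((Algebra.trdeg ℂ A).toNat : WithBot ℕ∞) := by
  obtain ⟨s, g, ginj, gint⟩ := exists_integral_inj_algHom_of_fg ℂ A
  let := g.toRingHom.toAlgebra
  have : IsScalarTower ℂ (MvPolynomial (Fin s) ℂ) A :=
    IsScalarTower.of_algebraMap_eq fun x => (g.commutes x).symm
  have : Algebra.IsIntegral (MvPolynomial (Fin s) ℂ) A := ⟨gint⟩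
  have hinj : Function.Injective (algebraMap (MvPolynomial (Fin s) ℂ) A) := ginj
  have : FaithfulSMul (MvPolynomial (Fin s) ℂ) A :=
    (faithfulSMul_iff_algebraMap_injective _ _).mpr hinj
  rw [ringKrullDim_eq_of_isIntegral hinj, MvPolynomial.ringKrullDim_of_isNoetherianRing,
    ringKrullDim_eq_zero_of_field, ← trdeg_add_eq ℂ (MvPolynomial (Fin s) ℂ) (A := A),
    MvPolynomial.trdeg_of_isDomain, _root_.trdeg_eq_zero]
  simp

theorem toNat_trdeg_le_of_injective {A B : Type} [CommRing A] [CommRing B] [IsDomain B]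
    [Algebra ℂ A] [Algebra ℂ B] [Algebra.FiniteType ℂ B] (f : A →ₐ[ℂ] B)
    (hf : Function.Injective f) :
    (Algebra.trdeg ℂ A).toNat ≤ (Algebra.trdeg ℂ B).toNat :=
  Cardinal.toNat_le_toNat (trdeg_le_of_injective f hf) trdeg_lt_aleph0_of_finiteType

theorem trdeg_mvPolynomial (A : Type) [CommRing A] [IsDomain A] [Algebra ℂ A]
    [Algebra.FiniteType ℂ A] (ι : Type) [Fintype ι] :
    (Algebra.trdeg ℂ (MvPolynomial ι A)).toNat = (Algebra.trdeg ℂ A).toNat + Fintype.card ι := by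
  rw [← trdeg_add_eq ℂ A (A := MvPolynomial ι A), MvPolynomial.trdeg_of_isDomain,
    Cardinal.toNat_add trdeg_lt_aleph0_of_finiteType (by simp)]
  simp

/-- A proper ideal of a finitely generated algebra vanishes at some point. -/
theorem exists_algHom_of_ne_top {A : Type*} [CommRing A] [Algebra ℂ A] [Algebra.FiniteType ℂ A]
    {I : Ideal A} (hI : I ≠ ⊤) : ∃ ψ : A →ₐ[ℂ] ℂ, ∀ x ∈ I, ψ x = 0 := by
  obtain ⟨M, hM, hIM⟩ := Ideal.exists_le_maximal I hI
  let : Field (A ⧸ M) := Ideal.Quotient.field M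
  have : Module.Finite ℂ (A ⧸ M) := finite_of_finite_type_of_isJacobsonRing ℂ (A ⧸ M)
  let e : ℂ ≃ₐ[ℂ] (A ⧸ M) := AlgEquiv.ofBijective (Algebra.ofId ℂ (A ⧸ M))
    IsAlgClosed.algebraMap_bijective_of_isIntegral
  refine ⟨(e.symm : (A ⧸ M) →ₐ[ℂ] ℂ).comp (Ideal.Quotient.mkₐ ℂ M), fun x hx => ?_⟩
  have : Ideal.Quotient.mk M x = 0 := Ideal.Quotient.eq_zero_iff_mem.mpr (hIM hx)
  simp [this]

/-- The Nullstellensatz for primes. -/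
theorem exists_algHom_of_notMem {A : Type*} [CommRing A] [Algebra ℂ A] [Algebra.FiniteType ℂ A]
    {P : Ideal A} (hP : P.IsPrime) {x : A} (hx : x ∉ P) :
    ∃ ψ : A →ₐ[ℂ] ℂ, (∀ y ∈ P, ψ y = 0) ∧ ψ x ≠ 0 := by
  -- Rabinowitsch's trick: after inverting `x` the prime `P` still generates a proper ideal, and no
  -- point of the localization kills `x`.
  let L := Localization.Away x
  have : Algebra.FiniteType A L := IsLocalization.finiteType_of_monoid_fg (Submonoid.powers x) L
  have : Algebra.FiniteType ℂ L := Algebra.FiniteType.trans (S := A) ‹_› ‹_›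
  have hne : P.map (algebraMap A L) ≠ ⊤ := by
    refine (IsLocalization.isPrime_of_isPrime_disjoint (Submonoid.powers x) L P hP ?_).ne_top
    exact (Ideal.disjoint_powers_iff_notMem x hP.isRadical).mpr hx
  obtain ⟨ψ, hψ⟩ := exists_algHom_of_ne_top hne
  refine ⟨ψ.comp (IsScalarTower.toAlgHom ℂ A L),
    fun y hy => hψ _ (Ideal.mem_map_of_mem _ hy), ?_⟩
  exact ((IsLocalization.Away.algebraMap_isUnit (S := L) x).map ψ).ne_zero

/-- Points of a dense open subset lift along an injective homomorphism of finite type. -/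
theorem exists_ne_zero_forall_algHom_lift {A B : Type} [CommRing A] [CommRing B] [IsDomain A]
    [IsDomain B] [Algebra ℂ A] [Algebra ℂ B] [Algebra A B] [IsScalarTower ℂ A B]
    [Algebra.FiniteType ℂ A] [Algebra.FiniteType ℂ B]
    (hinj : Function.Injective (algebraMap A B)) {f : B} (hf : f ≠ 0) :
    ∃ a : A, a ≠ 0 ∧ ∀ φ : A →ₐ[ℂ] ℂ, φ a ≠ 0 →
      ∃ ψ : B →ₐ[ℂ] ℂ, (∀ x, ψ (algebraMap A B x) = φ x) ∧ ψ f ≠ 0 := by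
  have : IsNoetherianRing A := Algebra.FiniteType.isNoetherianRing ℂ A
  have : Algebra.FiniteType A B := .of_restrictScalars_finiteType ℂ A B
  have hfp : (algebraMap A B).FinitePresentation :=
    RingHom.finitePresentation_algebraMap.mpr (Algebra.FinitePresentation.of_finiteType.mp ‹_›)
  -- By Chevalley the image of `D(f)` is constructible. It contains the generic point, so in one of
  -- its pieces all equations are zero and only an inequation `D.f ≠ 0` remains; that `D.f` serves
  -- as `a`.
  obtain ⟨S, hS⟩ := PrimeSpectrum.exists_constructibleSetData_iff.mpr
    (PrimeSpectrum.isConstructible_comap_image hfp (PrimeSpectrum.isConstructible_basicOpen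
      (R := B) (f := f)))
  have hmem : (⟨⊥, Ideal.isPrime_bot⟩ : PrimeSpectrum A) ∈ S.toSet := by
    rw [hS]
    refine ⟨⟨⊥, Ideal.isPrime_bot⟩, by simpa [PrimeSpectrum.mem_basicOpen] using hf, ?_⟩
    ext x
    simp [hinj.eq_iff' (map_zero _)]
  simp only [PrimeSpectrum.ConstructibleSetData.toSet, Set.mem_iUnion] at hmem
  obtain ⟨D, hD, hDmem⟩ := hmem
  obtain ⟨h1, h2⟩ := hDmem
  refine ⟨D.f, by simpa using h2, fun φ hφ => ?_⟩
  have hker : (⟨RingHom.ker φ, RingHom.ker_isPrime φ⟩ : PrimeSpectrum A) ∈ S.toSet := by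
    simp only [PrimeSpectrum.ConstructibleSetData.toSet, Set.mem_iUnion]
    refine ⟨D, hD, ?_, by simpa [RingHom.mem_ker] using hφ⟩
    rintro _ ⟨i, rfl⟩
    have := h1 ⟨i, rfl⟩
    have : D.g i = 0 := by simpa using this
    simp [this]
  rw [hS] at hker
  obtain ⟨P, hP, hPφ⟩ := hker
  obtain ⟨ψ, hψ, hψf⟩ := exists_algHom_of_notMem P.isPrime hP
  refine ⟨ψ, fun x => ?_, hψf⟩
  have hx : x - algebraMap ℂ A (φ x) ∈ (PrimeSpectrum.comap (algebraMap A B) P).asIdeal := by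
    rw [hPφ]
    simp [RingHom.mem_ker]
  have := hψ _ hx
  rwa [map_sub, map_sub, ← IsScalarTower.algebraMap_apply, AlgHom.commutes, sub_eq_zero] at this

theorem ker_algHom_inj {A : Type*} [CommRing A] [Algebra ℂ A] {ψ ψ' : A →ₐ[ℂ] ℂ}
    (h : RingHom.ker ψ ≤ RingHom.ker ψ') : ψ = ψ' := by
  ext x
  have hx : x - algebraMap ℂ A (ψ x) ∈ RingHom.ker ψ := by simp [RingHom.mem_ker]
  have := h hx
  rw [RingHom.mem_ker, map_sub, AlgHom.commutes, sub_eq_zero] at this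
  exact this.symm

/-- An extension of domains that has an isolated point in some fibre is algebraic. -/
theorem isAlgebraic_of_finite_fibre {A B : Type} [CommRing A] [CommRing B]
    [IsDomain B] [Algebra ℂ A] [Algebra ℂ B] [Algebra A B] [IsScalarTower ℂ A B]
    [Algebra.FiniteType ℂ B]
    (hinj : Function.Injective (algebraMap A B)) {f : B} (ψ₀ : B →ₐ[ℂ] ℂ) (hf : ψ₀ f ≠ 0)
    (hfin : {ψ : B →ₐ[ℂ] ℂ | (∀ x, ψ (algebraMap A B x) = ψ₀ (algebraMap A B x)) ∧
      ψ f ≠ 0}.Finite) : Algebra.IsAlgebraic A B := by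
  classical
  have : IsDomain A := hinj.isDomain _
  have : Algebra.FiniteType A B := .of_restrictScalars_finiteType ℂ A B
  let q : PrimeSpectrum B := ⟨RingHom.ker ψ₀, RingHom.ker_isPrime ψ₀⟩
  set T : Finset (B →ₐ[ℂ] ℂ) := hfin.toFinset with hT
  -- Separating functions for the finitely many other points of the fibre. Multiplied into `f` they
  -- give a `g` whose basic open set meets the fibre in `q` alone.
  have hsep : ∀ ψ : B →ₐ[ℂ] ℂ, ∃ b : B, ψ₀ b ≠ 0 ∧ (ψ ≠ ψ₀ → ψ b = 0) := by
    intro ψ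
    by_cases h : ψ = ψ₀
    · exact ⟨1, by simp, fun h' => (h' h).elim⟩
    · have := mt ker_algHom_inj h
      obtain ⟨b, hb, hb'⟩ := SetLike.not_le_iff_exists.mp this
      exact ⟨b, hb', fun _ => hb⟩
  choose b hb hb' using hsep
  let g : B := f * ∏ ψ ∈ T, b ψ
  have hq : ∀ P : PrimeSpectrum B,
      P.comap (algebraMap A B) = q.comap (algebraMap A B) → g ∉ P.asIdeal → P = q := by
    intro P hPq hg
    have hfP : f ∉ P.asIdeal := fun h => hg (Ideal.mul_mem_right _ _ h)
    have hbP : ∀ ψ ∈ T, b ψ ∉ P.asIdeal := fun ψ hψ h =>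
      hg (Ideal.mul_mem_left _ _ (Ideal.mem_of_dvd _ (Finset.dvd_prod_of_mem b hψ) h))
    -- By the Nullstellensatz `P` contains the intersection of the kernels of those points of the
    -- fibre off `f = 0` that lie on `P`. There are finitely many, so the prime `P` equals one of
    -- these kernels.
    have hle : (T.filter fun ψ => P.asIdeal ≤ RingHom.ker ψ).inf (fun ψ => RingHom.ker ψ)
        ≤ P.asIdeal := by
      intro x hx
      by_contra hxP
      obtain ⟨ψ, hψ, hψx⟩ := exists_algHom_of_notMem P.isPrime
        (fun h => (P.isPrime.mem_or_mem h).elim hxP hfP : x * f ∉ P.asIdeal)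
      rw [map_mul] at hψx
      refine left_ne_zero_of_mul hψx ?_
      have hmem : ψ ∈ T.filter fun ψ => P.asIdeal ≤ RingHom.ker ψ := by
        simp only [Finset.mem_filter, hT, Set.Finite.mem_toFinset]
        refine ⟨⟨fun y => ?_, right_ne_zero_of_mul hψx⟩, hψ⟩
        have hy : y - algebraMap ℂ A (ψ₀ (algebraMap A B y)) ∈
            (q.comap (algebraMap A B)).asIdeal := by
          change ψ₀ (algebraMap A B _) = 0
          rw [map_sub, map_sub, ← IsScalarTower.algebraMap_apply, AlgHom.commutes]
          exact sub_self _
        rw [← hPq] at hy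
        have := hψ _ hy
        rwa [map_sub, map_sub, ← IsScalarTower.algebraMap_apply, AlgHom.commutes,
          sub_eq_zero] at this
      exact (Submodule.mem_finsetInf.mp hx) ψ hmem
    obtain ⟨ψ, hψ, hψP⟩ := (P.isPrime.inf_le').mp hle
    rw [Finset.mem_filter] at hψ
    have hψ0 : ψ = ψ₀ := by
      by_contra h
      exact hbP ψ hψ.1 (hψP (hb' ψ h))
    refine PrimeSpectrum.ext (le_antisymm ?_ ?_)
    · rw [hψ0] at hψ; exact hψ.2
    · rw [hψ0] at hψP; exact hψP
  have hgq : g ∉ q.asIdeal := by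
    change ¬ ψ₀ g = 0
    rw [map_mul, map_prod]
    exact mul_ne_zero hf (Finset.prod_ne_zero_iff.mpr fun ψ _ => hb ψ)
  have hopen : IsOpen (X := PrimeSpectrum.comap (algebraMap A B) ⁻¹'
      {q.comap (algebraMap A B)}) {⟨q, rfl⟩} := by
    have : ({⟨q, rfl⟩} : Set (PrimeSpectrum.comap (algebraMap A B) ⁻¹'
        {q.comap (algebraMap A B)})) =
        Subtype.val ⁻¹' (PrimeSpectrum.basicOpen g : Set (PrimeSpectrum B)) := by
      ext ⟨P, hP⟩
      simp only [Set.mem_singleton_iff, Set.mem_preimage, SetLike.mem_coe,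
        PrimeSpectrum.mem_basicOpen]
      refine ⟨fun h => ?_, fun h => Subtype.ext (hq P hP h)⟩
      obtain rfl : P = q := congrArg Subtype.val h
      exact hgq
    rw [this]
    exact (PrimeSpectrum.basicOpen g).isOpen.preimage continuous_subtype_val
  -- An isolated point of its fibre is a point of quasi-finiteness. Zariski's main theorem then
  -- gives an integral `r ∉ q` such that every `x` becomes integral after multiplication by a power
  -- of `r`; since `r ≠ 0`, every `x` is algebraic.
  have := Algebra.QuasiFiniteAt.of_isOpen_singleton_fiber q hopen
  have := q.isPrime
  obtain ⟨r, hr, hri, hrx⟩ := Algebra.zariskisMainProperty_iff.mp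
    (Algebra.ZariskisMainProperty.of_finiteType (R := A) q.asIdeal)
  refine ⟨fun x => ?_⟩
  obtain ⟨m, hm⟩ := hrx x
  have hr0 : r ≠ 0 := by rintro rfl; exact hr (Ideal.zero_mem _)
  exact IsAlgebraic.of_mul (mem_nonZeroDivisors_of_ne_zero (pow_ne_zero m hr0))
    (hri.pow m).isAlgebraic hm.isAlgebraic

theorem trdeg_eq_of_isAlgebraic {A B : Type} [CommRing A] [CommRing B] [IsDomain B] [Algebra ℂ A]
    [Algebra ℂ B] [Algebra A B] [IsScalarTower ℂ A B] [Algebra.IsAlgebraic A B]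
    (hinj : Function.Injective (algebraMap A B)) : Algebra.trdeg ℂ B = Algebra.trdeg ℂ A := by
  have := hinj.isDomain
  have : FaithfulSMul A B := (faithfulSMul_iff_algebraMap_injective _ _).mpr hinj
  rw [← trdeg_add_eq ℂ A (A := B), _root_.trdeg_eq_zero (R := A), add_zero]

theorem trdeg_eq_of_bijective {A B : Type} [CommRing A] [CommRing B] [Algebra ℂ A] [Algebra ℂ B]
    (f : A →ₐ[ℂ] B) (hf : Function.Bijective f) : Algebra.trdeg ℂ A = Algebra.trdeg ℂ B :=
  (AlgEquiv.ofBijective f hf).trdeg_eq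

end Algebras

end PlaneForms

end

open MvPolynomial
noncomputable section
namespace PlaneForms
attribute [local instance] zariskiTopology

/-! ### Coordinate rings -/

section CoordRing

variable {E E' : Type} [AddCommGroup E] [Module ℂ E] [AddCommGroup E'] [Module ℂ E']

/-- Pullback of functions. -/
def pullFun {S T : Type} (φ : S → T) : (T → ℂ) →ₐ[ℂ] (S → ℂ) where
  toFun f s := f (φ s)
  map_one' := rfl
  map_mul' _ _ := rfl
  map_zero' := rfl
  map_add' _ _ := rfl
  commutes' _ := rfl

/-- The ring of polynomial functions on a subset of a vector space. -/
def coordRing (S : Set E) : Subalgebra ℂ (S → ℂ) :=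
  (polynomialFunctions E).map (pullFun Subtype.val)

theorem exists_of_mem_coordRing {S : Set E} (g : coordRing S) :
    ∃ f ∈ polynomialFunctions E, ∀ s : S, (g : S → ℂ) s = f s := by
  obtain ⟨f, hf, hfg⟩ := g.2
  exact ⟨f, hf, fun s => (congrFun hfg s).symm⟩

/-- The pullback of polynomial functions along a polynomial map. -/
def pullback (S : Set E) {φ : E → E'} (hφ : IsPolyMap φ) :
    polynomialFunctions E' →ₐ[ℂ] coordRing S :=
  ((pullFun (fun s : S => φ s)).comp (polynomialFunctions E').val).codRestrict _ (by
    rintro ⟨f, hf⟩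
    exact ⟨_, hφ.comp_mem hf, rfl⟩)

theorem isPolyMap_id : IsPolyMap (fun v : E => v) := isPolyMap_linear LinearMap.id

/-- Restriction of polynomial functions to a subset. -/
abbrev res (S : Set E) : polynomialFunctions E →ₐ[ℂ] coordRing S := pullback S isPolyMap_id

theorem res_surjective (S : Set E) : Function.Surjective (res S) := fun g => by
  obtain ⟨f, hf, h⟩ := exists_of_mem_coordRing g
  exact ⟨⟨f, hf⟩, Subtype.ext (funext fun s => (h s).symm)⟩

theorem polynomialFunctions_fg [FiniteDimensional ℂ E] : (polynomialFunctions E).FG := by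
  classical
  let b := Module.finBasis ℂ E
  refine ⟨Finset.univ.image fun i => fun v => b.coord i v, le_antisymm ?_ ?_⟩
  · refine Algebra.adjoin_le ?_
    intro f hf
    obtain ⟨i, -, rfl⟩ := Finset.mem_image.mp hf
    exact dual_mem_polynomialFunctions (b.coord i)
  · refine Algebra.adjoin_le ?_
    rintro _ ⟨l, rfl⟩
    have : (fun v => l v) = ∑ i, l (b i) • fun v => b.coord i v := by
      ext v
      rw [Finset.sum_apply]
      nth_rewrite 1 [← b.sum_repr v]
      simp only [map_sum, map_smul, smul_eq_mul, mul_comm, Pi.smul_apply,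
        Module.Basis.coord_apply]
    rw [this]
    exact sum_mem fun i _ => Subalgebra.smul_mem _
      (Algebra.subset_adjoin (by simp)) _

instance [FiniteDimensional ℂ E] : Algebra.FiniteType ℂ (polynomialFunctions E) :=
  (polynomialFunctions E).fg_iff_finiteType.mp polynomialFunctions_fg

instance [FiniteDimensional ℂ E] (S : Set E) : Algebra.FiniteType ℂ (coordRing S) :=
  Algebra.FiniteType.of_surjective (res S) (res_surjective S)

theorem isDomain_coordRing {S : Set E} (hS : IsIrreducible S) : IsDomain (coordRing S) := by
  obtain ⟨v, hv⟩ := hS.nonempty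
  have : Nontrivial (coordRing S) := ⟨0, 1, fun h => by
    simpa using congrFun (congrArg Subtype.val h) ⟨v, hv⟩⟩
  have : NoZeroDivisors (coordRing S) := by
    refine ⟨fun {a b} hab => ?_⟩
    obtain ⟨f, hf, hfa⟩ := exists_of_mem_coordRing a
    obtain ⟨g, hg, hgb⟩ := exists_of_mem_coordRing b
    by_contra! h
    have h1 : ∃ v : E, v ∈ S ∧ f v ≠ 0 := by
      by_contra! h'
      exact h.1 (Subtype.ext (funext fun s => by rw [hfa]; exact h' s s.2))
    have h2 : ∃ v : E, v ∈ S ∧ g v ≠ 0 := by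
      by_contra! h'
      exact h.2 (Subtype.ext (funext fun s => by rw [hgb]; exact h' s s.2))
    obtain ⟨x, hx, hfx, hgx⟩ := isPreirreducible_zar_iff.mp hS.2 f hf g hg h1 h2
    have := congrFun (congrArg Subtype.val hab) ⟨x, hx⟩
    change (a : S → ℂ) ⟨x, hx⟩ * (b : S → ℂ) ⟨x, hx⟩ = 0 at this
    rw [hfa, hgb] at this
    exact mul_ne_zero hfx hgx this
  exact NoZeroDivisors.to_isDomain _

theorem exists_algHom_of_ker_eq {R A B : Type} [CommRing R] [CommRing A] [CommRing B]
    [Algebra ℂ R] [Algebra ℂ A] [Algebra ℂ B] (f : R →ₐ[ℂ] A) (g : R →ₐ[ℂ] B)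
    (hf : Function.Surjective f) (h : ∀ x, f x = 0 ↔ g x = 0) :
    ∃ u : A →ₐ[ℂ] B, Function.Injective u ∧ ∀ x, u (f x) = g x := by
  let e := Ideal.quotientKerAlgEquivOfSurjective hf
  have hg : ∀ x ∈ RingHom.ker f, g x = 0 := fun x hx => (h x).mp hx
  let u := (Ideal.Quotient.liftₐ (RingHom.ker f) g hg).comp (e.symm : A →ₐ[ℂ] _)
  have hu : ∀ x, u (f x) = g x := fun x => by
    have : e.symm (f x) = Ideal.Quotient.mk _ x := by
      rw [AlgEquiv.symm_apply_eq]
      exact (Ideal.quotientKerAlgEquivOfSurjective_mk hf x).symm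
    change Ideal.Quotient.liftₐ (RingHom.ker f) g hg (e.symm (f x)) = g x
    rw [this]
    rfl
  refine ⟨u, (injective_iff_map_eq_zero _).mpr fun a ha => ?_, hu⟩
  obtain ⟨x, rfl⟩ := hf a
  rw [hu] at ha
  exact (h x).mpr ha

theorem forall_eq_zero_of_closure_eq {S T : Set E} (h : closure S = closure T) {f : E → ℂ}
    (hf : f ∈ polynomialFunctions E) (hT : ∀ t ∈ T, f t = 0) : ∀ s ∈ S, f s = 0 := fun _ hs =>
  mem_closure_zar_iff.mp (h ▸ subset_closure hs) f hf hT

/-- A polynomial function vanishes on a set exactly when it vanishes on its closure, so restriction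
to `S'` and pullback to `S` have the same kernel. Dominance thus becomes an inclusion of coordinate
rings. -/
theorem exists_pullback {S : Set E} {S' : Set E'} {φ : E → E'} (hφ : IsPolyMap φ)
    (hcl : closure S' = closure (φ '' S)) :
    ∃ u : coordRing S' →ₐ[ℂ] coordRing S, Function.Injective u ∧
      ∀ f, u (res S' f) = pullback S hφ f := by
  refine exists_algHom_of_ker_eq _ _ (res_surjective S') fun f => ⟨fun h => ?_, fun h => ?_⟩
  · refine Subtype.ext (funext fun s => ?_)
    exact forall_eq_zero_of_closure_eq hcl.symm f.2
      (fun t ht => congrFun (congrArg Subtype.val h) ⟨t, ht⟩) _ ⟨s, s.2, rfl⟩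
  · refine Subtype.ext (funext fun s => ?_)
    refine forall_eq_zero_of_closure_eq hcl f.2 ?_ _ s.2
    rintro _ ⟨t, ht, rfl⟩
    exact congrFun (congrArg Subtype.val h) ⟨t, ht⟩

/-- The dimension of (the closure of) an irreducible subset of a vector space. -/
def vdim (S : Set E) : ℕ := (Algebra.trdeg ℂ (coordRing S)).toNat

theorem ringKrullDim_coordRing [FiniteDimensional ℂ E] {S : Set E} (hS : IsIrreducible S) :
    ringKrullDim (coordRing S) = (vdim S : WithBot ℕ∞) := by
  have := isDomain_coordRing hS
  exact ringKrullDim_eq_trdeg _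

theorem vdim_le_of_dominant [FiniteDimensional ℂ E] {S : Set E} {S' : Set E'}
    (hS : IsIrreducible S) {φ : E → E'} (hφ : IsPolyMap φ)
    (hcl : closure S' = closure (φ '' S)) : vdim S' ≤ vdim S := by
  have := isDomain_coordRing hS
  obtain ⟨u, hu, -⟩ := exists_pullback hφ hcl
  exact toNat_trdeg_le_of_injective u hu

theorem vdim_eq_of_closure_eq [FiniteDimensional ℂ E] {S S' : Set E}
    (hS : IsIrreducible S) (hS' : IsIrreducible S') (hcl : closure S = closure S') :
    vdim S = vdim S' :=
  le_antisymm (vdim_le_of_dominant hS' isPolyMap_id (by simpa using hcl))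
    (vdim_le_of_dominant hS isPolyMap_id (by simpa using hcl.symm))

/-- The values of `ψ` on linear forms are a functional on the dual space, hence evaluation at a
vector `y` by reflexivity. It lies in the closure because `ψ` kills whatever vanishes on `S`. -/
theorem exists_eval_eq [FiniteDimensional ℂ E] {S : Set E} (ψ : coordRing S →ₐ[ℂ] ℂ) :
    ∃ y : E, y ∈ closure S ∧ ∀ f, ψ (res S f) = (f : E → ℂ) y := by
  let ev : Module.Dual ℂ (Module.Dual ℂ E) :=
    { toFun := fun l => ψ (res S ⟨_, dual_mem_polynomialFunctions l⟩)
      map_add' := fun l m => by rw [← map_add, ← map_add]; rfl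
      map_smul' := fun c l => by
        rw [RingHom.id_apply, smul_eq_mul, ← smul_eq_mul, ← map_smul, ← map_smul]; rfl }
  obtain ⟨y, hy⟩ := (Module.evalEquiv ℂ E).surjective ev
  have key : ∀ f (hf : f ∈ polynomialFunctions E), ψ (res S ⟨f, hf⟩) = f y := by
    intro f hf
    induction hf using polynomialFunctions_induction with
    | dual l =>
      have := congrArg (fun z => z l) hy
      simpa [ev] using this.symm
    | const c => exact AlgHom.commutes (ψ.comp (res S)) c
    | add f g hf hg h1 h2 =>
      change _ = f y + g y
      rw [← h1, ← h2, ← map_add, ← map_add]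
      rfl
    | mul f g hf hg h1 h2 =>
      change _ = f y * g y
      rw [← h1, ← h2, ← map_mul, ← map_mul]
      rfl
  refine ⟨y, mem_closure_zar_iff.mpr fun f hf hS => ?_, fun f => key f f.2⟩
  rw [← key f hf]
  have : res S ⟨f, hf⟩ = 0 := Subtype.ext (funext fun s => hS s s.2)
  rw [this, map_zero]

theorem exists_ne_zero_of_isLocallyClosed {S : Set E} (hS : IsLocallyClosed S) {x : E}
    (hx : x ∈ S) : ∃ f ∈ polynomialFunctions E, f x ≠ 0 ∧ ∀ y ∈ closure S, f y ≠ 0 → y ∈ S := by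
  obtain ⟨U, V, hU, hV, rfl⟩ := hS
  obtain ⟨f, hf, hfx, hfU⟩ := exists_ne_zero_of_isOpen hU hx.1
  refine ⟨f, hf, hfx, fun y hy hfy => ⟨hfU y hfy, ?_⟩⟩
  exact closure_minimal Set.inter_subset_right hV hy

/-- One finite fibre suffices, since it makes the extension of coordinate rings algebraic. Local
closedness provides an `f` off whose zero set the points of the closure already belong to `S`, so
the fibre of algebra homomorphisms with `f ≠ 0` is no larger than the fibre of points. -/
theorem vdim_le_of_finite_fibre [FiniteDimensional ℂ E] [FiniteDimensional ℂ E'] {S : Set E}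
    (hS : IsIrreducible S) (hS' : IsLocallyClosed S) {φ : E → E'} (hφ : IsPolyMap φ) {x : E}
    (hx : x ∈ S) (hfin : {y | y ∈ S ∧ φ y = φ x}.Finite) : vdim S ≤ vdim (φ '' S) := by
  obtain ⟨u, hu, hu'⟩ := exists_pullback (S := S) (S' := φ '' S) hφ rfl
  have := isDomain_coordRing hS
  let := u.toRingHom.toAlgebra
  have : IsScalarTower ℂ (coordRing (φ '' S)) (coordRing S) :=
    IsScalarTower.of_algebraMap_eq fun x => (u.commutes x).symm
  have hinj : Function.Injective (algebraMap (coordRing (φ '' S)) (coordRing S)) := hu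
  obtain ⟨f, hf, hfx, hfS⟩ := exists_ne_zero_of_isLocallyClosed hS' hx
  let ψ₀ : coordRing S →ₐ[ℂ] ℂ :=
    (Pi.evalAlgHom ℂ (fun _ : S => ℂ) ⟨x, hx⟩).comp (coordRing S).val
  have halg : Algebra.IsAlgebraic (coordRing (φ '' S)) (coordRing S) := by
    refine isAlgebraic_of_finite_fibre hinj (f := res S ⟨f, hf⟩) ψ₀ hfx ?_
    choose pt hpt hpt' using fun ψ : coordRing S →ₐ[ℂ] ℂ => exists_eval_eq ψ
    refine Set.Finite.of_injOn (f := pt) (t := {y | y ∈ S ∧ φ y = φ x}) ?_ ?_ hfin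
    · rintro ψ ⟨h1, h2⟩
      rw [hpt'] at h2
      refine ⟨hfS _ (hpt ψ) h2, ?_⟩
      refine (Module.forall_dual_apply_eq_zero_iff ℂ _).mp ?_ |> sub_eq_zero.mp
      intro l
      have := h1 (res _ ⟨_, dual_mem_polynomialFunctions l⟩)
      have h3 : algebraMap (coordRing (φ '' S)) (coordRing S)
          (res _ ⟨_, dual_mem_polynomialFunctions l⟩) = res S ⟨_, hφ l⟩ := hu' _
      rw [h3, hpt'] at this
      rw [map_sub, sub_eq_zero]
      exact this
    · intro ψ _ ψ' _ h
      ext g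
      obtain ⟨g, rfl⟩ := res_surjective S g
      rw [hpt', hpt', h]
  exact (congrArg _ (trdeg_eq_of_isAlgebraic hinj)).le

/-- A chain of irreducible subsets has length at most the dimension. -/
theorem krullDim_le_vdim [FiniteDimensional ℂ E] {S : Set E} (hS : IsIrreducible S)
    {α : Type} [PartialOrder α] (c : α → Set E) (hc : ∀ a, IsIrreducible (c a))
    (hcS : ∀ a, c a ⊆ S)
    (hlt : ∀ a b, a < b → c a ⊆ closure (c b) ∧ ¬ c b ⊆ closure (c a)) :
    Order.krullDim α ≤ (vdim S : WithBot ℕ∞) := by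
  -- Each `c a` defines a prime ideal, the kernel of restriction to it. Larger sets have smaller
  -- ideals, hence the order dual.
  rw [← ringKrullDim_coordRing hS, ringKrullDim, ← Order.krullDim_orderDual (α := PrimeSpectrum _)]
  let r : ∀ a, coordRing S →ₐ[ℂ] coordRing (c a) := fun a =>
    ((pullFun (Set.inclusion (hcS a))).comp
      (coordRing S).val).codRestrict _ (by
        rintro ⟨g, hg⟩
        obtain ⟨f, hf, rfl⟩ := hg
        exact ⟨f, hf, rfl⟩)
  have hr : ∀ a g, r a g = 0 ↔ ∀ s (hs : s ∈ c a), (g : S → ℂ) ⟨s, hcS a hs⟩ = 0 := fun a g =>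
    ⟨fun h s hs => congrFun (congrArg Subtype.val h) ⟨s, hs⟩,
      fun h => Subtype.ext (funext fun t => h t t.2)⟩
  have hp : ∀ a, (RingHom.ker (r a)).IsPrime := fun a => by
    have := isDomain_coordRing (hc a)
    exact RingHom.ker_isPrime _
  refine Order.krullDim_le_of_strictMono
    (fun a : α => OrderDual.toDual (⟨RingHom.ker (r a), hp a⟩ : PrimeSpectrum _)) ?_
  intro a b hab
  obtain ⟨h1, h2⟩ := hlt a b hab
  refine OrderDual.toDual_lt_toDual.mpr ?_
  refine (PrimeSpectrum.asIdeal_lt_asIdeal _ _).mp (SetLike.lt_iff_le_and_exists.mpr ⟨?_, ?_⟩)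
  · intro g hg
    obtain ⟨g, rfl⟩ := res_surjective S g
    refine (hr a _).mpr fun s hs => ?_
    exact mem_closure_zar_iff.mp (h1 hs) g.1 g.2 fun t ht => (hr b _).mp hg t ht
  · obtain ⟨v, hv, hva⟩ := Set.not_subset.mp h2
    rw [mem_closure_zar_iff] at hva
    push Not at hva
    obtain ⟨f, hf, hfa, hfv⟩ := hva
    refine ⟨res S ⟨f, hf⟩, (hr a _).mpr fun s hs => hfa s hs, fun h => hfv ((hr b _).mp h v hv)⟩

end CoordRing

end PlaneForms

end

open MvPolynomial
noncomputable section
namespace PlaneForms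
attribute [local instance] zariskiTopology

/-! ### Dimension of a product with a vector space -/

section Product

variable {E F : Type} [AddCommGroup E] [Module ℂ E] [AddCommGroup F] [Module ℂ F]

theorem isPolyMap_fst : IsPolyMap (fun v : E × F => v.1) := isPolyMap_linear (LinearMap.fst ℂ E F)

theorem isPolyMap_snd : IsPolyMap (fun v : E × F => v.2) := isPolyMap_linear (LinearMap.snd ℂ E F)

/-- The coordinate ring of `S × F` is a polynomial ring over that of `S`, in the coordinates of `F`.
-/
theorem vdim_prod_univ [FiniteDimensional ℂ E] [FiniteDimensional ℂ F] {S : Set E}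
    (hS : IsIrreducible S) :
    vdim (S ×ˢ (Set.univ : Set F)) = vdim S + Module.finrank ℂ F := by
  have := isDomain_coordRing hS
  let b := Module.finBasis ℂ F
  let T := S ×ˢ (Set.univ : Set F)
  let φ : coordRing S →ₐ[ℂ] coordRing T :=
    ((pullFun (fun t : T => (⟨t.1.1, t.2.1⟩ : S))).comp (coordRing S).val).codRestrict _ (by
      rintro ⟨g, hg⟩
      obtain ⟨f, hf, rfl⟩ := hg
      exact ⟨_, isPolyMap_fst.comp_mem hf, rfl⟩)
  let x : Fin (Module.finrank ℂ F) → coordRing T := fun i =>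
    res T ⟨_, isPolyMap_snd (b.coord i)⟩
  let Φ : MvPolynomial (Fin (Module.finrank ℂ F)) (coordRing S) →ₐ[ℂ] coordRing T :=
    { MvPolynomial.eval₂Hom (φ : coordRing S →+* coordRing T) x with
      commutes' := fun c => by
        change MvPolynomial.eval₂Hom (φ : coordRing S →+* coordRing T) x
          (MvPolynomial.C (algebraMap ℂ (coordRing S) c)) = _
        rw [MvPolynomial.coe_eval₂Hom, MvPolynomial.eval₂_C]
        exact φ.commutes c }
  have hΦC : ∀ g, Φ (MvPolynomial.C g) = φ g := fun g => MvPolynomial.eval₂_C _ _ _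
  have hΦX : ∀ i, Φ (MvPolynomial.X i) = x i := fun i => MvPolynomial.eval₂_X _ _ _
  have hsurj : Function.Surjective Φ := by
    have key : ∀ f (hf : f ∈ polynomialFunctions (E × F)), res T ⟨f, hf⟩ ∈ Φ.range := by
      intro f hf
      induction hf using polynomialFunctions_induction with
      | dual l =>
        have : res T ⟨_, dual_mem_polynomialFunctions l⟩ =
            φ (res S ⟨_, dual_mem_polynomialFunctions (l ∘ₗ LinearMap.inl ℂ E F)⟩) +
              ∑ i, l (0, b i) • x i := by
          refine Subtype.ext (funext fun t => ?_)
          have h1 : l t.1 = l (t.1.1, 0) + l (0, t.1.2) := by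
            rw [← map_add]; simp
          have h2 : l (0, t.1.2) = ∑ i, l (0, b i) * b.coord i t.1.2 := by
            have h3 : ∀ w, l (0, w) = (l ∘ₗ LinearMap.inr ℂ E F) w := fun w => rfl
            simp only [h3]
            nth_rewrite 1 [← b.sum_repr t.1.2]
            simp only [map_sum, map_smul, smul_eq_mul, mul_comm, Module.Basis.coord_apply]
          change l t.1 = l (t.1.1, 0) + (((∑ i, l (0, b i) • x i : coordRing T)) : T → ℂ) t
          rw [h1, h2, AddSubmonoidClass.coe_finsetSum, Finset.sum_apply]
          rfl
        rw [this]
        have hx : ∀ i, x i ∈ Φ.range := fun i => ⟨_, hΦX i⟩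
        have hφ : ∀ g, φ g ∈ Φ.range := fun g => ⟨_, hΦC g⟩
        exact add_mem (hφ _) (sum_mem fun i _ => Subalgebra.smul_mem _ (hx i) _)
      | const c => exact ⟨algebraMap ℂ _ c, Φ.commutes c⟩
      | add f g hf hg h1 h2 => exact add_mem h1 h2
      | mul f g hf hg h1 h2 => exact mul_mem h1 h2
    intro g
    obtain ⟨f, rfl⟩ := res_surjective T g
    exact key f.1 f.2
  have hinj : Function.Injective Φ := by
    refine (injective_iff_map_eq_zero _).mpr fun p hp => ?_
    -- Injectivity is tested on fibres: over each point of `S` the coefficients become complex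
    -- numbers, and a complex polynomial that vanishes everywhere is zero.
    have hev : ∀ s : S, MvPolynomial.map
        ((Pi.evalRingHom (fun _ : S => ℂ) s).comp (coordRing S).val.toRingHom) p = 0 := by
      intro s
      refine MvPolynomial.funext fun w => ?_
      rw [MvPolynomial.eval_map, map_zero]
      let t : T := ⟨(s.1, ∑ i, w i • b i), s.2, trivial⟩
      have h1 : (Φ p : T → ℂ) t = 0 := by rw [hp]; rfl
      have h2 : ((Pi.evalRingHom (fun _ : T => ℂ) t).comp (coordRing T).val.toRingHom) (Φ p) =
          MvPolynomial.eval₂ ((Pi.evalRingHom (fun _ : S => ℂ) s).comp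
            (coordRing S).val.toRingHom) w p := by
        change ((Pi.evalRingHom (fun _ : T => ℂ) t).comp (coordRing T).val.toRingHom)
          (MvPolynomial.eval₂ (φ : coordRing S →+* coordRing T) x p) = _
        rw [MvPolynomial.hom_eval₂]
        congr 1
        funext i
        change b.repr (∑ i, w i • b i) i = w i
        rw [b.repr_sum_self]
      rw [← h2]
      exact h1
    ext m s
    have := congrArg (MvPolynomial.coeff m) (hev s)
    rw [MvPolynomial.coeff_map] at this
    exact this
  have h1 : Algebra.trdeg ℂ (MvPolynomial (Fin (Module.finrank ℂ F)) (coordRing S)) =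
      Algebra.trdeg ℂ (coordRing T) := trdeg_eq_of_bijective Φ ⟨hinj, hsurj⟩
  have h2 := trdeg_mvPolynomial (coordRing S) (Fin (Module.finrank ℂ F))
  rw [Fintype.card_fin] at h2
  rw [vdim, vdim, ← h2, h1]

end Product

/-! ### Chains of closed irreducible subsets in images of varieties -/

section Lower

variable {E E' : Type} [AddCommGroup E] [Module ℂ E] [AddCommGroup E'] [Module ℂ E']

theorem isIrreducible_preimage_val {T : Type} [TopologicalSpace T] {S W : Set T}
    (hW : IsIrreducible W) (hWS : W ⊆ S) : IsIrreducible (Subtype.val ⁻¹' W : Set S) := by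
  refine ⟨?_, ?_⟩
  · obtain ⟨w, hw⟩ := hW.1
    exact ⟨⟨w, hWS hw⟩, hw⟩
  · rintro _ _ ⟨U, hU, rfl⟩ ⟨V, hV, rfl⟩ ⟨u, hu, huU⟩ ⟨v, hv, hvV⟩
    obtain ⟨w, hw, h1, h2⟩ := hW.2 U V hU hV ⟨u, hu, huU⟩ ⟨v, hv, hvV⟩
    exact ⟨⟨w, hWS hw⟩, hw, h1, h2⟩

/-- The image of a locally closed irreducible set contains chains of closed irreducible subsets
whose length is its dimension. -/
theorem vdim_le_topologicalKrullDim [FiniteDimensional ℂ E] [FiniteDimensional ℂ E'] {X : Set E}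
    (hX : IsIrreducible X) (hX' : IsLocallyClosed X) {φ : E → E'} (hφ : IsPolyMap φ) :
    (vdim (φ '' X) : WithBot ℕ∞) ≤ topologicalKrullDim (φ '' X) := by
  set S := φ '' X with hSdef
  have hS : IsIrreducible S := hX.image φ hφ.continuous.continuousOn
  obtain ⟨u, hu, hu'⟩ := exists_pullback (S := X) (S' := S) hφ rfl
  have hdA := isDomain_coordRing hS
  have hdB := isDomain_coordRing hX
  obtain ⟨x, hx⟩ := hX.nonempty
  obtain ⟨f, hf, hfx, hfX⟩ := exists_ne_zero_of_isLocallyClosed hX' hx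
  have hf0 : res X ⟨f, hf⟩ ≠ 0 := fun h => hfx (congrFun (congrArg Subtype.val h) ⟨x, hx⟩)
  -- The image contains a dense basic open subset of its closure: every point of the coordinate ring
  -- with `a ≠ 0` comes from an actual point of `S`.
  obtain ⟨a, ha, hlift⟩ : ∃ a : coordRing S, a ≠ 0 ∧ ∀ ψ : coordRing S →ₐ[ℂ] ℂ, ψ a ≠ 0 →
      ∃ s : S, ∀ g : coordRing S, ψ g = (g : S → ℂ) s := by
    let := u.toRingHom.toAlgebra
    have : IsScalarTower ℂ (coordRing S) (coordRing X) :=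
      IsScalarTower.of_algebraMap_eq fun x => (u.commutes x).symm
    obtain ⟨a, ha, h⟩ := exists_ne_zero_forall_algHom_lift (A := coordRing S) (B := coordRing X)
      hu hf0
    refine ⟨a, ha, fun ψ hψ => ?_⟩
    obtain ⟨ψ', hψ', hψf⟩ := h ψ hψ
    obtain ⟨y, hy, hy'⟩ := exists_eval_eq ψ'
    rw [hy'] at hψf
    refine ⟨⟨φ y, y, hfX y hy hψf, rfl⟩, fun g => ?_⟩
    obtain ⟨g, rfl⟩ := res_surjective S g
    rw [← hψ']
    have : algebraMap (coordRing S) (coordRing X) (res S g) = res X ⟨_, hφ.comp_mem g.2⟩ := hu' g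
    rw [this, hy']
    rfl
  let W : Ideal (coordRing S) → Set E' := fun p =>
    {v | ∃ h : v ∈ S, (a : S → ℂ) ⟨v, h⟩ ≠ 0 ∧ ∀ g ∈ p, (g : S → ℂ) ⟨v, h⟩ = 0}
  -- The points of `S` on the zero locus of `p` with `a ≠ 0` are dense in that locus, so `W p`
  -- remembers the prime `p`.
  have hW : ∀ p : Ideal (coordRing S), p.IsPrime → a ∉ p → ∀ g ∉ p,
      ∃ v, ∃ h : v ∈ S, v ∈ W p ∧ (g : S → ℂ) ⟨v, h⟩ ≠ 0 := by
    intro p hp hap g hg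
    obtain ⟨ψ, hψ, hψg⟩ := exists_algHom_of_notMem hp
      (fun h => (hp.mem_or_mem h).elim hap hg : a * g ∉ p)
    rw [map_mul] at hψg
    obtain ⟨s, hs⟩ := hlift ψ (left_ne_zero_of_mul hψg)
    refine ⟨s.1, s.2, ⟨s.2, ?_, fun g hg => ?_⟩, ?_⟩
    · rw [← hs]; exact left_ne_zero_of_mul hψg
    · rw [← hs]; exact hψ g hg
    · rw [← hs]; exact right_ne_zero_of_mul hψg
  have hWirr : ∀ p : Ideal (coordRing S), p.IsPrime → a ∉ p → IsIrreducible (W p) := by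
    intro p hp hap
    refine ⟨?_, isPreirreducible_zar_iff.mpr ?_⟩
    · obtain ⟨v, -, hv, -⟩ := hW p hp hap a hap
      exact ⟨v, hv⟩
    · rintro f hf g hg ⟨v, hv, hfv⟩ ⟨w, hw, hgw⟩
      obtain ⟨y, hy, hyW, hfg⟩ := hW p hp hap (res S ⟨f, hf⟩ * res S ⟨g, hg⟩) (fun h => by
        rcases hp.mem_or_mem h with h | h
        · exact hfv (hv.2.2 _ h)
        · exact hgw (hw.2.2 _ h))
      exact ⟨y, hyW, left_ne_zero_of_mul hfg, right_ne_zero_of_mul hfg⟩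
  -- Its primes are the primes avoiding `a`. Its dimension is at least that of the coordinate ring,
  -- which embeds into it.
  let L := Localization.Away a
  have hLle : Submonoid.powers a ≤ nonZeroDivisors (coordRing S) :=
    powers_le_nonZeroDivisors_of_noZeroDivisors ha
  have : IsDomain L := IsLocalization.isDomain_localization hLle
  have : Algebra.FiniteType (coordRing S) L :=
    IsLocalization.finiteType_of_monoid_fg (Submonoid.powers a) L
  have : Algebra.FiniteType ℂ L := Algebra.FiniteType.trans (S := coordRing S) inferInstance this
  have hinjL : Function.Injective (IsScalarTower.toAlgHom ℂ (coordRing S) L) :=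
    IsLocalization.injective L hLle
  have h1 : (vdim S : WithBot ℕ∞) ≤ ringKrullDim L := by
    rw [ringKrullDim_eq_trdeg L]
    exact_mod_cast toNat_trdeg_le_of_injective _ hinjL
  refine h1.trans ?_
  have hap : ∀ P : PrimeSpectrum L, a ∉ P.asIdeal.comap (algebraMap (coordRing S) L) := by
    intro P h
    exact P.isPrime.ne_top (Ideal.eq_top_of_isUnit_mem _ h
      (IsLocalization.Away.algebraMap_isUnit (S := L) a))
  let c : PrimeSpectrum L → TopologicalSpace.IrreducibleCloseds S := fun P =>
    { carrier := closure (Subtype.val ⁻¹' (W (P.asIdeal.comap (algebraMap (coordRing S) L))))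
      isIrreducible' := (isIrreducible_preimage_val
        (hWirr _ (P.isPrime.comap _) (hap P)) (fun v hv => hv.1)).closure
      isClosed' := isClosed_closure }
  have hc : ∀ P' Q' : PrimeSpectrum L, Q' < P' → c P' < c Q' := by
    intro P' Q' hPQ'
    have hle : Q'.asIdeal.comap (algebraMap (coordRing S) L) ≤
      P'.asIdeal.comap (algebraMap (coordRing S) L) := Ideal.comap_mono hPQ'.le
    refine lt_of_le_of_ne ?_ fun heq => ?_
    · refine closure_mono fun s hs => ?_
      exact ⟨hs.1, hs.2.1, fun g hg => hs.2.2 g (hle hg)⟩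
    · refine hPQ'.not_ge ?_
      change P'.asIdeal ≤ Q'.asIdeal
      rw [← IsLocalization.under_le_under_iff (M := Submonoid.powers a)]
      intro g hg
      by_contra hgQ
      obtain ⟨v, hv, hvW, hgv⟩ := hW _ (Q'.isPrime.comap _) (hap Q') g hgQ
      have hmem : (⟨v, hv⟩ : S) ∈ closure (Subtype.val ⁻¹'
          (W (P'.asIdeal.comap (algebraMap (coordRing S) L))) : Set S) := by
        have : (⟨v, hv⟩ : S) ∈ c Q' := subset_closure hvW
        rw [← heq] at this
        exact this
      obtain ⟨g', hg', hgg'⟩ := exists_of_mem_coordRing g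
      have hcl : IsOpen ({s : S | g' s ≠ 0}) := (isOpen_ne_zero hg').preimage continuous_subtype_val
      obtain ⟨s, hs, hsW⟩ := mem_closure_iff.mp hmem _ hcl (by
        change g' v ≠ 0
        rwa [hgg'] at hgv)
      exact hs (by rw [← hgg']; exact hsW.2.2 g hg)
  rw [topologicalKrullDim, ringKrullDim, ← Order.krullDim_orderDual]
  exact Order.krullDim_le_of_strictMono
    (fun P : (PrimeSpectrum L)ᵒᵈ => c (OrderDual.ofDual P)) fun P Q hPQ => hc _ _ hPQ

end Lower

end PlaneForms

end

open MvPolynomial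
noncomputable section
namespace PlaneForms

/-! ### Graded pieces of the polynomial ring, indexed by integers -/

section Graded

/-- Homogeneous polynomials of degree `j`, where `j` is allowed to be negative. -/
abbrev gr (j : ℤ) : Submodule ℂ (MvPolynomial (Fin 3) ℂ) :=
  weightedHomogeneousSubmodule ℂ (fun _ : Fin 3 => (1 : ℤ)) j

theorem weight_one (m : Fin 3 →₀ ℕ) : Finsupp.weight (fun _ : Fin 3 => (1 : ℤ)) m = m.degree := by
  simp [Finsupp.weight_apply, Finsupp.degree_eq_sum, Finsupp.sum_fintype]

theorem gr_natCast (n : ℕ) : gr n = Hom n := by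
  ext p
  rw [mem_weightedHomogeneousSubmodule, mem_homogeneousSubmodule]
  simp only [IsHomogeneous, IsWeightedHomogeneous, weight_one]
  refine forall_congr' fun m => ?_
  have h : Finsupp.weight (1 : Fin 3 → ℕ) m = m.degree :=
    (DFunLike.congr_fun Finsupp.degree_eq_weight_one m).symm
  rw [h]
  norm_cast

theorem gr_of_neg {j : ℤ} (hj : j < 0) : gr j = ⊥ := by
  rw [eq_bot_iff]
  intro p hp
  rw [mem_weightedHomogeneousSubmodule] at hp
  refine (Submodule.mem_bot _).mpr (MvPolynomial.ext _ _ fun m => ?_)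
  by_contra h
  have := hp h
  rw [weight_one] at this
  omega

instance (n : ℕ) : FiniteDimensional ℂ (Hom n) :=
  Module.Finite.iff_fg.mpr (homogeneousSubmodule_fg _ _ n)

instance (j : ℤ) : FiniteDimensional ℂ (gr j) := by
  rcases lt_or_ge j 0 with h | h
  · rw [gr_of_neg h]; infer_instance
  · lift j to ℕ using h
    rw [gr_natCast]; infer_instance

theorem finrank_hom (n : ℕ) : Module.finrank ℂ (Hom n) = (n + 2).choose 2 := by
  have h1 : {m : Fin 3 →₀ ℕ | m.degree = n} =
      ((Finset.finsuppAntidiag (Finset.univ : Finset (Fin 3)) n : Finset (Fin 3 →₀ ℕ)) :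
        Set (Fin 3 →₀ ℕ)) := by
    ext m
    simp [Finset.mem_finsuppAntidiag, Finsupp.degree_eq_sum]
  have h2 := homogeneousSubmodule_eq_finsupp_supported (Fin 3) ℂ n
  rw [h1] at h2
  rw [Hom, h2, (AddMonoidAlgebra.supportedEquivFinsupp _).finrank_eq,
    Module.finrank_finsupp_self, ← Nat.card_eq_fintype_card, Nat.card_coe_set_eq,
    Set.ncard_coe_finset,
    Finset.card_finsuppAntidiag_nat_eq_choose, Finset.card_univ, Fintype.card_fin,
    show 3 + n - 1 = n + 2 by omega, Nat.choose_symm_add]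

theorem finrank_gr (j : ℤ) : Module.finrank ℂ (gr j) = (j + 2).toNat.choose 2 := by
  rcases lt_or_ge j 0 with h | h
  · rw [gr_of_neg h, finrank_bot, Nat.choose_eq_zero_of_lt]
    omega
  · lift j to ℕ using h
    rw [gr_natCast, finrank_hom]
    rfl

theorem mul_mem_gr {i j : ℤ} {p q : MvPolynomial (Fin 3) ℂ} (hp : p ∈ gr i) (hq : q ∈ gr j) :
    p * q ∈ gr (i + j) :=
  IsWeightedHomogeneous.mul hp hq

theorem weightedHomogeneousComponent_mul_of_mem {i : ℤ} (j : ℤ) {p : MvPolynomial (Fin 3) ℂ}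
    (hp : p ∈ gr i) (q : MvPolynomial (Fin 3) ℂ) :
    weightedHomogeneousComponent (fun _ : Fin 3 => (1 : ℤ)) (i + j) (p * q) =
      p * weightedHomogeneousComponent (fun _ : Fin 3 => (1 : ℤ)) j q := by
  induction q using MvPolynomial.induction_on' with
  | monomial m c =>
    have hm : monomial m c ∈ gr m.degree :=
      isWeightedHomogeneous_monomial _ _ _ (weight_one m)
    rw [weightedHomogeneousComponent_of_mem hm,
      weightedHomogeneousComponent_of_mem (mul_mem_gr hp hm)]
    by_cases h : (m.degree : ℤ) = j
    · simp [h]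
    · rw [if_neg (by omega), if_neg (by omega), mul_zero]
  | add p' q' h1 h2 => rw [mul_add, map_add, map_add, mul_add, h1, h2]

theorem mem_gr_of_mul_mem {i j : ℤ} {p q : MvPolynomial (Fin 3) ℂ} (hp : p ∈ gr i) (hp0 : p ≠ 0)
    (hpq : p * q ∈ gr (i + j)) : q ∈ gr j := by
  have h1 := weightedHomogeneousComponent_mul_of_mem j hp q
  rw [IsWeightedHomogeneous.weightedHomogeneousComponent_same hpq] at h1
  rw [mul_left_cancel₀ hp0 h1]
  exact weightedHomogeneousComponent_mem _ _ _

/-- Substitution of `x_i T` for `x_i`. -/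
def scaleVars : MvPolynomial (Fin 3) ℂ →ₐ[ℂ] Polynomial (MvPolynomial (Fin 3) ℂ) :=
  MvPolynomial.aeval fun i => Polynomial.C (X i) * Polynomial.X

theorem coeff_scaleVars (p : MvPolynomial (Fin 3) ℂ) (k : ℕ) :
    (scaleVars p).coeff k = homogeneousComponent k p := by
  induction p using MvPolynomial.induction_on' with
  | monomial m c =>
    have h1 : scaleVars (monomial m c) = Polynomial.C (monomial m c) * Polynomial.X ^ m.degree := by
      rw [scaleVars, aeval_monomial, Finsupp.prod_fintype _ _ (by simp)]
      simp only [mul_pow, Finset.prod_mul_distrib, Finset.prod_pow_eq_pow_sum, Finsupp.degree_eq_sum]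
      rw [← mul_assoc, monomial_eq (s := m), Finsupp.prod_fintype _ _ (by simp), map_mul, map_prod]
      simp only [map_pow]
      rfl
    have hm : monomial m c ∈ Hom m.degree := isHomogeneous_monomial _ rfl
    rw [h1, Polynomial.coeff_C_mul_X_pow, homogeneousComponent_of_mem hm]
  | add p q h1 h2 => rw [map_add, map_add, Polynomial.coeff_add, h1, h2]

theorem scaleVars_of_mem {n : ℕ} {p : MvPolynomial (Fin 3) ℂ} (hp : p ∈ Hom n) :
    scaleVars p = Polynomial.C p * Polynomial.X ^ n := by
  ext1 k
  rw [coeff_scaleVars, homogeneousComponent_of_mem hp, Polynomial.coeff_C_mul_X_pow]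

/-- Under `x_i ↦ x_i T` the product becomes a monomial in `T`. Degree and trailing degree in `T` are
additive and agree for the product, so they agree for each factor. -/
theorem exists_mem_hom_of_mul_mem {n : ℕ} {p q : MvPolynomial (Fin 3) ℂ} (h : p * q ∈ Hom n)
    (h0 : p * q ≠ 0) : ∃ k, p ∈ Hom k := by
  have h1 : scaleVars p * scaleVars q = Polynomial.C (p * q) * Polynomial.X ^ n := by
    rw [← map_mul, scaleVars_of_mem h]
  have hne : scaleVars p * scaleVars q ≠ 0 := by
    rw [h1]; simpa using h0
  have hp := left_ne_zero_of_mul hne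
  have hq := right_ne_zero_of_mul hne
  have h2 : (scaleVars p).natDegree + (scaleVars q).natDegree = n := by
    rw [← Polynomial.natDegree_mul hp hq, h1, Polynomial.natDegree_C_mul_X_pow _ _ h0]
  have h3 : (scaleVars p).natTrailingDegree + (scaleVars q).natTrailingDegree = n := by
    rw [← Polynomial.natTrailingDegree_mul hp hq, h1, Polynomial.C_mul_X_pow_eq_monomial,
      Polynomial.natTrailingDegree_monomial h0]
  have h4 := Polynomial.natTrailingDegree_le_natDegree (scaleVars p)
  have h5 := Polynomial.natTrailingDegree_le_natDegree (scaleVars q)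
  refine ⟨(scaleVars p).natDegree, ?_⟩
  suffices h : ∑ k ∈ Finset.range (p.totalDegree + 1), homogeneousComponent k p ∈
      Hom (scaleVars p).natDegree by rwa [sum_homogeneousComponent] at h
  refine sum_mem fun k _ => ?_
  by_cases hk : k = (scaleVars p).natDegree
  · rw [hk]; exact homogeneousComponent_isHomogeneous _ _
  · rw [← coeff_scaleVars]
    rcases lt_or_gt_of_ne hk with hk | hk
    · rw [Polynomial.coeff_eq_zero_of_lt_natTrailingDegree (by omega)]
      exact zero_mem _
    · rw [Polynomial.coeff_eq_zero_of_natDegree_lt hk]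
      exact zero_mem _

theorem exists_mem_gr_of_dvd {j : ℤ} {p q : MvPolynomial (Fin 3) ℂ} (h : q ∈ gr j) (h0 : q ≠ 0)
    (hpq : p ∣ q) : ∃ k : ℕ, p ∈ gr k := by
  have hj : 0 ≤ j := by
    by_contra hj
    rw [gr_of_neg (not_le.mp hj)] at h
    exact h0 h
  lift j to ℕ using hj
  obtain ⟨r, rfl⟩ := hpq
  obtain ⟨k, hk⟩ := exists_mem_hom_of_mul_mem (by rwa [gr_natCast] at h) h0
  exact ⟨k, by rwa [gr_natCast]⟩

theorem isUnit_of_mem_gr_zero {p : MvPolynomial (Fin 3) ℂ} (hp : p ∈ gr 0) (h0 : p ≠ 0) :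
    IsUnit p := by
  have h1 : p ∈ homogeneousSubmodule (Fin 3) ℂ 0 := (gr_natCast 0).le hp
  rw [homogeneousSubmodule_zero] at h1
  obtain ⟨c, rfl⟩ := Submodule.mem_one.mp h1
  refine (isUnit_iff_ne_zero.mpr fun hc => h0 ?_).map (algebraMap ℂ _)
  rw [hc, map_zero]

theorem pderiv_mem_gr {j : ℤ} {p : MvPolynomial (Fin 3) ℂ} (hp : p ∈ gr j) (i : Fin 3) :
    pderiv i p ∈ gr (j - 1) := by
  rcases lt_or_ge j 1 with h | h
  · rcases lt_or_ge j 0 with h' | h'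
    · rw [gr_of_neg h', Submodule.mem_bot] at hp
      rw [hp, map_zero]
      exact zero_mem _
    · obtain rfl : j = 0 := by omega
      have h1 : p ∈ homogeneousSubmodule (Fin 3) ℂ 0 := (gr_natCast 0).le hp
      rw [homogeneousSubmodule_zero] at h1
      obtain ⟨c, rfl⟩ := Submodule.mem_one.mp h1
      rw [algebraMap_eq, pderiv_C]
      exact zero_mem _
  · lift j to ℕ using by omega
    rw [gr_natCast] at hp
    have : ((j : ℤ) - 1) = ((j - 1 : ℕ) : ℤ) := by omega
    rw [this, gr_natCast]
    exact IsHomogeneous.pderiv hp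

end Graded
end PlaneForms

end

open MvPolynomial
noncomputable section
namespace PlaneForms

/-! ### The space of forms and the Hilbert function of the singular ideal -/

section Hilbert

theorem exists_homogeneous_combination {i₁ i₂ i₃ j : ℤ} {f₁ f₂ f₃ u : MvPolynomial (Fin 3) ℂ}
    (h₁ : f₁ ∈ gr i₁) (h₂ : f₂ ∈ gr i₂) (h₃ : f₃ ∈ gr i₃) (hu : u ∈ gr j)
    (h : u ∈ Ideal.span {f₁, f₂, f₃}) :
    ∃ a ∈ gr (j - i₁), ∃ b ∈ gr (j - i₂), ∃ c ∈ gr (j - i₃), u = f₁ * a + f₂ * b + f₃ * c := by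
  obtain ⟨a, v, hv, rfl⟩ := Ideal.mem_span_insert.mp h
  obtain ⟨b, c, rfl⟩ := Ideal.mem_span_pair.mp hv
  let κ := weightedHomogeneousComponent (R := ℂ) (fun _ : Fin 3 => (1 : ℤ))
  refine ⟨κ (j - i₁) a, weightedHomogeneousComponent_mem _ _ _,
    κ (j - i₂) b, weightedHomogeneousComponent_mem _ _ _,
    κ (j - i₃) c, weightedHomogeneousComponent_mem _ _ _, ?_⟩
  rw [← weightedHomogeneousComponent_mul_of_mem _ h₁, ← weightedHomogeneousComponent_mul_of_mem _ h₂,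
    ← weightedHomogeneousComponent_mul_of_mem _ h₃, add_sub_cancel, add_sub_cancel, add_sub_cancel,
    ← map_add, ← map_add, ← IsWeightedHomogeneous.weightedHomogeneousComponent_same hu]
  congr 1
  ring

/-- The dimension of the degree `j` part of an ideal. -/
def hd (I : Ideal (MvPolynomial (Fin 3) ℂ)) (j : ℤ) : ℕ :=
  Module.finrank ℂ ↥(gr j ⊓ I.restrictScalars ℂ)

theorem hd_add_finrank_quotient (I : Ideal (MvPolynomial (Fin 3) ℂ)) (n : ℕ) :
    hd I n + Module.finrank ℂ (Hom n ⧸ (I.restrictScalars ℂ).comap (Hom n).subtype) =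
      (n + 2).choose 2 := by
  rw [hd, gr_natCast, ← Submodule.map_comap_subtype, Submodule.finrank_map_subtype_eq, add_comm,
    Submodule.finrank_quotient_add_finrank, finrank_hom]

theorem hd_le (I : Ideal (MvPolynomial (Fin 3) ℂ)) (j : ℤ) : hd I j ≤ Module.finrank ℂ (gr j) :=
  Submodule.finrank_mono inf_le_left

/-- The map `(P, Q, K) ↦ C_x Q - C_y P - C K`. -/
def darboux (e d : ℕ) : Hom e →ₗ[ℂ] (Hom d × Hom d) × gr (d - 1) →ₗ[ℂ] MvPolynomial (Fin 3) ℂ :=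
  LinearMap.mk₂ ℂ (fun C w => pderiv 0 C.1 * w.1.2.1 - pderiv 1 C.1 * w.1.1.1 - C.1 * w.2.1)
    (fun a b w => by simp only [Submodule.coe_add, map_add]; ring)
    (fun c a w => by
      simp only [Submodule.coe_smul, Derivation.map_smul, smul_mul_assoc, smul_sub])
    (fun a v w => by simp only [Prod.fst_add, Prod.snd_add, Submodule.coe_add]; ring)
    (fun c a w => by
      simp only [Prod.smul_fst, Prod.smul_snd, Submodule.coe_smul, mul_smul_comm, smul_sub])

theorem darboux_apply {e d : ℕ} (C : Hom e) (w : (Hom d × Hom d) × gr (d - 1)) :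
    darboux e d C w = pderiv 0 C.1 * w.1.2.1 - pderiv 1 C.1 * w.1.1.1 - C.1 * w.2.1 := rfl

theorem hom_le_gr {n : ℕ} {p : MvPolynomial (Fin 3) ℂ} (hp : p ∈ Hom n) : p ∈ gr n := by
  rwa [gr_natCast]

theorem mem_ker_darboux_of_mem {e d : ℕ} {C : Hom e} (hC : C ≠ 0) {η : Hom d × Hom d}
    (hη : η ∈ integralForms C.1 d) : ∃ K : gr (d - 1), darboux e d C (η, K) = 0 := by
  obtain ⟨K, hK⟩ := hη
  have hC' : C.1 ≠ 0 := fun h => hC (Subtype.ext h)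
  have hCK : C.1 * K ∈ gr (e + (d - 1)) := by
    rw [← hK]
    have h1 := mul_mem_gr (pderiv_mem_gr (hom_le_gr C.2) 0) (hom_le_gr η.2.2)
    have h2 := mul_mem_gr (pderiv_mem_gr (hom_le_gr C.2) 1) (hom_le_gr η.1.2)
    rw [show (e : ℤ) - 1 + d = e + (d - 1) by ring] at h1 h2
    exact sub_mem h1 h2
  refine ⟨⟨K, mem_gr_of_mul_mem (hom_le_gr C.2) hC' hCK⟩, ?_⟩
  rw [darboux_apply]
  change _ - C.1 * K = 0
  rw [hK, sub_self]

theorem mem_integralForms_of_darboux {e d : ℕ} {C : Hom e} {w : (Hom d × Hom d) × gr (d - 1)}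
    (hw : darboux e d C w = 0) : w.1 ∈ integralForms C.1 d :=
  ⟨w.2.1, sub_eq_zero.mp hw⟩

theorem snd_eq_zero_of_darboux {e d : ℕ} {C : Hom e} (hC : C ≠ 0) {K : gr (d - 1)}
    (hw : darboux e d C (0, K) = 0) : K = 0 := by
  rw [darboux_apply] at hw
  have hC' : C.1 ≠ 0 := fun h => hC (Subtype.ext h)
  simp only [Prod.fst_zero, Prod.snd_zero, Submodule.coe_zero, mul_zero, sub_zero, zero_sub,
    neg_eq_zero, mul_eq_zero, hC', false_or] at hw
  exact Subtype.ext hw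

/-- For `C ≠ 0` the space `V_C(d)` is the kernel of `(C_x, C_y, C)`. -/
def kerDarbouxEquiv {e : ℕ} (d : ℕ) {C : Hom e} (hC : C ≠ 0) :
    LinearMap.ker (darboux e d C) ≃ₗ[ℂ] integralForms C.1 d :=
  LinearEquiv.ofBijective
    ((LinearMap.fst ℂ (Hom d × Hom d) (gr (d - 1))).restrict
      (p := LinearMap.ker (darboux e d C)) (q := integralForms C.1 d)
      fun _ hw => mem_integralForms_of_darboux hw)
    ⟨by
      refine (injective_iff_map_eq_zero _).mpr fun w hw => ?_
      have h1 : w.1.1 = 0 := congrArg Subtype.val hw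
      have h2 : w.1.2 = 0 := snd_eq_zero_of_darboux hC (by
        rw [← h1]; exact w.2)
      exact Subtype.ext (Prod.ext h1 h2),
    fun η => by
      obtain ⟨K, hK⟩ := mem_ker_darboux_of_mem hC η.2
      exact ⟨⟨(η, K), hK⟩, rfl⟩⟩

theorem range_darboux {e d : ℕ} (C : Hom e) :
    LinearMap.range (darboux e d C) = gr (e + d - 1) ⊓ (singIdeal C.1).restrictScalars ℂ := by
  apply le_antisymm
  · rintro _ ⟨w, rfl⟩
    rw [darboux_apply]
    refine ⟨?_, ?_⟩
    · have h1 := mul_mem_gr (pderiv_mem_gr (hom_le_gr C.2) 0) (hom_le_gr w.1.2.2)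
      have h2 := mul_mem_gr (pderiv_mem_gr (hom_le_gr C.2) 1) (hom_le_gr w.1.1.2)
      have h3 := mul_mem_gr (hom_le_gr C.2) w.2.2
      rw [show (e : ℤ) - 1 + d = e + d - 1 by ring] at h1 h2
      rw [← add_sub_assoc] at h3
      exact sub_mem (sub_mem h1 h2) h3
    · refine sub_mem (sub_mem ?_ ?_) ?_ <;>
        exact Ideal.mul_mem_right _ _ (Ideal.subset_span (by simp))
  · rintro u ⟨h1, h2⟩
    obtain ⟨a, ha, b, hb, c, hc, rfl⟩ := exists_homogeneous_combination
      (pderiv_mem_gr (hom_le_gr C.2) 0) (pderiv_mem_gr (hom_le_gr C.2) 1) (hom_le_gr C.2) h1 h2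
    rw [show (e : ℤ) + d - 1 - (e - 1) = d by ring, gr_natCast] at ha hb
    rw [show (e : ℤ) + d - 1 - e = d - 1 by ring] at hc
    refine ⟨((-⟨b, hb⟩, ⟨a, ha⟩), -⟨c, hc⟩), ?_⟩
    rw [darboux_apply]
    simp only [Submodule.coe_neg]
    ring

/-- Rank-nullity for the Darboux map: its kernel is `V_C(d)`, and its image is the full degree `e +
d - 1` part of `(C_x, C_y, C)`. -/
theorem finrank_integralForms {e : ℕ} (d : ℕ) {C : Hom e} (hC : C ≠ 0) :
    Module.finrank ℂ (integralForms C.1 d) + hd (singIdeal C.1) (e + d - 1) =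
      2 * (d + 2).choose 2 + (d + 1).choose 2 := by
  rw [← (kerDarbouxEquiv d hC).finrank_eq, hd, ← range_darboux, add_comm,
    LinearMap.finrank_range_add_finrank_ker, Module.finrank_prod, Module.finrank_prod, finrank_hom,
    finrank_gr, two_mul, show ((d : ℤ) - 1 + 2).toNat = d + 1 by omega]

end Hilbert
end PlaneForms

end

open MvPolynomial
noncomputable section
namespace PlaneForms

/-! ### A linear nonzerodivisor modulo two coprime polynomials -/

section Coprime

theorem exists_of_mul_eq_mul {A A' P Q : MvPolynomial (Fin 3) ℂ} (h : IsRelPrime A A')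
    (hPQ : A * Q = A' * P) : ∃ w, P = w * A ∧ Q = w * A' := by
  by_cases hA' : A' = 0
  · subst hA'
    have hA : IsUnit A := h dvd_rfl (dvd_zero A)
    obtain ⟨u, rfl⟩ := hA
    refine ⟨P * ↑u⁻¹, ?_, ?_⟩
    · rw [mul_assoc, Units.inv_mul, mul_one]
    · rw [zero_mul] at hPQ
      rw [mul_zero]
      exact (mul_eq_zero.mp hPQ).resolve_left u.ne_zero
  · obtain ⟨w, rfl⟩ : A' ∣ Q := h.symm.dvd_of_dvd_mul_left ⟨P, hPQ⟩
    refine ⟨w, mul_left_cancel₀ hA' ?_, mul_comm _ _⟩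
    linear_combination -hPQ

theorem X_zero_prime : Prime (X 0 : MvPolynomial (Fin 3) ℂ) := X_prime

theorem not_X_zero_dvd_X_one : ¬ (X 0 : MvPolynomial (Fin 3) ℂ) ∣ X 1 := by
  rw [X_dvd_X]
  simp

/-- Membership in the monomial ideal `(X 0, X 1)` is decided monomial by monomial, and the factor `X
2` does not affect it. -/
theorem exists_of_X_mul_eq {u v w : MvPolynomial (Fin 3) ℂ} (h : X 2 * w = X 0 * u + X 1 * v) :
    ∃ p q, w = X 1 * p - X 0 * q := by
  have h1 : w ∈ Ideal.span ((X : Fin 3 → MvPolynomial (Fin 3) ℂ) '' {0, 1}) := by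
    have h2 : X 2 * w ∈ Ideal.span ((X : Fin 3 → MvPolynomial (Fin 3) ℂ) '' {0, 1}) := by
      rw [h]
      exact add_mem (Ideal.mul_mem_right _ _ (Ideal.subset_span ⟨0, by simp, rfl⟩))
        (Ideal.mul_mem_right _ _ (Ideal.subset_span ⟨1, by simp, rfl⟩))
    rw [mem_ideal_span_X_image] at h2 ⊢
    intro m hm
    obtain ⟨i, hi, hmi⟩ := h2 (Finsupp.single 2 1 + m) (by
      rw [mem_support_iff, coeff_X_mul]
      exact mem_support_iff.mp hm)
    refine ⟨i, hi, ?_⟩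
    rcases hi with rfl | rfl <;> simpa using hmi
  rw [Set.image_pair, Ideal.mem_span_pair] at h1
  obtain ⟨a, b, rfl⟩ := h1
  exact ⟨b, -a, by ring⟩

/-- A polynomial ring modulo two coprime elements has no embedded component at the origin. -/
theorem mem_span_pair_of_X_mul_mem {A A' u : MvPolynomial (Fin 3) ℂ} (h : IsRelPrime A A')
    (hu : ∀ i, X i * u ∈ Ideal.span {A, A'}) : u ∈ Ideal.span {A, A'} := by
  choose α β hαβ using fun i => Ideal.mem_span_pair.mp (hu i)
  -- Eliminating `u` from two of the relations `X i * u = α i * A + β i * A'` leaves a syzygy of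
  -- `A`, `A'`; by coprimality it is a multiple of the trivial one.
  have hw : ∀ i j, ∃ w, X j * β i - X i * β j = w * A ∧ X i * α j - X j * α i = w * A' := by
    intro i j
    refine exists_of_mul_eq_mul h ?_
    linear_combination X i * hαβ j - X j * hαβ i
  by_cases hA : A = 0
  · subst hA
    have : IsUnit A' := h (dvd_zero A') dvd_rfl
    rw [Ideal.eq_top_of_isUnit_mem _ (Ideal.subset_span (by simp)) this]
    trivial
  obtain ⟨w₁, h₁, h₁'⟩ := hw 0 1
  obtain ⟨w₂, h₂, h₂'⟩ := hw 1 2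
  obtain ⟨w₃, h₃, h₃'⟩ := hw 2 0
  -- The three multipliers satisfy the cyclic relation `X 2 * w₁ + X 0 * w₂ + X 1 * w₃ = 0`. This
  -- allows `α 0` and `β 0` to be corrected by multiples of `A'` and `A` so that both become
  -- divisible by `X 0`, which can then be cancelled.
  obtain ⟨p, q, rfl⟩ := exists_of_X_mul_eq (u := -w₂) (v := -w₃) (w := w₁) (by
    refine mul_right_cancel₀ hA ?_
    linear_combination - X 2 * h₁ - X 0 * h₂ - X 1 * h₃)
  obtain ⟨α', hα'⟩ : X 0 ∣ α 0 + p * A' := by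
    refine (X_zero_prime.dvd_or_dvd (b := X 1) ⟨α 1 + q * A', ?_⟩).resolve_right
      not_X_zero_dvd_X_one
    linear_combination -h₁'
  obtain ⟨β', hβ'⟩ : X 0 ∣ β 0 - p * A := by
    refine (X_zero_prime.dvd_or_dvd (b := X 1) ⟨β 1 - q * A, ?_⟩).resolve_right
      not_X_zero_dvd_X_one
    linear_combination h₁
  refine Ideal.mem_span_pair.mpr ⟨α', β', mul_left_cancel₀ X_zero_prime.ne_zero ?_⟩
  linear_combination hαβ 0 - A * hα' - A' * hβ'

/-- Prime avoidance: if every linear form were a zero divisor, the space of linear forms would be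
covered by finitely many associated primes, hence contained in one of them. That prime contains all
variables and annihilates a nonzero class, against `mem_span_pair_of_X_mul_mem`. -/
theorem exists_linear_nonZeroDivisor {A A' : MvPolynomial (Fin 3) ℂ} (h : IsRelPrime A A') :
    ∃ l ∈ gr 1, ∀ u, l * u ∈ Ideal.span {A, A'} → u ∈ Ideal.span {A, A'} := by
  let R := MvPolynomial (Fin 3) ℂ
  let M := R ⧸ Ideal.span {A, A'}
  have hfin : Finite (associatedPrimes R M) := (associatedPrimes.finite R M).to_subtype
  by_contra! hcon
  have hcov : ⋃ p : associatedPrimes R M,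
      (((p.1.restrictScalars ℂ).comap (gr 1).subtype : Submodule ℂ (gr 1)) : Set (gr 1)) =
        Set.univ := by
    refine Set.eq_univ_of_forall fun l => ?_
    obtain ⟨u, hu, hu'⟩ := hcon l.1 l.2
    have : l.1 ∈ ⋃ p ∈ associatedPrimes R M, (p : Set R) := by
      rw [biUnion_associatedPrimes_eq_zero_divisors]
      refine ⟨Ideal.Quotient.mk _ u, fun h0 => hu' (Ideal.Quotient.eq_zero_iff_mem.mp h0), ?_⟩
      exact Ideal.Quotient.eq_zero_iff_mem.mpr hu
    obtain ⟨p, hp, hlp⟩ := Set.mem_iUnion₂.mp this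
    exact Set.mem_iUnion.mpr ⟨⟨p, hp⟩, hlp⟩
  obtain ⟨p, hp⟩ := Subspace.exists_eq_top_of_iUnion_eq_univ hcov
  have hX : ∀ i, (X i : R) ∈ p.1 := fun i => by
    have : (⟨X i, by simpa using isWeightedHomogeneous_X ℂ (fun _ : Fin 3 => (1 : ℤ)) i⟩ : gr 1) ∈
      (p.1.restrictScalars ℂ).comap (gr 1).subtype := by rw [hp]; trivial
    exact this
  obtain ⟨hprime, x, hx⟩ := isAssociatedPrime_iff.mp p.2
  obtain ⟨u, rfl⟩ := Ideal.Quotient.mk_surjective x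
  have hu : u ∈ Ideal.span {A, A'} := by
    refine mem_span_pair_of_X_mul_mem h fun i => ?_
    have := hX i
    rw [hx, Submodule.mem_colon_singleton] at this
    exact Ideal.Quotient.eq_zero_iff_mem.mp this
  apply hprime.ne_top
  rw [hx, Ideal.Quotient.eq_zero_iff_mem.mpr hu]
  simp

/-- Multiplication by `l` embeds the degree `m` part of the quotient by `I` into the degree `m + 1`
part. The inequality is rearranged to avoid subtraction. -/
theorem hd_succ_add_finrank_le {I : Ideal (MvPolynomial (Fin 3) ℂ)} {l : MvPolynomial (Fin 3) ℂ}
    (hl : l ∈ gr 1) (h : ∀ u, l * u ∈ I → u ∈ I) (m : ℤ) :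
    hd I (m + 1) + Module.finrank ℂ (gr m) ≤ Module.finrank ℂ (gr (m + 1)) + hd I m := by
  let π : MvPolynomial (Fin 3) ℂ →ₗ[ℂ] _ := (I.restrictScalars ℂ).mkQ
  let ψ := π.domRestrict (gr (m + 1))
  let φ := (π ∘ₗ LinearMap.mulLeft ℂ l).domRestrict (gr m)
  have h1 : Module.finrank ℂ (LinearMap.ker ψ) = hd I (m + 1) := by
    have : LinearMap.ker ψ = (I.restrictScalars ℂ).comap (gr (m + 1)).subtype := by
      ext u
      simp [ψ, π]
    rw [hd, ← Submodule.map_comap_subtype, Submodule.finrank_map_subtype_eq, this]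
  have h2 : Module.finrank ℂ (LinearMap.ker φ) = hd I m := by
    have : LinearMap.ker φ = (I.restrictScalars ℂ).comap (gr m).subtype := by
      ext u
      simp only [φ, π, LinearMap.mem_ker, LinearMap.domRestrict_apply, LinearMap.comp_apply,
        LinearMap.mulLeft_apply, Submodule.mkQ_apply, Submodule.Quotient.mk_eq_zero,
        Submodule.mem_comap, Submodule.subtype_apply, Submodule.restrictScalars_mem]
      exact ⟨h _, fun hu => I.mul_mem_left _ hu⟩
    rw [hd, ← Submodule.map_comap_subtype, Submodule.finrank_map_subtype_eq, this]
  have h3 : LinearMap.range φ ≤ LinearMap.range ψ := by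
    rintro _ ⟨u, rfl⟩
    have : l * u.1 ∈ gr (m + 1) := by
      rw [add_comm]
      exact mul_mem_gr hl u.2
    exact ⟨⟨l * u.1, this⟩, rfl⟩
  have h4 := Submodule.finrank_mono h3
  have h5 := ψ.finrank_range_add_finrank_ker
  have h6 := φ.finrank_range_add_finrank_ker
  omega

end Coprime
end PlaneForms

end

open MvPolynomial
noncomputable section
namespace PlaneForms

/-! ### Splitting a form from its cofactor -/

section LowerBound

theorem exists_homogeneous_combination_pair {i₁ i₂ j : ℤ} {f₁ f₂ u : MvPolynomial (Fin 3) ℂ}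
    (h₁ : f₁ ∈ gr i₁) (h₂ : f₂ ∈ gr i₂) (hu : u ∈ gr j) (h : u ∈ Ideal.span {f₁, f₂}) :
    ∃ a ∈ gr (j - i₁), ∃ b ∈ gr (j - i₂), u = f₁ * a + f₂ * b := by
  obtain ⟨a, ha, b, hb, c, -, h⟩ := exists_homogeneous_combination h₁ h₂ (zero_mem (gr 0)) hu
    (Ideal.span_mono (by intro x; simp; tauto) h)
  exact ⟨a, ha, b, hb, by rw [h, zero_mul, add_zero]⟩

/-- The ideal of all `K` such that `C K` lies in `(A, A')`. -/
def colonIdeal (A A' C : MvPolynomial (Fin 3) ℂ) : Ideal (MvPolynomial (Fin 3) ℂ) :=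
  Submodule.comap (LinearMap.mulLeft (MvPolynomial (Fin 3) ℂ) C) (Ideal.span {A, A'})

theorem mem_colonIdeal {A A' C K : MvPolynomial (Fin 3) ℂ} :
    K ∈ colonIdeal A A' C ↔ C * K ∈ Ideal.span {A, A'} := Iff.rfl

theorem finrank_map_add_finrank_inf_ker {V W : Type*} [AddCommGroup V] [Module ℂ V]
    [FiniteDimensional ℂ V] [AddCommGroup W] [Module ℂ W] (S : Submodule ℂ V) (σ : V →ₗ[ℂ] W) :
    Module.finrank ℂ (S.map σ) + Module.finrank ℂ ↥(S ⊓ LinearMap.ker σ) =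
      Module.finrank ℂ S := by
  have h1 := (σ.domRestrict S).finrank_range_add_finrank_ker
  rw [LinearMap.range_domRestrict, LinearMap.ker_domRestrict,
    ← Submodule.finrank_map_subtype_eq S, Submodule.map_comap_subtype] at h1
  exact h1

section

variable {e d : ℕ} {C : Hom e} {G A A' : MvPolynomial (Fin 3) ℂ} {g a : ℤ}

/-- With zero cofactor the equation reads `A Q = A' P` after cancelling `G`, so `(P, Q)` is a
multiple of `(A, A')` by an element of degree `d - a`. -/
theorem finrank_ker_inf_ker (hA : A ∈ gr a) (hA' : A' ∈ gr a)
    (h : IsRelPrime A A') (hx : pderiv 0 C.1 = G * A) (hy : pderiv 1 C.1 = G * A') (hG0 : G ≠ 0) :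
    Module.finrank ℂ ↥(LinearMap.ker (darboux e d C) ⊓
      LinearMap.ker (LinearMap.snd ℂ (Hom d × Hom d) (gr (d - 1)))) =
      Module.finrank ℂ (gr (d - a)) := by
  have hm : ∀ B ∈ gr a, ∀ u : gr (d - a), B * u.1 ∈ Hom d := fun B hB u => by
    have := mul_mem_gr hB u.2
    rwa [add_sub_cancel, gr_natCast] at this
  let mulBy : ∀ B ∈ gr a, gr (d - a) →ₗ[ℂ] Hom d := fun B hB =>
    LinearMap.codRestrict (Hom d) ((LinearMap.mulLeft ℂ B).domRestrict _) (hm B hB)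
  let f : gr (d - a) →ₗ[ℂ] (Hom d × Hom d) × gr (d - 1) :=
    LinearMap.inl ℂ _ _ ∘ₗ (mulBy A hA).prod (mulBy A' hA')
  have hf1 : ∀ u, (f u).1.1.1 = A * u.1 := fun u => rfl
  have hf2 : ∀ u, (f u).1.2.1 = A' * u.1 := fun u => rfl
  have hf3 : ∀ u, (f u).2 = 0 := fun u => rfl
  have hne : A ≠ 0 ∨ A' ≠ 0 := by
    by_contra! h0
    rw [h0.1, h0.2] at h
    exact not_isUnit_zero (h dvd_rfl dvd_rfl)
  have hinj : Function.Injective f := by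
    refine (injective_iff_map_eq_zero _).mpr fun u hu => Subtype.ext ?_
    rcases hne with h0 | h0
    · have := hf1 u
      rw [hu] at this
      exact (mul_eq_zero.mp this.symm).resolve_left h0
    · have := hf2 u
      rw [hu] at this
      exact (mul_eq_zero.mp this.symm).resolve_left h0
  have hrange : LinearMap.ker (darboux e d C) ⊓
      LinearMap.ker (LinearMap.snd ℂ (Hom d × Hom d) (gr (d - 1))) = LinearMap.range f := by
    apply le_antisymm
    · rintro w ⟨h1, h2⟩
      have h2 : w.2 = 0 := h2
      have h1 : darboux e d C w = 0 := h1
      rw [darboux_apply, h2, hx, hy, Submodule.coe_zero, mul_zero, sub_zero] at h1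
      obtain ⟨u, hu, hu'⟩ := exists_of_mul_eq_mul h (P := w.1.1.1) (Q := w.1.2.1)
        (mul_left_cancel₀ hG0 (by linear_combination h1))
      have hud : u ∈ gr (d - a) := by
        rcases hne with h0 | h0
        · refine mem_gr_of_mul_mem hA h0 ?_
          rw [mul_comm, ← hu, add_sub_cancel]
          exact hom_le_gr w.1.1.2
        · refine mem_gr_of_mul_mem hA' h0 ?_
          rw [mul_comm, ← hu', add_sub_cancel]
          exact hom_le_gr w.1.2.2
      refine ⟨⟨u, hud⟩, Prod.ext (Prod.ext (Subtype.ext ?_) (Subtype.ext ?_)) ?_⟩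
      · rw [hf1, hu, mul_comm]
      · rw [hf2, hu', mul_comm]
      · rw [hf3, h2]
    · rintro _ ⟨u, rfl⟩
      refine ⟨?_, hf3 u⟩
      change darboux e d C (f u) = 0
      rw [darboux_apply, hf1, hf2, hf3, hx, hy, Submodule.coe_zero]
      ring
  rw [hrange, LinearMap.finrank_range_of_inj hinj]

/-- For a cofactor `K` the product `C K` is divisible by `G`, and `G` is coprime to `C`, so `K = G
K'`. Then `C K' ∈ (A, A')`, and every such `K'` of the right degree occurs. -/
theorem map_snd_ker_darboux (hA : A ∈ gr a) (hA' : A' ∈ gr a) (hG : G ∈ gr g)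
    (hga : g + a = e - 1) (hx : pderiv 0 C.1 = G * A) (hy : pderiv 1 C.1 = G * A') (hG0 : G ≠ 0)
    (hGC : IsRelPrime G C.1) :
    Module.finrank ℂ ((LinearMap.ker (darboux e d C)).map
      (LinearMap.snd ℂ (Hom d × Hom d) (gr (d - 1)))) = hd (colonIdeal A A' C.1) (d + a - e) := by
  have hinj : Function.Injective (LinearMap.mulLeft ℂ G) := fun u v => mul_left_cancel₀ hG0
  rw [hd, ← Submodule.finrank_map_subtype_eq (gr (d - 1)),
    (Submodule.equivMapOfInjective _ hinj (gr (d + a - e) ⊓ (colonIdeal A A'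
      C.1).restrictScalars ℂ)).finrank_eq]
  have : ((LinearMap.ker (darboux e d C)).map
      (LinearMap.snd ℂ (Hom d × Hom d) (gr (d - 1)))).map (gr (d - 1)).subtype =
      (gr (d + a - e) ⊓ (colonIdeal A A' C.1).restrictScalars ℂ).map (LinearMap.mulLeft ℂ G) := by
    apply le_antisymm
    · rintro _ ⟨_, ⟨w, hw, rfl⟩, rfl⟩
      have hw : darboux e d C w = 0 := hw
      rw [darboux_apply, hx, hy, sub_eq_zero] at hw
      change w.2.1 ∈ _
      obtain ⟨K, hK⟩ : G ∣ w.2.1 := hGC.dvd_of_dvd_mul_left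
        ⟨A * w.1.2.1 - A' * w.1.1.1, by linear_combination -hw⟩
      refine ⟨K, ⟨mem_gr_of_mul_mem hG hG0 ?_, ?_⟩, hK.symm⟩
      · rw [← hK, show g + (d + a - e) = (d : ℤ) - 1 by linear_combination hga]
        exact w.2.2
      · rw [SetLike.mem_coe, Submodule.restrictScalars_mem, mem_colonIdeal, Ideal.mem_span_pair]
        refine ⟨w.1.2.1, -w.1.1.1, mul_left_cancel₀ hG0 ?_⟩
        rw [hK] at hw
        linear_combination hw
    · rintro _ ⟨K, ⟨hK, hK'⟩, rfl⟩
      have hCK : C.1 * K ∈ gr (d + a) := by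
        have := mul_mem_gr (hom_le_gr C.2) hK
        rwa [show (e : ℤ) + (d + a - e) = d + a by ring] at this
      obtain ⟨q, hq, p, hp, h⟩ := exists_homogeneous_combination_pair hA hA' hCK hK'
      rw [add_sub_cancel_right, gr_natCast] at hq hp
      have hGK : G * K ∈ gr (d - 1) := by
        have := mul_mem_gr hG hK
        rwa [show g + (d + a - e) = (d : ℤ) - 1 by linear_combination hga] at this
      refine ⟨⟨G * K, hGK⟩, ⟨((-⟨p, hp⟩, ⟨q, hq⟩), ⟨G * K, hGK⟩), ?_, rfl⟩, rfl⟩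
      change darboux e d C _ = 0
      rw [darboux_apply, hx, hy]
      simp only [Submodule.coe_neg]
      linear_combination -G * h
  rw [this]

theorem finrank_integralForms_of_factorization (hC : C ≠ 0) (hA : A ∈ gr a) (hA' : A' ∈ gr a)
    (hG : G ∈ gr g) (hga : g + a = e - 1) (hx : pderiv 0 C.1 = G * A) (hy : pderiv 1 C.1 = G * A')
    (hG0 : G ≠ 0) (h : IsRelPrime A A') (hGC : IsRelPrime G C.1) :
    Module.finrank ℂ (integralForms C.1 d) =
      Module.finrank ℂ (gr (d - a)) + hd (colonIdeal A A' C.1) (d + a - e) := by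
  rw [← (kerDarbouxEquiv d hC).finrank_eq, ← finrank_ker_inf_ker (C := C) hA hA' h hx hy hG0,
    ← map_snd_ker_darboux hA hA' hG hga hx hy hG0 hGC]
  rw [add_comm, finrank_map_add_finrank_inf_ker]

end

theorem hd_le_of_dvd {e : ℕ} {C : Hom e} (hC : C ≠ 0) {F : MvPolynomial (Fin 3) ℂ}
    (h : ∀ u ∈ singIdeal C.1, F ∣ u) (hF : ¬ IsUnit F) (j : ℤ) :
    hd (singIdeal C.1) j ≤ Module.finrank ℂ (gr (j - 1)) := by
  have hC' : C.1 ≠ 0 := fun h => hC (Subtype.ext h)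
  have hFC : F ∣ C.1 := h _ (Ideal.subset_span (by simp))
  have hF0 : F ≠ 0 := fun h0 => hC' (zero_dvd_iff.mp (h0 ▸ hFC))
  obtain ⟨k, hk⟩ := exists_mem_gr_of_dvd (hom_le_gr C.2) hC' hFC
  have hk1 : 1 ≤ k := by
    by_contra hk0
    obtain rfl : k = 0 := by omega
    exact hF (isUnit_of_mem_gr_zero hk hF0)
  have hle : gr j ⊓ (singIdeal C.1).restrictScalars ℂ ≤ (gr (j - k)).map (LinearMap.mulLeft ℂ F) := by
    rintro u ⟨hu, hu'⟩
    obtain ⟨v, rfl⟩ := h u hu'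
    exact ⟨v, mem_gr_of_mul_mem hk hF0 (by rwa [add_sub_cancel]), rfl⟩
  refine (Submodule.finrank_mono hle).trans ((Submodule.finrank_map_le _ _).trans ?_)
  rw [finrank_gr, finrank_gr]
  exact Nat.choose_le_choose 2 (by omega)

/-- A common factor of positive degree would force the ideal to have codimension at least `n + 1` in
degree `n`, which exceeds `t` for `n ≥ t`. -/
theorem isUnit_of_dvd_singIdeal {e t : ℕ} {C : Hom e} (hC : C ≠ 0)
    (ht : SingSchemeFiniteOfDegree C.1 t) {F : MvPolynomial (Fin 3) ℂ}
    (h : ∀ u ∈ singIdeal C.1, F ∣ u) : IsUnit F := by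
  by_contra hF
  obtain ⟨N, hN⟩ := ht
  have h1 := hd_le_of_dvd hC h hF ((max N t : ℕ) : ℤ)
  have h2 := hd_add_finrank_quotient (singIdeal C.1) (max N t)
  rw [hN _ (le_max_left _ _)] at h2
  rw [finrank_gr, show (((max N t : ℕ) : ℤ) - 1 + 2).toNat = max N t + 1 by omega] at h1
  have h3 : (max N t + 2).choose 2 = max N t + 1 + (max N t + 1).choose 2 := by
    rw [Nat.choose_succ_succ' (max N t + 1) 1, Nat.choose_one_right]
  have := le_max_right N t
  omega

theorem dvd_of_mem_singIdeal {C F : MvPolynomial (Fin 3) ℂ} (h0 : F ∣ pderiv 0 C)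
    (h1 : F ∣ pderiv 1 C) (h2 : F ∣ C) : ∀ u ∈ singIdeal C, F ∣ u := by
  intro u hu
  rw [← Ideal.mem_span_singleton]
  refine (Ideal.span_le.mpr ?_ : singIdeal C ≤ Ideal.span {F}) hu
  rintro _ (rfl | rfl | rfl) <;> exact Ideal.mem_span_singleton.mpr (by assumption)

/-- `G` is the gcd of the two partial derivatives. Finiteness of the singular scheme excludes that
both vanish, as `C` would then divide the whole ideal, and makes `G` coprime to `C`. -/
theorem exists_factorization {e t : ℕ} {C : Hom e} (he : 1 ≤ e) (hC : C ≠ 0)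
    (ht : SingSchemeFiniteOfDegree C.1 t) :
    ∃ (G A A' : MvPolynomial (Fin 3) ℂ) (g a : ℕ), G ∈ gr g ∧ A ∈ gr a ∧ A' ∈ gr a ∧
      (g : ℤ) + a = e - 1 ∧ pderiv 0 C.1 = G * A ∧ pderiv 1 C.1 = G * A' ∧ G ≠ 0 ∧
      IsRelPrime A A' ∧ IsRelPrime G C.1 := by
  have hC' : C.1 ≠ 0 := fun h => hC (Subtype.ext h)
  have hx := pderiv_mem_gr (hom_le_gr C.2) 0
  have hy := pderiv_mem_gr (hom_le_gr C.2) 1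
  have hne : pderiv 0 C.1 ≠ 0 ∨ pderiv 1 C.1 ≠ 0 := by
    by_contra! h0
    have hu := isUnit_of_dvd_singIdeal hC ht (F := C.1)
      (dvd_of_mem_singIdeal (by rw [h0.1]; exact dvd_zero _) (by rw [h0.2]; exact dvd_zero _) dvd_rfl)
    obtain ⟨c, hc⟩ := (MvPolynomial.isUnit_iff_eq_C_of_isReduced).mp hu
    have h3 : C.1 ∈ gr 0 := by
      rw [hc.2]
      exact isWeightedHomogeneous_C _ _
    have := IsWeightedHomogeneous.inj_right hC' (hom_le_gr C.2) h3
    omega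
  obtain ⟨A, A', G, h, h1, h2⟩ : ∃ A A' G, IsRelPrime A A' ∧ G * A = pderiv 0 C.1 ∧
      G * A' = pderiv 1 C.1 := by
    rcases hne with h0 | h0
    · exact UniqueFactorizationMonoid.exists_reduced_factors _ h0 _
    · exact UniqueFactorizationMonoid.exists_reduced_factors' _ _ h0
  have hG0 : G ≠ 0 := by
    rintro rfl
    rw [zero_mul] at h1 h2
    exact hne.elim (fun h => h h1.symm) (fun h => h h2.symm)
  obtain ⟨g, hg⟩ : ∃ g : ℕ, G ∈ gr g := by
    rcases hne with h0 | h0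
    · exact exists_mem_gr_of_dvd hx h0 ⟨_, h1.symm⟩
    · exact exists_mem_gr_of_dvd hy h0 ⟨_, h2.symm⟩
  have hA : A ∈ gr (e - 1 - g) := mem_gr_of_mul_mem hg hG0 (by rwa [h1, add_sub_cancel])
  have hA' : A' ∈ gr (e - 1 - g) := mem_gr_of_mul_mem hg hG0 (by rwa [h2, add_sub_cancel])
  have ha : (0 : ℤ) ≤ e - 1 - g := by
    by_contra hneg
    rw [gr_of_neg (not_le.mp hneg), Submodule.mem_bot] at hA hA'
    rw [hA, hA'] at h
    exact not_isUnit_zero (h dvd_rfl dvd_rfl)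
  refine ⟨G, A, A', g, (e - 1 - g : ℤ).toNat, hg, ?_, ?_, ?_, h1.symm, h2.symm, hG0, h, ?_⟩
  · rwa [Int.toNat_of_nonneg ha]
  · rwa [Int.toNat_of_nonneg ha]
  · rw [Int.toNat_of_nonneg ha]; ring
  · intro F hFG hFC
    exact isUnit_of_dvd_singIdeal hC ht (dvd_of_mem_singIdeal (h1 ▸ hFG.mul_right _)
      (h2 ▸ hFG.mul_right _) hFC)

end LowerBound
end PlaneForms

end

open MvPolynomial
noncomputable section
namespace PlaneForms

/-! ### Comparison of the actual and the expected dimension -/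

section Numerical

theorem two_mul_choose_two (n : ℕ) : 2 * (n.choose 2 : ℤ) = n * (n - 1) := by
  induction n with
  | zero => simp
  | succ k ih =>
    rw [Nat.choose_succ_succ' k 1, Nat.choose_one_right]
    push_cast
    linear_combination ih

theorem two_mul_finrank_gr {j : ℤ} (hj : -2 ≤ j) :
    2 * (Module.finrank ℂ (gr j) : ℤ) = (j + 2) * (j + 1) := by
  rw [finrank_gr, two_mul_choose_two, Int.toNat_of_nonneg (by omega)]
  ring

theorem finrank_gr_of_neg {j : ℤ} (hj : j < 0) : Module.finrank ℂ (gr j) = 0 := by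
  rw [gr_of_neg hj, finrank_bot]

theorem expectedDim_eq (d e t : ℕ) : expectedDim d e t =
    Module.finrank ℂ (gr (d + 1 - e)) + Module.finrank ℂ (gr (d - 1)) - ((e : ℤ) - 1) ^ 2 + t := by
  rw [expectedDim, finrank_gr, finrank_gr, show ((d : ℤ) + 1 - e + 2).toNat = d + 3 - e by omega,
    show ((d : ℤ) - 1 + 2).toNat = d + 1 by omega]

/-- In high degree the ideal has codimension exactly `t`, so `finrank_integralForms` becomes an
explicit quadratic formula. -/
theorem finrank_integralForms_of_large {e t : ℕ} {C : Hom e} (he : 1 ≤ e) (hC : C ≠ 0)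
    (ht : SingSchemeFiniteOfDegree C.1 t) :
    ∃ N : ℕ, ∀ M ≥ N, 2 * (Module.finrank ℂ (integralForms C.1 M) : ℤ) =
      2 * (M + 2) * (M + 1) + (M + 1) * M - (e + M + 1) * (e + M) + 2 * t := by
  obtain ⟨N, hN⟩ := ht
  refine ⟨N, fun M hM => ?_⟩
  have h1 := finrank_integralForms M hC
  have h2 := hd_add_finrank_quotient (singIdeal C.1) (e + M - 1)
  rw [hN _ (by omega), show ((e + M - 1 : ℕ) : ℤ) = e + M - 1 by omega] at h2
  have h3 := two_mul_choose_two (M + 2)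
  have h4 := two_mul_choose_two (M + 1)
  have h5 := two_mul_choose_two (e + M - 1 + 2)
  rw [show e + M - 1 + 2 = e + M + 1 by omega] at h2 h5
  push_cast at h3 h4 h5
  zify at h1 h2
  linear_combination 2 * h1 - 2 * h2 + 2 * h3 + h4 - h5

/-- A nonzerodivisor modulo `(A, A')` remains one modulo the colon ideal, so the Hilbert function of
the quotient by the colon ideal cannot decrease. -/
theorem finrank_sub_hd_mono {A A' D : MvPolynomial (Fin 3) ℂ} (h : IsRelPrime A A') {m n : ℤ}
    (hmn : m ≤ n) :
    (Module.finrank ℂ (gr m) : ℤ) - hd (colonIdeal A A' D) m ≤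
      Module.finrank ℂ (gr n) - hd (colonIdeal A A' D) n := by
  obtain ⟨l, hl, hl'⟩ := exists_linear_nonZeroDivisor h
  induction n, hmn using Int.leInduction with
  | base => rfl
  | succ n hn ih =>
    have := hd_succ_add_finrank_le (I := colonIdeal A A' D) hl (fun u hu => by
      rw [mem_colonIdeal] at hu ⊢
      exact hl' _ (by rwa [mul_left_comm])) n
    omega

/-- The codimension of the colon ideal in degree `d + a - e` is at most its value in a large degree,
and that value is known from `t`. The second alternative in `h` expresses `a ≥ 1` through `V_C(0)`,
a form in which it is visibly an open condition on the curve. -/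
theorem expectedDim_le_finrank {e d t : ℕ} {C : Hom e} (he : 1 ≤ e) (hC : C ≠ 0)
    (ht : SingSchemeFiniteOfDegree C.1 t) (h : e ≤ d + 2 ∨ integralForms C.1 0 = ⊥) :
    expectedDim d e t ≤ Module.finrank ℂ (integralForms C.1 d) := by
  obtain ⟨G, A, A', g, a, hG, hA, hA', hga, hx, hy, hG0, hAA', hGC⟩ := exists_factorization he hC ht
  have hv := fun n : ℕ => finrank_integralForms_of_factorization (d := n) hC hA hA' hG hga hx hy
    hG0 hAA' hGC
  obtain ⟨N, hN⟩ := finrank_integralForms_of_large he hC ht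
  let M := N + d + e + a
  have h1 := hN M (by omega)
  have h2 := hv M
  have h3 := hv d
  have h4 := finrank_sub_hd_mono (D := C.1) hAA' (m := d + a - e) (n := M + a - e) (by omega)
  have h5 := two_mul_finrank_gr (j := M - a) (by omega)
  have h6 := two_mul_finrank_gr (j := M + a - e) (by omega)
  -- If `a = 0`, the constant multiples of `(A, A')` are nonzero elements of `V_C(0)`.
  have ha : e ≤ d + 2 ∨ 1 ≤ a := by
    refine h.imp_right fun h0 => ?_
    by_contra ha
    obtain rfl : a = 0 := by omega
    have h7 := hv 0
    rw [h0, finrank_bot, finrank_gr] at h7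
    simp at h7
    omega
  have h8 := two_mul_finrank_gr (j := d - 1) (by omega)
  rw [expectedDim_eq]
  zify at h2 h3
  have hg : (g : ℤ) = e - 1 - a := by omega
  have key : 2 * (Module.finrank ℂ (gr (d + 1 - e)) + Module.finrank ℂ (gr (d - 1)) -
      ((e : ℤ) - 1) ^ 2 + t) ≤ 2 * Module.finrank ℂ (integralForms C.1 d) := by
    suffices 2 * (Module.finrank ℂ (gr (d + 1 - e)) : ℤ) + (d + 1) * d - 2 * ((e : ℤ) - 1) ^ 2 ≤
        2 * Module.finrank ℂ (gr (d - a)) + 2 * Module.finrank ℂ (gr (d + a - e)) -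
        (M - a + 2) * (M - a + 1) - (M + a - e + 2) * (M + a - e + 1) + 
        2 * (M + 2) * (M + 1) + (M + 1) * M - (e + M + 1) * (e + M) by linarith
    clear_value M
    clear hN h1 h2 h3 h4 h5 h6 h8 hv
    have hga' : (a : ℤ) ≤ e - 1 := by omega
    -- The quadratic formula for the dimension of a graded piece holds only from degree `-2` on;
    -- below that the dimension is 0. Hence the case distinction on each degree.
    rcases lt_or_ge ((d : ℤ) + 1 - e) (-2) with hde | hde
    · have ha1 : 1 ≤ a := by omega
      rw [finrank_gr_of_neg (j := d + 1 - e) (by omega)]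
      rcases lt_or_ge ((d : ℤ) - a) (-2) with hda | hda
      · rw [finrank_gr_of_neg (j := d - a) (by omega)]
        rcases lt_or_ge ((d : ℤ) + a - e) (-2) with hdae | hdae
        · rw [finrank_gr_of_neg (j := d + a - e) (by omega)]
          obtain ⟨u, hu⟩ := Int.eq_ofNat_of_zero_le (show (0 : ℤ) ≤ e - d - a - 2 by omega)
          obtain ⟨w, hw⟩ := Int.eq_ofNat_of_zero_le (show (0 : ℤ) ≤ a - d - 2 by omega)
          obtain rfl : e = u + w + 2 * d + 4 := by omega
          obtain rfl : a = w + d + 2 := by omega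
          push_cast
          have : (0 : ℤ) ≤ u * w + u * d + w * d + d * d + d + u + w := by positivity
          nlinarith
        · rw [two_mul_finrank_gr (j := d + a - e) (by omega)]
          obtain ⟨w, hw⟩ := Int.eq_ofNat_of_zero_le (show (0 : ℤ) ≤ a - d - 2 by omega)
          obtain ⟨u, hu⟩ := Int.eq_ofNat_of_zero_le (show (0 : ℤ) ≤ e - 1 - a by omega)
          obtain rfl : e = u + w + d + 3 := by omega
          obtain rfl : a = w + d + 2 := by omega
          push_cast
          have : (0 : ℤ) ≤ u * w + u * u + u := by positivity
          nlinarith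
      · rw [two_mul_finrank_gr (j := d - a) (by omega)]
        rcases lt_or_ge ((d : ℤ) + a - e) (-2) with hdae | hdae
        · rw [finrank_gr_of_neg (j := d + a - e) (by omega)]
          obtain ⟨u, hu⟩ := Int.eq_ofNat_of_zero_le (show (0 : ℤ) ≤ e - d - a - 2 by omega)
          obtain ⟨w, hw⟩ := Int.eq_ofNat_of_zero_le (show (0 : ℤ) ≤ a - 1 by omega)
          obtain rfl : e = u + w + d + 3 := by omega
          obtain rfl : a = w + 1 := by omega
          push_cast
          have : (0 : ℤ) ≤ u * w + w * w + w := by positivity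
          nlinarith
        · rw [two_mul_finrank_gr (j := d + a - e) (by omega)]
          obtain ⟨u, hu⟩ := Int.eq_ofNat_of_zero_le (show (0 : ℤ) ≤ e - d - 4 by omega)
          obtain rfl : e = u + d + 4 := by omega
          push_cast
          have : (0 : ℤ) ≤ u * u + u := by positivity
          nlinarith
    -- When all degrees are at least `-2` the two sides agree identically: `a` and `M` cancel.
    · rw [two_mul_finrank_gr hde, two_mul_finrank_gr (j := d - a) (by omega),
        two_mul_finrank_gr (j := d + a - e) (by omega)]
      linarith
  linarith

/-- A nonzero constant form forces `a = 0`, geometrically a union of parallel lines. Then the colon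
ideal is the whole ring, `t = e(e - 1)`, and `V_C(d)` consists of the multiples of one constant
form, which leaves it short of `δ` by `e - d - 2 > 0`. -/
theorem finrank_lt_expectedDim {e d t : ℕ} {C : Hom e} (hC : C ≠ 0)
    (ht : SingSchemeFiniteOfDegree C.1 t) (hde : d + 3 ≤ e) (h : integralForms C.1 0 ≠ ⊥) :
    (Module.finrank ℂ (integralForms C.1 d) : ℤ) < expectedDim d e t := by
  have he : 1 ≤ e := by omega
  obtain ⟨G, A, A', g, a, hG, hA, hA', hga, hx, hy, hG0, hAA', hGC⟩ := exists_factorization he hC ht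
  have hv := fun n : ℕ => finrank_integralForms_of_factorization (d := n) hC hA hA' hG hga hx hy
    hG0 hAA' hGC
  obtain ⟨N, hN⟩ := finrank_integralForms_of_large he hC ht
  have hneg : ∀ j : ℤ, j < 0 → hd (colonIdeal A A' C.1) j = 0 := fun j hj => by
    have := hd_le (colonIdeal A A' C.1) j
    rw [finrank_gr_of_neg hj] at this
    omega
  have ha : a = 0 := by
    by_contra ha
    apply h
    rw [← Submodule.finrank_eq_zero, hv 0, hneg _ (by omega), finrank_gr_of_neg (by omega)]
  subst ha
  have htop : colonIdeal A A' C.1 = ⊤ := by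
    have h1 : Ideal.span {A, A'} = ⊤ := by
      by_cases hA0 : A = 0
      · exact Ideal.eq_top_of_isUnit_mem _ (Ideal.subset_span (by simp))
          (hAA' (hA0 ▸ dvd_zero _) dvd_rfl : IsUnit A')
      · exact Ideal.eq_top_of_isUnit_mem _ (Ideal.subset_span (by simp))
          (isUnit_of_mem_gr_zero hA hA0)
    rw [colonIdeal, h1, Submodule.comap_top]
  let M := N + d + e
  have h1 := hN M (by omega)
  have h2 := hv M
  have h3 := hv d
  rw [hneg _ (by omega)] at h3
  have h4 : hd (colonIdeal A A' C.1) (M + (0 : ℕ) - e) = Module.finrank ℂ (gr (M + (0 : ℕ) - e)) := by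
    rw [htop, hd, Submodule.restrictScalars_top, inf_top_eq]
  rw [h4] at h2
  have h5 := two_mul_finrank_gr (j := M - (0 : ℕ)) (by omega)
  have h6 := two_mul_finrank_gr (j := M + (0 : ℕ) - e) (by omega)
  have h7 := two_mul_finrank_gr (j := d - (0 : ℕ)) (by omega)
  have h8 := two_mul_finrank_gr (j := d - 1) (by omega)
  rw [expectedDim_eq, finrank_gr_of_neg (j := d + 1 - e) (by omega)]
  zify at h2 h3
  push_cast at *
  obtain ⟨u, hu⟩ := Int.eq_ofNat_of_zero_le (show (0 : ℤ) ≤ e - d - 3 by omega)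
  obtain rfl : e = u + d + 3 := by omega
  push_cast at *
  have : (0 : ℤ) ≤ u * u + u := by positivity
  have h9 : 2 * (Module.finrank ℂ (gr (d - 0)) : ℤ) + 0 < 2 * (0 + Module.finrank ℂ (gr (d - 1)) - ((u : ℤ) + d + 3 - 1) ^ 2 + t) := by
    nlinarith
  linarith

end Numerical
end PlaneForms

end

open MvPolynomial
noncomputable section
namespace PlaneForms

/-- Being reduced and affine near `C` is obtained from semicontinuity in one auxiliary degree `n`. A
repeated factor of `D`, or the factor `z`, divides the whole singular ideal of `D`; in large degree
this makes the ideal smaller, hence `V_D(n)` larger, than for `C`. -/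
theorem exists_forall_reduced {e t : ℕ} {C : Hom e} (hC : C ≠ 0)
    (ht : SingSchemeFiniteOfDegree C.1 t) :
    ∃ n : ℕ, ∀ D : Hom e, D ≠ 0 → Module.finrank ℂ (integralForms D.1 n) ≤
      Module.finrank ℂ (integralForms C.1 n) → Squarefree D.1 ∧ ¬ X 2 ∣ D.1 := by
  obtain ⟨N, hN⟩ := ht
  refine ⟨N + t + 1, fun D hD hDC => ?_⟩
  have key : ∀ F, (∀ u ∈ singIdeal D.1, F ∣ u) → IsUnit F := by
    intro F hF
    by_contra hu
    have h1 := hd_le_of_dvd hD hF hu (e + (N + t + 1 : ℕ) - 1)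
    have h2 := finrank_integralForms (N + t + 1) hD
    have h3 := finrank_integralForms (N + t + 1) hC
    have h4 := hd_add_finrank_quotient (singIdeal C.1) (e + N + t)
    rw [hN _ (by omega), show ((e + N + t : ℕ) : ℤ) = e + (N + t + 1 : ℕ) - 1 by push_cast; ring]
      at h4
    rw [finrank_gr, show ((e : ℤ) + (N + t + 1 : ℕ) - 1 - 1 + 2).toNat = e + N + t + 1 by omega]
      at h1
    have h5 : (e + N + t + 2).choose 2 = e + N + t + 1 + (e + N + t + 1).choose 2 := by
      rw [Nat.choose_succ_succ' (e + N + t + 1) 1, Nat.choose_one_right]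
    omega
  refine ⟨fun x hx => key x ?_, fun h => ?_⟩
  · obtain ⟨r, hr⟩ := hx
    refine dvd_of_mem_singIdeal ?_ ?_ ⟨x * r, by rw [hr, mul_assoc]⟩ <;>
    · rw [hr, mul_assoc, Derivation.leibniz, smul_eq_mul, smul_eq_mul]
      exact dvd_add (dvd_mul_right _ _) ⟨r * pderiv _ x, by ring⟩
  · refine (X_prime (i := (2 : Fin 3)) (R := ℂ)).not_isUnit (key _ ?_)
    obtain ⟨r, hr⟩ := h
    refine dvd_of_mem_singIdeal ?_ ?_ ⟨r, hr⟩ <;>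
    · rw [hr, Derivation.leibniz, pderiv_X_of_ne (by decide), smul_zero, add_zero]
      exact dvd_mul_right _ _

theorem integralForms_eq_top (C : Hom 0) (d : ℕ) : integralForms C.1 d = ⊤ := by
  have h := C.2
  rw [mem_homogeneousSubmodule, ← totalDegree_zero_iff_isHomogeneous, totalDegree_eq_zero_iff_eq_C]
    at h
  refine eq_top_iff.mpr fun η _ => ⟨0, ?_⟩
  rw [h, pderiv_C, pderiv_C]
  ring

/-! ### Families of kernels of linear maps -/

section Bundle

variable {E E' : Type} [AddCommGroup E] [Module ℂ E] [AddCommGroup E'] [Module ℂ E']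

theorem det_mem_polynomialFunctions {n : Type} [Fintype n] [DecidableEq n] {M : E → Matrix n n ℂ}
    (hM : ∀ i j, (fun v => M v i j) ∈ polynomialFunctions E) :
    (fun v => (M v).det) ∈ polynomialFunctions E := by
  have : (fun v => (M v).det) = ∑ σ : Equiv.Perm n, (Equiv.Perm.sign σ : ℤ) •
      ∏ i, fun v => M v (σ i) i := by
    ext v
    simp [Matrix.det_apply, Units.smul_def]
  rw [this]
  exact sum_mem fun σ _ => zsmul_mem (prod_mem fun i _ => hM _ _) _

theorem adjugate_mem_polynomialFunctions {n : Type} [Fintype n] [DecidableEq n]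
    {M : E → Matrix n n ℂ} (hM : ∀ i j, (fun v => M v i j) ∈ polynomialFunctions E) (i j : n) :
    (fun v => (M v).adjugate i j) ∈ polynomialFunctions E := by
  simp only [Matrix.adjugate_apply]
  refine det_mem_polynomialFunctions fun i' j' => ?_
  simp only [Matrix.updateRow_apply]
  split_ifs
  · exact const_mem_polynomialFunctions _
  · exact hM _ _

theorem isPolyMap_pi {n : Type} [Fintype n] [DecidableEq n] {s : E → n → ℂ}
    (hs : ∀ i, (fun v => s v i) ∈ polynomialFunctions E) : IsPolyMap s := by
  intro l
  have : (fun v => l (s v)) = ∑ i, l (Pi.single i 1) • fun v => s v i := by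
    ext v
    conv_lhs => rw [← LinearMap.sum_single_apply (fun _ => ℂ) (s v)]
    simp only [map_sum, Finset.sum_apply, Pi.smul_apply, smul_eq_mul]
    refine Finset.sum_congr rfl fun i _ => ?_
    rw [mul_comm, ← smul_eq_mul, ← map_smul]
    congr 1
    ext j
    simp [Pi.single_apply]
  rw [this]
  exact sum_mem fun i _ => Subalgebra.smul_mem _ (hs i) _

/-- Near a given point the kernels of a linear family of linear maps do not grow, they are
complementary to a fixed subspace, and they have sections as long as they do not shrink. -/
theorem exists_local_sections [FiniteDimensional ℂ E] {F X : Type} [AddCommGroup F] [Module ℂ F]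
    [AddCommGroup X] [Module ℂ X] (Ψ : X →ₗ[ℂ] E →ₗ[ℂ] F) (D₁ : X) :
    ∃ h ∈ polynomialFunctions X, h D₁ ≠ 0 ∧
      (∃ q : E →ₗ[ℂ] LinearMap.ker (Ψ D₁), ∀ D, h D ≠ 0 → ∀ w, Ψ D w = 0 → q w = 0 → w = 0) ∧
      ∀ w₁, Ψ D₁ w₁ = 0 → ∃ s : X → E, IsPolyMap s ∧ s D₁ = w₁ ∧ ∀ D, h D ≠ 0 →
        Module.finrank ℂ (LinearMap.ker (Ψ D₁)) ≤ Module.finrank ℂ (LinearMap.ker (Ψ D)) →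
        Ψ D (s D) = 0 := by
  obtain ⟨W, hW⟩ := (LinearMap.ker (Ψ D₁)).exists_isCompl
  let n := Fin (Module.finrank ℂ W)
  let b := Module.finBasis ℂ W
  let ι : (n → ℂ) →ₗ[ℂ] E := W.subtype ∘ₗ b.equivFun.symm.toLinearMap
  have hιW : LinearMap.range ι = W := by
    rw [LinearMap.range_comp, LinearEquiv.range, Submodule.map_top, Submodule.range_subtype]
  have hinj : Function.Injective (Ψ D₁ ∘ₗ ι) := by
    refine (injective_iff_map_eq_zero _).mpr fun v hv => ?_
    have h1 : ι v ∈ LinearMap.ker (Ψ D₁) ⊓ W := ⟨hv, hιW ▸ ⟨v, rfl⟩⟩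
    rw [hW.inf_eq_bot, Submodule.mem_bot] at h1
    exact b.equivFun.symm.injective (Subtype.val_injective (by rw [map_zero]; exact h1))
  obtain ⟨π, hπ⟩ := LinearMap.exists_leftInverse_of_injective _ (LinearMap.ker_eq_bot.mpr hinj)
  -- `M D` is the restriction of `Ψ D` to a complement `W` of the kernel at `D₁`, followed by a left
  -- inverse chosen at `D₁`. Its determinant is polynomial in `D` and equals 1 at `D₁`; where it is
  -- nonzero, the kernel of `Ψ D` meets `W` trivially.
  let M : X → Matrix n n ℂ := fun D => LinearMap.toMatrix' (π ∘ₗ Ψ D ∘ₗ ι)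
  have hMapp : ∀ D v, (M D).mulVec v = π (Ψ D (ι v)) := fun D v => by
    rw [← Matrix.toLin'_apply, Matrix.toLin'_toMatrix']; rfl
  have hM : ∀ i j, (fun D => M D i j) ∈ polynomialFunctions X := fun i j => by
    have : (fun D => M D i j) =
        fun D => (LinearMap.proj i ∘ₗ π ∘ₗ (LinearMap.flip Ψ) (ι (Pi.single j 1))) D := by
      ext D
      simp only [M, LinearMap.toMatrix'_apply]
      rfl
    rw [this]
    exact dual_mem_polynomialFunctions _
  have hM1 : M D₁ = 1 := by
    simp only [M, hπ, LinearMap.toMatrix'_id]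
  have hdet := det_mem_polynomialFunctions hM
  have hinf : ∀ D, (M D).det ≠ 0 → LinearMap.ker (Ψ D) ⊓ W = ⊥ := by
    intro D hD
    rw [eq_bot_iff]
    rintro w ⟨hw, hwW⟩
    rw [SetLike.mem_coe, ← hιW] at hwW
    obtain ⟨v, rfl⟩ := hwW
    have hw : Ψ D (ι v) = 0 := hw
    have h1 : (M D).mulVec v = 0 := by rw [hMapp, hw, map_zero]
    rw [Matrix.eq_zero_of_mulVec_eq_zero hD h1, map_zero]
    exact zero_mem _
  refine ⟨_, hdet, by rw [hM1, Matrix.det_one]; exact one_ne_zero,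
    ⟨Submodule.projectionOnto _ _ hW, fun D hD w hw hq => ?_⟩, fun w₁ hw₁ => ?_⟩
  · rw [Submodule.projectionOnto_apply_eq_zero_iff] at hq
    have : w ∈ LinearMap.ker (Ψ D) ⊓ W := ⟨hw, hq⟩
    rwa [hinf D hD, Submodule.mem_bot] at this
  -- Cramer's rule: this is `det (M D)` times the projection of `w₁` to the kernel of `Ψ D` along
  -- `W`, with the denominator cleared. It lies in the kernel as soon as that kernel is a complement
  -- of `W`.
  · refine ⟨fun D => (M D).det • w₁ - ι ((M D).adjugate.mulVec (π (Ψ D w₁))), ?_, ?_, ?_⟩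
    · refine (IsPolyMap.smul hdet (isPolyMap_const _)).sub
        ((isPolyMap_linear ι).comp (isPolyMap_pi fun i => ?_))
      have : (fun D => (M D).adjugate.mulVec (π (Ψ D w₁)) i) = ∑ j, (fun D => (M D).adjugate i j) *
          fun D => (LinearMap.proj j ∘ₗ π ∘ₗ (LinearMap.flip Ψ) w₁) D := by
        ext D
        simp [Matrix.mulVec, dotProduct]
      rw [this]
      exact sum_mem fun j _ => mul_mem (adjugate_mem_polynomialFunctions hM i j)
        (dual_mem_polynomialFunctions _)
    · simp [hM1, hw₁]
    · intro D hD hr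
      have hsup : LinearMap.ker (Ψ D) ⊔ W = ⊤ := by
        apply Submodule.eq_top_of_finrank_eq
        have h1 := Submodule.finrank_sup_add_finrank_inf_eq (LinearMap.ker (Ψ D)) W
        rw [hinf D hD, finrank_bot] at h1
        have h2 := Submodule.finrank_add_eq_of_isCompl hW
        have h3 := Submodule.finrank_le (LinearMap.ker (Ψ D) ⊔ W)
        omega
      have : w₁ ∈ LinearMap.ker (Ψ D) ⊔ W := hsup ▸ trivial
      obtain ⟨k, hk, w, hw, rfl⟩ := Submodule.mem_sup.mp this
      have hk : Ψ D k = 0 := hk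
      rw [← hιW] at hw
      obtain ⟨v, rfl⟩ := hw
      have h4 : (M D).adjugate.mulVec (π (Ψ D (k + ι v))) = (M D).det • v := by
        rw [map_add, hk, zero_add, ← hMapp, Matrix.mulVec_mulVec, Matrix.adjugate_mul,
          Matrix.smul_mulVec, Matrix.one_mulVec]
      change Ψ D ((M D).det • (k + ι v) - ι ((M D).adjugate.mulVec (π (Ψ D (k + ι v))))) = 0
      rw [h4, map_smul, ← smul_sub, add_sub_cancel_right, map_smul, hk, smul_zero]

theorem exists_finrank_ker_le [FiniteDimensional ℂ E] {F X : Type} [AddCommGroup F] [Module ℂ F]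
    [AddCommGroup X] [Module ℂ X] (Ψ : X →ₗ[ℂ] E →ₗ[ℂ] F) (D₁ : X) :
    ∃ h ∈ polynomialFunctions X, h D₁ ≠ 0 ∧ ∀ D, h D ≠ 0 →
      Module.finrank ℂ (LinearMap.ker (Ψ D)) ≤ Module.finrank ℂ (LinearMap.ker (Ψ D₁)) := by
  obtain ⟨h, hh, h1, ⟨q, hq⟩, -⟩ := exists_local_sections Ψ D₁
  refine ⟨h, hh, h1, fun D hD => ?_⟩
  refine LinearMap.finrank_le_finrank_of_injective (f := q.domRestrict (LinearMap.ker (Ψ D)))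
    ((injective_iff_map_eq_zero _).mpr fun w hw => Subtype.ext (hq D hD w.1 w.2 hw))

/-- The Zariski topology on a product of vector spaces; it is not the product topology. -/
abbrev zariskiTopologyProd (E E' : Type) [AddCommGroup E] [Module ℂ E] [AddCommGroup E']
    [Module ℂ E'] : TopologicalSpace (E × E') := zariskiTopology (E × E')

attribute [local instance] zariskiTopology zariskiTopologyProd

/-- The total space of a family of kernels of constant rank over an irreducible set. -/
theorem isIrreducible_bundle [FiniteDimensional ℂ E] {F X : Type} [AddCommGroup F] [Module ℂ F]
    [AddCommGroup X] [Module ℂ X] (Ψ : X →ₗ[ℂ] E →ₗ[ℂ] F) {S : Set X} (hS : IsIrreducible S)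
    {r : ℕ} (hr : ∀ D ∈ S, Module.finrank ℂ (LinearMap.ker (Ψ D)) = r) :
    IsIrreducible {v : X × E | v.1 ∈ S ∧ Ψ v.1 v.2 = 0} := by
  refine ⟨?_, isPreirreducible_zar_iff.mpr ?_⟩
  · obtain ⟨D, hD⟩ := hS.nonempty
    exact ⟨(D, 0), hD, map_zero _⟩
  · rintro f hf g hg ⟨⟨D₁, w₁⟩, ⟨hD₁, hw₁⟩, hf₁⟩ ⟨⟨D₂, w₂⟩, ⟨hD₂, hw₂⟩, hg₂⟩
    obtain ⟨h₁, hh₁, hh₁D, -, hs⟩ := exists_local_sections Ψ D₁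
    obtain ⟨s₁, hs₁, hs₁D, hs₁k⟩ := hs w₁ hw₁
    obtain ⟨h₂, hh₂, hh₂D, -, hs⟩ := exists_local_sections Ψ D₂
    obtain ⟨s₂, hs₂, hs₂D, hs₂k⟩ := hs w₂ hw₂
    -- Sections through the two given points carry both nonvanishing conditions down to the
    -- irreducible base, where they hold over a common `D`. The two values there are joined by a
    -- line in the fibre, a vector space.
    obtain ⟨D, hD, hfD, hgD⟩ := isPreirreducible_zar_iff.mp hS.isPreirreducible
      (fun D => h₁ D * f (D, s₁ D))
      (mul_mem_polynomialFunctions hh₁ ((isPolyMap_id.prodMk hs₁).comp_mem hf))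
      (fun D => h₂ D * g (D, s₂ D))
      (mul_mem_polynomialFunctions hh₂ ((isPolyMap_id.prodMk hs₂).comp_mem hg))
      ⟨D₁, hD₁, mul_ne_zero hh₁D (by rwa [hs₁D])⟩ ⟨D₂, hD₂, mul_ne_zero hh₂D (by rwa [hs₂D])⟩
    have k₁ := hs₁k D (left_ne_zero_of_mul hfD) (by rw [hr _ hD, hr _ hD₁])
    have k₂ := hs₂k D (left_ne_zero_of_mul hgD) (by rw [hr _ hD, hr _ hD₂])
    obtain ⟨c, -, hc₁, hc₂⟩ := exists_ne_zero_on_line hf hg (D, s₁ D) (0, s₂ D - s₁ D) (a := 0)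
      (b := 1) (by simpa using right_ne_zero_of_mul hfD) (by simpa using right_ne_zero_of_mul hgD)
    refine ⟨(D, s₁ D) + c • (0, s₂ D - s₁ D), ⟨by simpa using hD, ?_⟩, hc₁, hc₂⟩
    simp [k₁, k₂]

theorem isClosed_bundle [FiniteDimensional ℂ E] {F X : Type} [AddCommGroup F] [Module ℂ F]
    [AddCommGroup X] [Module ℂ X] (Ψ : X →ₗ[ℂ] E →ₗ[ℂ] F) :
    IsClosed {v : X × E | Ψ v.1 v.2 = 0} := by
  have : {v : X × E | Ψ v.1 v.2 = 0}ᶜ = ⋃ l : Module.Dual ℂ F, {v | l (Ψ v.1 v.2) ≠ 0} := by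
    ext v
    rw [Set.mem_iUnion]
    change ¬ Ψ v.1 v.2 = 0 ↔ ∃ l : Module.Dual ℂ F, l (Ψ v.1 v.2) ≠ 0
    rw [← not_forall_not, not_iff_not]
    simp only [not_not]
    exact (Module.forall_dual_apply_eq_zero_iff ℂ _).symm
  rw [← isOpen_compl_iff, this]
  refine isOpen_iUnion fun l => isOpen_ne_zero ?_
  let b := Module.finBasis ℂ E
  have : (fun v : X × E => l (Ψ v.1 v.2)) = ∑ i, (fun v : X × E => (b.coord i ∘ₗ
      LinearMap.snd ℂ X E) v) * fun v : X × E => (l ∘ₗ Ψ.flip (b i) ∘ₗ LinearMap.fst ℂ X E) v := by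
    ext v
    have h : l (Ψ v.1 v.2) = ∑ i, b.repr v.2 i * l (Ψ v.1 (b i)) := by
      nth_rewrite 1 [← b.sum_repr v.2]
      simp only [map_sum, map_smul, smul_eq_mul]
    simpa using h
  rw [this]
  exact sum_mem fun i _ => mul_mem (dual_mem_polynomialFunctions _) (dual_mem_polynomialFunctions _)

end Bundle
end PlaneForms

end

open MvPolynomial
noncomputable section
namespace PlaneForms

/-- The Zariski topology on a projective space. -/
abbrev projectiveTopology (E : Type) [AddCommGroup E] [Module ℂ E] :
    TopologicalSpace (Projectivization ℂ E) :=
  TopologicalSpace.coinduced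
    (fun v : {v : E // v ≠ 0} => (Projectivization.mk ℂ v.1 v.2 : Projectivization ℂ E))
    (TopologicalSpace.induced Subtype.val (zariskiTopology E))

attribute [local instance] zariskiTopology zariskiTopologyProd projectiveTopology

/-! ### Cones and affine slices of subsets of projective space -/

section Projective

variable {E : Type} [AddCommGroup E] [Module ℂ E]

/-- The set of nonzero vectors representing a point of `S`. -/
def cone (S : Set (Projectivization ℂ E)) : Set E :=
  {v | ∃ h : v ≠ 0, Projectivization.mk ℂ v h ∈ S}

theorem mk_smul_eq {v : E} (hv : v ≠ 0) {c : ℂ} (hcv : c • v ≠ 0) :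
    Projectivization.mk ℂ (c • v) hcv = Projectivization.mk ℂ v hv :=
  (Projectivization.mk_eq_mk_iff' ℂ _ _ _ _).mpr ⟨c, rfl⟩

theorem smul_mem_cone {S : Set (Projectivization ℂ E)} {v : E} (hv : v ∈ cone S) {c : ℂ}
    (hc : c ≠ 0) : c • v ∈ cone S := by
  obtain ⟨h, hS⟩ := hv
  exact ⟨smul_ne_zero hc h, by rwa [mk_smul_eq h]⟩

theorem cone_mono {S T : Set (Projectivization ℂ E)} (h : S ⊆ T) : cone S ⊆ cone T :=
  fun _ ⟨h0, hS⟩ => ⟨h0, h hS⟩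

theorem isOpen_iff_cone {U : Set (Projectivization ℂ E)} : IsOpen U ↔ IsOpen (cone U) := by
  rw [isOpen_coinduced, isOpen_induced_iff]
  constructor
  · rintro ⟨O, hO, h⟩
    have : cone U = O ∩ {v | v ≠ 0} := by
      ext v
      constructor
      · rintro ⟨hv, hvU⟩
        have : (⟨v, hv⟩ : {v : E // v ≠ 0}) ∈ Subtype.val ⁻¹' O := by rw [h]; exact hvU
        exact ⟨this, hv⟩
      · rintro ⟨hvO, hv⟩
        have : (⟨v, hv⟩ : {v : E // v ≠ 0}) ∈ Subtype.val ⁻¹' O := hvO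
        rw [h] at this
        exact ⟨hv, this⟩
    rw [this]
    exact hO.inter (isOpen_ne E)
  · intro hU
    exact ⟨_, hU, by ext v; exact ⟨fun h => h.2, fun h => ⟨v.2, h⟩⟩⟩

/-- The open set of points with a representative at which `f` does not vanish. -/
def nonvanishing (f : E → ℂ) : Set (Projectivization ℂ E) :=
  {p | ∃ v, ∃ h : v ≠ 0, Projectivization.mk ℂ v h = p ∧ f v ≠ 0}

theorem isOpen_nonvanishing {f : E → ℂ} (hf : f ∈ polynomialFunctions E) :
    IsOpen (nonvanishing f) := by
  -- As `f` need not be homogeneous, the nonvanishing is required at some multiple of the vector;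
  -- this gives a union of open sets over the scalars.
  have : cone (nonvanishing f) = (⋃ c : {c : ℂ // c ≠ 0}, {v : E | f (c.1 • v) ≠ 0}) ∩ {v | v ≠ 0} := by
    ext v
    constructor
    · rintro ⟨h, w, hw, hwv, hfw⟩
      obtain ⟨c, hc⟩ := (Projectivization.mk_eq_mk_iff' ℂ _ _ _ _).mp hwv
      refine ⟨Set.mem_iUnion.mpr ⟨⟨c, ?_⟩, ?_⟩, h⟩
      · rintro rfl
        rw [zero_smul] at hc
        exact hw hc.symm
      · change f (c • v) ≠ 0
        rwa [hc]
    · rintro ⟨hv, h⟩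
      obtain ⟨c, hc⟩ := Set.mem_iUnion.mp hv
      exact ⟨h, c.1 • v, smul_ne_zero c.2 h, mk_smul_eq h _, hc⟩
  rw [isOpen_iff_cone, this]
  refine IsOpen.inter (isOpen_iUnion fun c => ?_) (isOpen_ne E)
  exact isOpen_ne_zero ((isPolyMap_linear (c.1 • (LinearMap.id : E →ₗ[ℂ] E))).comp_mem hf)

theorem isIrreducible_cone {S : Set (Projectivization ℂ E)} (hS : IsIrreducible S) :
    IsIrreducible (cone S) := by
  refine ⟨?_, isPreirreducible_zar_iff.mpr ?_⟩
  · obtain ⟨p, hp⟩ := hS.nonempty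
    exact ⟨p.rep, p.rep_nonzero, by rwa [Projectivization.mk_rep]⟩
  · rintro f hf g hg ⟨v, ⟨hv, hvS⟩, hfv⟩ ⟨w, ⟨hw, hwS⟩, hgw⟩
    obtain ⟨p, hpS, ⟨v', hv', rfl, hfv'⟩, w', hw', hwp, hgw'⟩ := hS.isPreirreducible _ _
      (isOpen_nonvanishing hf) (isOpen_nonvanishing hg) ⟨_, hvS, v, hv, rfl, hfv⟩
      ⟨_, hwS, w, hw, rfl, hgw⟩
    obtain ⟨c, rfl⟩ := (Projectivization.mk_eq_mk_iff' ℂ _ _ _ _).mp hwp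
    -- The two functions are nonzero at possibly different representatives of the same point; the
    -- line through the origin contains a common one.
    obtain ⟨a, ha, hfa, hga⟩ := exists_ne_zero_on_line hf hg 0 v' (a := 1) (b := c)
      (by simpa using hfv') (by simpa using hgw')
    rw [zero_add] at hfa hga
    exact ⟨a • v', smul_mem_cone ⟨hv', hpS⟩ ha, hfa, hga⟩

theorem cone_closure_subset (S : Set (Projectivization ℂ E)) :
    cone (closure S) ⊆ closure (cone S) := by
  rintro v ⟨hv, hvS⟩
  refine mem_closure_zar_iff.mpr fun f hf hfS => ?_
  by_contra hfv
  obtain ⟨_, ⟨w, hw, rfl, hfw⟩, hwS⟩ := mem_closure_iff.mp hvS _ (isOpen_nonvanishing hf)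
    ⟨v, hv, rfl, hfv⟩
  exact hfw (hfS w ⟨hw, hwS⟩)

theorem isLocallyClosed_cone {S : Set (Projectivization ℂ E)} (hS : IsLocallyClosed S) :
    IsLocallyClosed (cone S) := by
  obtain ⟨U, V, hU, hV, rfl⟩ := hS
  refine ⟨cone U, (cone Vᶜ)ᶜ, isOpen_iff_cone.mp hU,
    (isOpen_iff_cone.mp hV.isOpen_compl).isClosed_compl, ?_⟩
  ext v
  constructor
  · rintro ⟨h, h1, h2⟩
    exact ⟨⟨h, h1⟩, fun ⟨_, h3⟩ => h3 h2⟩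
  · rintro ⟨⟨h, h1⟩, h2⟩
    exact ⟨h, h1, by_contra fun h3 => h2 ⟨h, h3⟩⟩

/-- The representatives of points of `S` normalized by a linear form. -/
def slice (l : Module.Dual ℂ E) (S : Set (Projectivization ℂ E)) : Set E :=
  {v | v ∈ cone S ∧ l v = 1}

theorem inv_smul_mem_slice {S : Set (Projectivization ℂ E)} {l : Module.Dual ℂ E} {v : E}
    (hv : v ∈ cone S) (h : l v ≠ 0) : (l v)⁻¹ • v ∈ slice l S :=
  ⟨smul_mem_cone hv (inv_ne_zero h), by rw [map_smul, smul_eq_mul, inv_mul_cancel₀ h]⟩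

theorem isIrreducible_slice {S : Set (Projectivization ℂ E)} (hS : IsIrreducible S)
    {l : Module.Dual ℂ E} {v : E} (hv : v ∈ cone S) (h : l v ≠ 0) :
    IsIrreducible (slice l S) := by
  refine ⟨⟨_, inv_smul_mem_slice hv h⟩, ?_⟩
  have := isPreirreducible_normalization (isIrreducible_cone hS).isPreirreducible l
    (0 : E →ₗ[ℂ] E) LinearMap.id
  convert this using 1
  ext w
  constructor
  · rintro ⟨hw, hw1⟩
    exact ⟨w, hw, by rw [hw1]; exact one_ne_zero, by simp [hw1]⟩
  · rintro ⟨u, hu, hlu, rfl⟩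
    simpa using inv_smul_mem_slice hu hlu

theorem isLocallyClosed_slice {S : Set (Projectivization ℂ E)} (hS : IsLocallyClosed S)
    (l : Module.Dual ℂ E) : IsLocallyClosed (slice l S) := by
  have hcl : IsClosed {v : E | l v = 1} := by
    rw [← isOpen_compl_iff]
    have : {v : E | l v = 1}ᶜ = {v : E | l v - 1 ≠ 0} := by
      ext v
      exact sub_ne_zero.symm
    rw [this]
    exact isOpen_ne_zero (sub_mem (dual_mem_polynomialFunctions l) (const_mem_polynomialFunctions 1))
  exact (isLocallyClosed_cone hS).inter hcl.isLocallyClosed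

/-- The hyperplane `l = 1` is an affine chart. A polynomial condition on it extends to projective
space by homogenizing with `l`, and the extra factor `l w` keeps the open set inside the chart. -/
theorem isInducing_slice (S : Set (Projectivization ℂ E)) (l : Module.Dual ℂ E) {A : Set E}
    (hA : A ⊆ slice l S) : Topology.IsInducing (fun v : A =>
      (⟨Projectivization.mk ℂ v.1 (hA v.2).1.1, (hA v.2).1.2⟩ : S)) := by
  have hmk : Continuous (fun v : A => Projectivization.mk ℂ v.1 (hA v.2).1.1) := by
    refine continuous_def.mpr fun U hU => ?_
    exact isOpen_induced_iff.mpr ⟨_, isOpen_iff_cone.mp hU, by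
      ext v; exact ⟨fun h => h.2, fun h => ⟨(hA v.2).1.1, h⟩⟩⟩
  refine ⟨le_antisymm (continuous_iff_le_induced.mp (hmk.subtype_mk _)) ?_⟩
  intro O hO
  obtain ⟨O', hO', rfl⟩ := isOpen_induced_iff.mp hO
  rw [@isOpen_iff_forall_mem_open]
  intro v hv
  obtain ⟨f, hf, hfv, hfO⟩ := exists_ne_zero_of_isOpen hO' hv
  obtain ⟨N, F, hF, hNF⟩ := exists_homogenization l (0 : E →ₗ[ℂ] E) LinearMap.id hf
  have hnorm : ∀ w : E, l w ≠ 0 → F w = l w ^ N * f ((l w)⁻¹ • w) := fun w hw => by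
    rw [hNF w hw]; simp
  have hopen : IsOpen (nonvanishing fun w => l w * F w) :=
    isOpen_nonvanishing (mul_mem_polynomialFunctions (dual_mem_polynomialFunctions l) hF)
  refine ⟨_, ?_, isOpen_induced_iff.mpr ⟨_, isOpen_induced_iff.mpr ⟨_, hopen, rfl⟩, rfl⟩, ?_⟩
  · rintro w ⟨u, hu, huw, hFu⟩
    obtain ⟨c, hc⟩ := (Projectivization.mk_eq_mk_iff' ℂ _ _ _ _).mp huw
    have hlu : l u ≠ 0 := left_ne_zero_of_mul hFu
    have hc' : l u = c := by
      rw [← hc, map_smul, (hA w.2).2, smul_eq_mul, mul_one]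
    have h1 := right_ne_zero_of_mul hFu
    rw [hnorm u hlu] at h1
    have h2 := right_ne_zero_of_mul h1
    rw [hc', ← hc, smul_smul, inv_mul_cancel₀ (hc' ▸ hlu), one_smul] at h2
    exact hfO _ h2
  · have hlv := (hA v.2).2
    refine ⟨v.1, (hA v.2).1.1, rfl, ?_⟩
    change l v.1 * F v.1 ≠ 0
    rw [hnorm _ (by rw [hlv]; exact one_ne_zero), hlv]
    simpa using hfv

end Projective

end PlaneForms

end

open MvPolynomial
noncomputable section
namespace PlaneForms

attribute [local instance] zariskiTopology zariskiTopologyProd projectiveTopology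

/-! ### Krull dimension in projective space -/

section ProjectiveDimension

variable {E E' : Type} [AddCommGroup E] [Module ℂ E] [AddCommGroup E'] [Module ℂ E']

theorem zero_mem_closure_cone {S : Set (Projectivization ℂ E)} (hS : S.Nonempty) :
    (0 : E) ∈ closure (cone S) := by
  refine mem_closure_zar_iff.mpr fun f hf hfS => ?_
  by_contra h0
  obtain ⟨p, hp⟩ := hS
  have hp' : p.rep ∈ cone S := ⟨p.rep_nonzero, by rwa [Projectivization.mk_rep]⟩
  obtain ⟨c, hc, h1, -⟩ := exists_ne_zero_on_line hf hf 0 p.rep (a := 0) (b := 0) (by simpa using h0)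
    (by simpa using h0)
  rw [zero_add] at h1
  exact h1 (hfS _ (smul_mem_cone hp' hc))

/-- Cones over a chain in `Y` form a chain of irreducible sets, and the origin lies in all their
closures. Adding `{0}` at the bottom lengthens the chain by one. -/
theorem topologicalKrullDim_add_one_le [FiniteDimensional ℂ E] {Y : Set (Projectivization ℂ E)}
    (hY : IsIrreducible Y) : topologicalKrullDim Y + 1 ≤ (vdim (cone Y) : WithBot ℕ∞) := by
  have h0 := zero_mem_closure_cone hY.nonempty
  have hcl : closure (insert 0 (cone Y)) = closure (cone Y) := by
    refine subset_antisymm (closure_minimal ?_ isClosed_closure) (closure_mono (Set.subset_insert _ _))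
    exact Set.insert_subset h0 subset_closure
  have hirr : IsIrreducible (insert 0 (cone Y)) := by
    rw [← isIrreducible_iff_closure, hcl, isIrreducible_iff_closure]
    exact isIrreducible_cone hY
  rw [← vdim_eq_of_closure_eq hirr (isIrreducible_cone hY) hcl]
  have : Nonempty (TopologicalSpace.IrreducibleCloseds Y) := by
    obtain ⟨y, hy⟩ := hY.nonempty
    exact ⟨⟨closure {⟨y, hy⟩}, isIrreducible_singleton.closure, isClosed_closure⟩⟩
  have himg : ∀ Z : TopologicalSpace.IrreducibleCloseds Y,
      IsIrreducible (Subtype.val '' (Z : Set Y)) := fun Z =>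
    Z.isIrreducible.image _ continuous_subtype_val.continuousOn
  rw [topologicalKrullDim, ← Order.krullDim_withBot]
  refine krullDim_le_vdim hirr (fun a => match a with
    | ⊥ => {0}
    | (Z : TopologicalSpace.IrreducibleCloseds Y) => cone (Subtype.val '' (Z : Set Y))) ?_ ?_ ?_
  · intro a
    induction a using WithBot.recBotCoe with
    | bot => exact isIrreducible_singleton
    | coe Z => exact isIrreducible_cone (himg Z)
  · intro a
    induction a using WithBot.recBotCoe with
    | bot => exact Set.singleton_subset_iff.mpr (Set.mem_insert _ _)
    | coe Z =>
      refine (cone_mono ?_).trans (Set.subset_insert _ _)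
      rintro _ ⟨y, -, rfl⟩
      exact y.2
  · intro a b hab
    induction b using WithBot.recBotCoe with
    | bot => exact absurd hab not_lt_bot
    | coe Z =>
      induction a using WithBot.recBotCoe with
      | bot =>
        refine ⟨Set.singleton_subset_iff.mpr (zero_mem_closure_cone (himg Z).nonempty), fun h => ?_⟩
        obtain ⟨v, hv⟩ := (isIrreducible_cone (himg Z)).nonempty
        have hcl0 : IsClosed ({0} : Set E) := by
          rw [← isOpen_compl_iff]
          exact isOpen_ne E
        have := h hv
        rw [hcl0.closure_eq] at this
        exact hv.1 this
      | coe Z' =>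
        have hlt := WithBot.coe_lt_coe.mp hab
        refine ⟨(cone_mono (Set.image_mono hlt.le)).trans subset_closure, fun h => ?_⟩
        obtain ⟨y, hy, hy'⟩ := SetLike.exists_of_lt hlt
        obtain ⟨U, hU, hUZ⟩ := isOpen_induced_iff.mp Z'.isClosed.isOpen_compl
        have hyU : y.1 ∈ U := by
          have : y ∈ Subtype.val ⁻¹' U := by rw [hUZ]; exact hy'
          exact this
        have hyr : y.1.rep ∈ cone (Subtype.val '' (Z : Set Y)) :=
          ⟨y.1.rep_nonzero, y, hy, by rw [Projectivization.mk_rep]⟩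
        obtain ⟨v, ⟨hv, hvU⟩, _, y', hy'Z, hy'v⟩ := mem_closure_iff.mp (h hyr) _
          (isOpen_iff_cone.mp hU) ⟨y.1.rep_nonzero, by rwa [Projectivization.mk_rep]⟩
        have : y' ∈ (Z' : Set Y)ᶜ := by
          rw [← hUZ]
          change y'.1 ∈ U
          rwa [hy'v]
        exact this hy'Z

/-- Scaling maps `slice × ℂ` onto the part of the cone where `l ≠ 0`, together with the origin, so
it is dominant. -/
theorem vdim_cone_le [FiniteDimensional ℂ E] {S : Set (Projectivization ℂ E)} (hS : IsIrreducible S)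
    {l : Module.Dual ℂ E} {v : E} (hv : v ∈ cone S) (h : l v ≠ 0) :
    vdim (cone S) ≤ vdim (slice l S) + 1 := by
  have hsl := isIrreducible_slice hS hv h
  have h1 := vdim_prod_univ (F := ℂ) hsl
  rw [Module.finrank_self] at h1
  rw [← h1]
  have hirr : IsIrreducible (slice l S ×ˢ (Set.univ : Set ℂ)) := by
    have := isIrreducible_bundle (0 : E →ₗ[ℂ] ℂ →ₗ[ℂ] ℂ) hsl (r := 1) (fun D _ => by
      rw [LinearMap.zero_apply, LinearMap.ker_zero, finrank_top, Module.finrank_self])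
    convert this using 1
    ext w
    simp
  have hφ : IsPolyMap (fun w : E × ℂ => w.2 • w.1) :=
    IsPolyMap.smul (dual_mem_polynomialFunctions (LinearMap.snd ℂ E ℂ)) isPolyMap_fst
  refine vdim_le_of_dominant hirr hφ (subset_antisymm ?_ ?_)
  · refine closure_minimal (fun w hw => ?_) isClosed_closure
    refine mem_closure_zar_iff.mpr fun f hf hfS => ?_
    by_contra hfw
    obtain ⟨u, hu, hfu, hlu⟩ := isPreirreducible_zar_iff.mp (isIrreducible_cone hS).isPreirreducible
      f hf l (dual_mem_polynomialFunctions l) ⟨w, hw, hfw⟩ ⟨v, hv, h⟩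
    refine hfu (hfS _ ⟨((l u)⁻¹ • u, l u), ⟨inv_smul_mem_slice hu hlu, trivial⟩, ?_⟩)
    simp [hlu]
  · refine closure_minimal ?_ isClosed_closure
    rintro _ ⟨⟨w, c⟩, ⟨hw, -⟩, rfl⟩
    by_cases hc : c = 0
    · subst hc
      simpa using zero_mem_closure_cone hS.nonempty
    · exact subset_closure (smul_mem_cone hw.1 hc)

/-- The dimension of a subset of projective space between a constructible set and its closure. -/
theorem topologicalKrullDim_eq_vdim [FiniteDimensional ℂ E] [FiniteDimensional ℂ E']
    {S Y : Set (Projectivization ℂ E)} (hS : IsIrreducible S) (hSY : S ⊆ Y) (hYS : Y ⊆ closure S)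
    {l : Module.Dual ℂ E} {X : Set E'} (hX : IsIrreducible X) (hX' : IsLocallyClosed X)
    {φ : E' → E} (hφ : IsPolyMap φ) (hφX : φ '' X = slice l S) :
    topologicalKrullDim Y = (vdim (slice l S) : WithBot ℕ∞) ∧
      vdim (cone S) = vdim (slice l S) + 1 := by
  have hcl : closure Y = closure S :=
    subset_antisymm (closure_minimal hYS isClosed_closure) (closure_mono hSY)
  have hY : IsIrreducible Y := by
    rwa [← isIrreducible_iff_closure, hcl, isIrreducible_iff_closure]
  obtain ⟨x, hx⟩ := hX.nonempty
  have hx' : φ x ∈ slice l S := hφX ▸ ⟨x, hx, rfl⟩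
  have h1 := vdim_cone_le hS hx'.1 (by rw [hx'.2]; exact one_ne_zero)
  have h2 := topologicalKrullDim_add_one_le hY
  have h3 : vdim (cone Y) = vdim (cone S) := by
    refine vdim_eq_of_closure_eq (isIrreducible_cone hY) (isIrreducible_cone hS)
      (subset_antisymm ?_ ?_)
    · exact closure_minimal ((cone_mono hYS).trans (cone_closure_subset S)) isClosed_closure
    · exact closure_mono (cone_mono hSY)
  -- The squeeze: `vdim` of the slice ≤ Krull dimension of the slice ≤ that of `Y` ≤ `vdim` of the
  -- cone minus 1 ≤ `vdim` of the slice. Only the first inequality needs the slice to be an image of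
  -- a locally closed set.
  have h4 := vdim_le_topologicalKrullDim hX hX' hφ
  rw [hφX] at h4
  have h5 : topologicalKrullDim (slice l S) ≤ topologicalKrullDim Y :=
    (isInducing_slice Y l (A := slice l S)
      fun v hv => ⟨cone_mono hSY hv.1, hv.2⟩).topologicalKrullDim_le
  rw [h3] at h2
  have h6 : (vdim (slice l S) : WithBot ℕ∞) ≤ topologicalKrullDim Y := h4.trans h5
  have h7 : ((vdim (slice l S) + 1 : ℕ) : WithBot ℕ∞) ≤ (vdim (cone S) : WithBot ℕ∞) := by
    rw [Nat.cast_add, Nat.cast_one]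
    exact (add_le_add_left h6 1).trans h2
  have h8 : vdim (cone S) = vdim (slice l S) + 1 := le_antisymm h1 (by exact_mod_cast h7)
  refine ⟨le_antisymm ?_ h6, h8⟩
  rw [h8, Nat.cast_add, Nat.cast_one] at h2
  generalize topologicalKrullDim Y = a at h2 ⊢
  induction a using WithBot.recBotCoe with
  | bot => exact bot_le
  | coe a =>
    have h9 : a + 1 ≤ (vdim (slice l S) : ℕ∞) + 1 := by exact_mod_cast h2
    have h10 : a ≤ (vdim (slice l S) : ℕ∞) := (ENat.add_le_add_iff_right ENat.one_ne_top).mp h9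
    exact_mod_cast h10

end ProjectiveDimension

end PlaneForms

end

open MvPolynomial
noncomputable section
namespace PlaneForms

/-! ### Components determined by an open subset -/

section Components

variable {T : Type*} [TopologicalSpace T]

theorem subset_closure_inter_of_isOpen {S O : Set T} (hS : IsPreirreducible S) (hO : IsOpen O)
    (hSO : (S ∩ O).Nonempty) : S ⊆ closure (S ∩ O) := by
  intro x hx
  refine mem_closure_iff.mpr fun V hV hxV => ?_
  obtain ⟨y, hy, hyV, hyO⟩ := hS V O hV hO ⟨x, hx, hxV⟩ hSO
  exact ⟨y, hyV, hy, hyO⟩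

theorem isIrreducible_of_subset_closure {S Y : Set T} (hS : IsIrreducible S) (h1 : S ⊆ Y)
    (h2 : Y ⊆ closure S) : IsIrreducible Y := by
  have : closure Y = closure S :=
    subset_antisymm (closure_minimal h2 isClosed_closure) (closure_mono h1)
  rw [← isIrreducible_iff_closure, this]
  exact hS.closure

theorem isIrreducible_inter_isOpen {S O : Set T} (hS : IsIrreducible S) (hO : IsOpen O)
    (hSO : (S ∩ O).Nonempty) : IsIrreducible (S ∩ O) :=
  ⟨hSO, fun U V hU hV hSU hSV => by
    obtain ⟨x, hx, ⟨hxO, hxU⟩, -, hxV⟩ := hS.isPreirreducible _ _ (hO.inter hU) (hO.inter hV)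
      (by rwa [← Set.inter_assoc]) (by rwa [← Set.inter_assoc])
    exact ⟨x, ⟨hx, hxO⟩, hxU, hxV⟩⟩

/-- An irreducible subset of `F` that meets `O` has a dense part in `F ∩ O`, so nothing irreducible
in `F` can be larger than this closure. -/
theorem isComponentOf_closure_inter {F O : Set T} (hO : IsOpen O) (hFO : IsIrreducible (F ∩ O)) :
    IsComponentOf (closure (F ∩ O) ∩ F) F := by
  have h1 : F ∩ O ⊆ closure (F ∩ O) ∩ F := fun x hx => ⟨subset_closure hx, hx.1⟩
  refine ⟨⟨isIrreducible_of_subset_closure hFO h1 Set.inter_subset_left, Set.inter_subset_right⟩, ?_⟩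
  rintro S ⟨hS, hSF⟩ hle x hx
  obtain ⟨y, hy⟩ := hFO.nonempty
  refine ⟨?_, hSF hx⟩
  exact closure_mono (Set.inter_subset_inter_left O hSF)
    (subset_closure_inter_of_isOpen hS.isPreirreducible hO ⟨y, hle (h1 hy), hy.2⟩ hx)

theorem IsComponentOf.eq_closure_inter {F O Z : Set T} (hO : IsOpen O)
    (hFO : IsIrreducible (F ∩ O)) (hZ : IsComponentOf Z F) (hZO : (Z ∩ O).Nonempty) :
    Z = closure (F ∩ O) ∩ F := by
  have h1 : Z ⊆ closure (F ∩ O) ∩ F := fun x hx => ⟨closure_mono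
    (Set.inter_subset_inter_left O hZ.1.2)
    (subset_closure_inter_of_isOpen hZ.1.1.isPreirreducible hO hZO hx), hZ.1.2 hx⟩
  exact subset_antisymm h1 (hZ.2 (isComponentOf_closure_inter hO hFO).1 h1)

end Components

/-- The Zariski topology on a subspace, viewed as a vector space. -/
abbrev zariskiTopologySubmodule {E : Type} [AddCommGroup E] [Module ℂ E] (S : Submodule ℂ E) :
    TopologicalSpace S := zariskiTopology S

attribute [local instance] zariskiTopology zariskiTopologyProd projectiveTopology
  zariskiTopologySubmodule

/-! ### Semicontinuity and irreducibility of the incidence variety -/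

section Curves

variable {e d : ℕ}

/-- The curve with a given equation. -/
def Curve.mk (v : Hom e) (hv : v ≠ 0) : Curve e := Projectivization.mk ℂ v hv

/-- The equation of a curve as a homogeneous polynomial. -/
def Curve.vec (D : Curve e) : Hom e := Projectivization.rep D

/-- The class of a form up to scaling. -/
def Form.mk (w : Hom d × Hom d) (hw : w ≠ 0) : Form d := Projectivization.mk ℂ w hw

theorem Curve.vec_ne_zero (D : Curve e) : D.vec ≠ 0 := Projectivization.rep_nonzero D

theorem Form.coeffs_ne_zero (η : Form d) : η.coeffs ≠ 0 := Projectivization.rep_nonzero η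

theorem Curve.mk_vec (D : Curve e) : Curve.mk D.vec D.vec_ne_zero = D := Projectivization.mk_rep D

theorem Curve.vec_mem_cone {D : Curve e} {S : Set (Curve e)} (hD : D ∈ S) : D.vec ∈ cone S :=
  ⟨D.vec_ne_zero, (congrArg (· ∈ S) D.mk_vec).mpr hD⟩

theorem Form.mk_coeffs (η : Form d) : Form.mk η.coeffs η.coeffs_ne_zero = η :=
  Projectivization.mk_rep η

theorem integralForms_smul {c : ℂ} (hc : c ≠ 0) (C : MvPolynomial (Fin 3) ℂ) (d : ℕ) :
    integralForms (c • C) d = integralForms C d := by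
  ext ω
  refine exists_congr fun K => ?_
  rw [Derivation.map_smul, Derivation.map_smul, smul_mul_assoc, smul_mul_assoc, smul_mul_assoc,
    ← smul_sub]
  exact (smul_right_injective _ hc).eq_iff

theorem integralForms_mk (v : Hom e) (hv : v ≠ 0) (d : ℕ) :
    integralForms (Curve.mk v hv).eqn d = integralForms v.1 d := by
  obtain ⟨a, ha⟩ := Projectivization.exists_smul_eq_mk_rep ℂ v hv
  have : (Curve.mk v hv).eqn = a.1 • v.1 := congrArg Subtype.val ha.symm
  rw [this]
  exact integralForms_smul a.ne_zero v.1 d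

theorem coeffs_mk_mem_iff (S : Submodule ℂ (Hom d × Hom d)) (w : Hom d × Hom d) (hw : w ≠ 0) :
    (Form.mk w hw).coeffs ∈ S ↔ w ∈ S := by
  obtain ⟨a, ha⟩ := Projectivization.exists_smul_eq_mk_rep ℂ w hw
  have : (Form.mk w hw).coeffs = a.1 • w := ha.symm
  rw [this]
  exact S.smul_mem_iff a.ne_zero

theorem isIntegralCurve_mk (v : Hom e) (hv : v ≠ 0) (w : Hom d × Hom d) (hw : w ≠ 0) :
    IsIntegralCurve (Curve.mk v hv) (Form.mk w hw) ↔ w ∈ integralForms v.1 d := by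
  rw [← integralForms_mk v hv]
  exact coeffs_mk_mem_iff _ w hw

theorem finrank_ker_darboux (v : Hom e) (hv : v ≠ 0) (d : ℕ) :
    Module.finrank ℂ (LinearMap.ker (darboux e d v)) =
      Module.finrank ℂ (integralForms (Curve.mk v hv).eqn d) := by
  rw [integralForms_mk, (kerDarbouxEquiv d hv).finrank_eq]

theorem isOpen_finrank_le (e d r : ℕ) :
    IsOpen {D : Curve e | Module.finrank ℂ (integralForms D.eqn d) ≤ r} := by
  refine isOpen_iff_forall_mem_open.mpr fun C hC => ?_
  obtain ⟨h, hh, hhC, hle⟩ := exists_finrank_ker_le (darboux e d) C.vec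
  refine ⟨nonvanishing h, ?_, isOpen_nonvanishing hh, _, C.vec_ne_zero, C.mk_vec, hhC⟩
  rintro _ ⟨v, hv, rfl, hhv⟩
  have := hle v hhv
  rw [finrank_ker_darboux v hv, finrank_ker_darboux _ C.vec_ne_zero, Curve.mk_vec] at this
  exact this.trans hC

theorem continuous_fst_curveForm : Continuous (fun p : CurveForm e d => (p.1 : Curve e)) := by
  refine continuous_def.mpr fun U hU => ?_
  refine isOpen_coinduced.mpr (isOpen_induced_iff.mpr ⟨Prod.fst ⁻¹' cone U, ?_, ?_⟩)
  · exact (isOpen_iff_cone.mp hU).preimage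
      (isPolyMap_fst (E := Hom e) (F := Hom d × Hom d)).continuous
  · ext v
    exact ⟨fun h => h.2, fun h => ⟨v.2.1, h⟩⟩

theorem continuous_snd_curveForm : Continuous (fun p : CurveForm e d => (p.2 : Form d)) := by
  refine continuous_def.mpr fun U hU => ?_
  refine isOpen_coinduced.mpr (isOpen_induced_iff.mpr ⟨Prod.snd ⁻¹' cone U, ?_, ?_⟩)
  · exact (isOpen_iff_cone.mp hU).preimage
      (isPolyMap_snd (E := Hom e) (F := Hom d × Hom d)).continuous
  · ext v
    exact ⟨fun h => h.2, fun h => ⟨v.2.2, h⟩⟩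

theorem exists_isOpen_bicone {O : Set (CurveForm e d)} (hO : IsOpen O) :
    ∃ O' : Set (Hom e × (Hom d × Hom d)), IsOpen O' ∧ ∀ v (hv : v ≠ 0) w (hw : w ≠ 0),
      (v, w) ∈ O' ↔ ((Curve.mk v hv, Form.mk w hw) : CurveForm e d) ∈ O := by
  obtain ⟨O', hO', h⟩ := isOpen_induced_iff.mp (isOpen_coinduced.mp hO)
  refine ⟨O', hO', fun v hv w hw => ?_⟩
  have := Set.ext_iff.mp h ⟨(v, w), hv, hw⟩
  exact this

/-- This is the image of the bundle of triples (equation, form, cofactor), restricted to nonzero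
forms. The rank must be nonzero for such forms to exist. -/
theorem isIrreducible_incidence {S : Set (Curve e)} (hS : IsIrreducible S) {r : ℕ}
    (hr : ∀ D ∈ S, Module.finrank ℂ (integralForms D.eqn d) = r) (hr0 : r ≠ 0) :
    IsIrreducible (incidence d S) := by
  have hcone : IsIrreducible (cone S) := isIrreducible_cone hS
  have hbundle := isIrreducible_bundle (darboux e d) hcone (r := r) (fun v hv => by
    rw [finrank_ker_darboux v hv.1]
    exact hr _ hv.2)
  refine ⟨?_, ?_⟩
  · obtain ⟨D, hD⟩ := hS.nonempty
    obtain ⟨η, hη, hη0⟩ : ∃ η ∈ integralForms D.eqn d, η ≠ 0 := by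
      refine (Submodule.ne_bot_iff _).mp fun h => hr0 ?_
      rw [← hr D hD, h, finrank_bot]
    exact ⟨((D, Form.mk η hη0) : CurveForm e d), hD, (coeffs_mk_mem_iff _ η hη0).mpr hη⟩
  · rintro O₁ O₂ hO₁ hO₂ ⟨⟨D₁, η₁⟩, ⟨hD₁, hη₁⟩, h₁⟩ ⟨⟨D₂, η₂⟩, ⟨hD₂, hη₂⟩, h₂⟩
    obtain ⟨O₁', hO₁', h₁'⟩ := exists_isOpen_bicone hO₁
    obtain ⟨O₂', hO₂', h₂'⟩ := exists_isOpen_bicone hO₂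
    have hnz : IsOpen {v : Hom d × Hom d | v ≠ 0} := isOpen_ne _
    have hψ : IsPolyMap (fun x : Hom e × ((Hom d × Hom d) × gr (d - 1)) => (x.1, x.2.1)) :=
      isPolyMap_fst.prodMk (isPolyMap_fst.comp isPolyMap_snd)
    have hψ' : IsPolyMap (fun x : Hom e × ((Hom d × Hom d) × gr (d - 1)) => x.2.1) :=
      isPolyMap_fst.comp isPolyMap_snd
    have key : ∀ (D : Curve e) (η : Form d), D ∈ S → IsIntegralCurve D η →
        ∃ x : Hom e × ((Hom d × Hom d) × gr (d - 1)), (x.1 ∈ cone S ∧ darboux e d x.1 x.2 = 0) ∧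
          x.2.1 ≠ 0 ∧ x.1 = D.vec ∧ x.2.1 = η.coeffs := by
      intro D η hD hη
      obtain ⟨K, hK⟩ := mem_ker_darboux_of_mem D.vec_ne_zero hη
      exact ⟨(D.vec, (η.coeffs, K)), ⟨D.vec_mem_cone hD, hK⟩,
        η.coeffs_ne_zero, rfl, rfl⟩
    obtain ⟨x₁, hx₁, hx₁0, hx₁D, hx₁η⟩ := key D₁ η₁ hD₁ hη₁
    obtain ⟨x₂, hx₂, hx₂0, hx₂D, hx₂η⟩ := key D₂ η₂ hD₂ hη₂
    obtain ⟨x, hx, ⟨hx1, hx0⟩, hx2, -⟩ := hbundle.isPreirreducible _ _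
      ((hO₁'.preimage hψ.continuous).inter (hnz.preimage hψ'.continuous))
      ((hO₂'.preimage hψ.continuous).inter (hnz.preimage hψ'.continuous))
      ⟨x₁, hx₁, by
        change (x₁.1, x₁.2.1) ∈ O₁'
        rw [hx₁D, hx₁η, h₁' _ D₁.vec_ne_zero _ η₁.coeffs_ne_zero, Curve.mk_vec, Form.mk_coeffs]
        exact h₁, hx₁0⟩
      ⟨x₂, hx₂, by
        change (x₂.1, x₂.2.1) ∈ O₂'
        rw [hx₂D, hx₂η, h₂' _ D₂.vec_ne_zero _ η₂.coeffs_ne_zero, Curve.mk_vec, Form.mk_coeffs]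
        exact h₂, hx₂0⟩
    refine ⟨((Curve.mk x.1 hx.1.1, Form.mk x.2.1 hx0) : CurveForm e d), ⟨hx.1.2, ?_⟩,
        (h₁' _ _ _ _).mp hx1, (h₂' _ _ _ _).mp hx2⟩
    exact (isIntegralCurve_mk _ _ _ _).mpr (mem_integralForms_of_darboux hx.2)

end Curves

end PlaneForms

end

open MvPolynomial
noncomputable section
namespace PlaneForms

attribute [local instance] zariskiTopology zariskiTopologyProd projectiveTopology
  zariskiTopologySubmodule

/-! ### The lower bound on the whole family -/

section Family

variable {e d t : ℕ}

/-- The expected dimension is a lower bound on the whole family. -/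
theorem expectedDim_le_of_mem {B : Set (Curve e)} (hB : IsEquisingularFamily B t) {C : Curve e}
    (hCB : C ∈ B) (hdeg : SingSchemeFiniteOfDegree C.eqn t)
    (hdim : (Module.finrank ℂ (integralForms C.eqn d) : ℤ) = expectedDim d e t)
    {D : Curve e} (hD : D ∈ B) :
    expectedDim d e t ≤ Module.finrank ℂ (integralForms D.eqn d) := by
  -- In degree 0 every form is integral for every curve, so the equality assumed at `C` transfers.
  rcases Nat.eq_zero_or_pos e with rfl | he
  · have h1 : integralForms D.eqn d = ⊤ := integralForms_eq_top D.vec d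
    have h2 : integralForms C.eqn d = ⊤ := integralForms_eq_top C.vec d
    rw [← hdim, h1, h2]
  obtain ⟨W, hW, hBW, hWt⟩ := hB.exists_open
  obtain ⟨W', hW', hBW', hle⟩ : ∃ W' : Set (Curve e), IsOpen W' ∧ (B ∩ W').Nonempty ∧
      ∀ D ∈ B ∩ W', expectedDim d e t ≤ Module.finrank ℂ (integralForms D.eqn d) := by
    by_cases hed : e ≤ d + 2
    · exact ⟨W, hW, hBW, fun D hD =>
        expectedDim_le_finrank he D.vec_ne_zero (hWt D hD) (Or.inl hed)⟩
    -- For `e ≥ d + 3` the equality at `C` excludes nonzero constant forms for `C`. This is an open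
    -- condition, so by irreducibility it can be imposed together with the condition that defines
    -- `W`.
    · have h0 : integralForms C.eqn 0 = ⊥ := by
        by_contra h0
        exact (finrank_lt_expectedDim C.vec_ne_zero hdeg (by omega) h0).ne hdim
      have hC0 : Module.finrank ℂ (integralForms C.eqn 0) ≤ 0 := by rw [h0, finrank_bot]
      refine ⟨W ∩ {D | Module.finrank ℂ (integralForms D.eqn 0) ≤ 0},
        hW.inter (isOpen_finrank_le e 0 0), ?_, fun D hD => ?_⟩
      · exact hB.isIrreducible.isPreirreducible _ _ hW (isOpen_finrank_le e 0 0) hBW ⟨C, hCB, hC0⟩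
      · refine expectedDim_le_finrank he D.vec_ne_zero (hWt D ⟨hD.1, hD.2.1⟩) (Or.inr ?_)
        exact Submodule.finrank_eq_zero.mp (Nat.le_zero.mp hD.2.2)
  -- A violating `D` would have an open neighbourhood on which the dimension stays below `δ`, and
  -- this neighbourhood meets `W'` inside `B`.
  by_contra hlt
  obtain ⟨D', hD', hD'1, hD'2⟩ := hB.isIrreducible.isPreirreducible _ _
    (isOpen_finrank_le e d (Module.finrank ℂ (integralForms D.eqn d))) hW' ⟨D, hD, Nat.le_refl (Module.finrank ℂ (integralForms D.eqn d))⟩ hBW'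
  have h1 := hle D' ⟨hD', hD'2⟩
  have h2 : Module.finrank ℂ (integralForms D'.eqn d) ≤
    Module.finrank ℂ (integralForms D.eqn d) := hD'1
  omega

end Family

/-! ### Dimension of the total space of forms and cofactors -/

section Dimension

variable {e d : ℕ} {S : Set (Curve e)} {l : Module.Dual ℂ (Hom e)} {r : ℕ}

theorem exists_mem_apply_eq {V Q : Type*} [AddCommGroup V] [Module ℂ V] [FiniteDimensional ℂ V]
    [AddCommGroup Q] [Module ℂ Q] [FiniteDimensional ℂ Q] {K : Submodule ℂ V} (q : V →ₗ[ℂ] Q)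
    (hK : Module.finrank ℂ K = Module.finrank ℂ Q) (hq : ∀ w ∈ K, q w = 0 → w = 0) (u : Q) :
    ∃ w ∈ K, q w = u := by
  have hinj : Function.Injective (q.domRestrict K) :=
    (injective_iff_map_eq_zero _).mpr fun w hw => Subtype.ext (hq w.1 w.2 hw)
  obtain ⟨w, hw⟩ := (LinearMap.injective_iff_surjective_of_finrank_eq_finrank hK).mp hinj u
  exact ⟨w.1, w.2, hw⟩

/-- The normalized equations of the curves of a family with their forms and cofactors. -/
def totalSpace (d : ℕ) (S : Set (Curve e)) (l : Module.Dual ℂ (Hom e)) :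
    Set (Hom e × ((Hom d × Hom d) × gr (d - 1))) :=
  {x | x.1 ∈ slice l S ∧ darboux e d x.1 x.2 = 0}

theorem isLocallyClosed_totalSpace (hS : IsLocallyClosed S) :
    IsLocallyClosed (totalSpace d S l) :=
  ((isLocallyClosed_slice hS l).preimage isPolyMap_fst.continuous).inter
    (isClosed_bundle (darboux e d)).isLocallyClosed

theorem isIrreducible_totalSpace (hS : IsIrreducible S)
    (hr : ∀ D ∈ S, Module.finrank ℂ (integralForms D.eqn d) = r) {v : Hom e} (hv : v ∈ cone S)
    (hlv : l v ≠ 0) : IsIrreducible (totalSpace d S l) :=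
  isIrreducible_bundle (darboux e d) (isIrreducible_slice hS hv hlv) (r := r) fun v hv => by
    rw [finrank_ker_darboux v hv.1.1]
    exact hr _ hv.1.2

/-- No trivialization of the bundle is needed: `q` maps every fibre isomorphically onto the fixed
space `Q`, so `(v, w) ↦ (v, q w)` is a bijective polynomial map onto `slice × Q`, and bijectivity
already forces equal dimensions. -/
theorem vdim_totalSpace (hS : IsIrreducible S) (hS' : IsLocallyClosed S)
    (hr : ∀ D ∈ S, Module.finrank ℂ (integralForms D.eqn d) = r) {v : Hom e} (hv : v ∈ cone S)
    (hlv : l v ≠ 0) {Q : Type} [AddCommGroup Q] [Module ℂ Q] [FiniteDimensional ℂ Q]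
    (hQ : Module.finrank ℂ Q = r) (q : (Hom d × Hom d) × gr (d - 1) →ₗ[ℂ] Q)
    (hq : ∀ v ∈ slice l S, ∀ w, darboux e d v w = 0 → q w = 0 → w = 0) :
    vdim (totalSpace d S l) = vdim (slice l S) + r := by
  have hX := isIrreducible_totalSpace (d := d) hS hr hv hlv
  have hX' := isLocallyClosed_totalSpace (d := d) (l := l) hS'
  let φ : Hom e × ((Hom d × Hom d) × gr (d - 1)) → Hom e × Q := fun x => (x.1, q x.2)
  have hφ : IsPolyMap φ := isPolyMap_fst.prodMk ((isPolyMap_linear q).comp isPolyMap_snd)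
  have himage : φ '' totalSpace d S l = slice l S ×ˢ (Set.univ : Set Q) := by
    ext ⟨v, u⟩
    constructor
    · rintro ⟨x, hx, hxv⟩
      rw [← hxv]
      exact ⟨hx.1, trivial⟩
    · rintro ⟨hv, -⟩
      have hdim : Module.finrank ℂ (LinearMap.ker (darboux e d v)) = Module.finrank ℂ Q := by
        rw [hQ, finrank_ker_darboux v hv.1.1]
        exact hr _ hv.1.2
      obtain ⟨w, hw, hwu⟩ := exists_mem_apply_eq q hdim (hq v hv) u
      exact ⟨(v, w), ⟨hv, hw⟩, Prod.ext rfl hwu⟩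
  have hprod := vdim_prod_univ (F := Q) (isIrreducible_slice hS hv hlv)
  rw [hQ] at hprod
  rw [← hprod, ← himage]
  refine le_antisymm ?_ (vdim_le_of_dominant hX hφ rfl)
  obtain ⟨x, hx⟩ := hX.nonempty
  refine vdim_le_of_finite_fibre hX hX' hφ hx ((Set.finite_singleton x).subset ?_)
  rintro y ⟨hy, hyx⟩
  obtain ⟨h1, h2⟩ : y.1 = x.1 ∧ q y.2 = q x.2 := Prod.ext_iff.mp hyx
  have h3 : darboux e d x.1 y.2 = 0 := h1 ▸ hy.2
  have h4 : y.2 - x.2 = 0 := hq x.1 hx.1 _ (by rw [map_sub, h3, hx.2, sub_zero])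
    (by rw [map_sub, h2, sub_self])
  exact Prod.ext h1 (sub_eq_zero.mp h4)

/-- The total space contains the zero form over every curve, whereas cones exclude the origin; hence
the extra point. -/
theorem image_totalSpace (hl : ∀ v ∈ cone S, l v ≠ 0) (hSne : S.Nonempty) :
    (fun x : Hom e × ((Hom d × Hom d) × gr (d - 1)) => x.2.1) '' totalSpace d S l =
      insert 0 (cone (formsOf d S)) := by
  ext η
  constructor
  · rintro ⟨x, hx, rfl⟩
    by_cases h0 : x.2.1 = 0
    · exact Set.mem_insert_iff.mpr (Or.inl h0)
    · exact Or.inr ⟨h0, Curve.mk x.1 hx.1.1.1, hx.1.1.2,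
        (isIntegralCurve_mk x.1 hx.1.1.1 x.2.1 h0).mpr (mem_integralForms_of_darboux hx.2)⟩
  · have key : ∀ D ∈ S, ∀ η ∈ integralForms D.eqn d, ∃ x ∈ totalSpace d S l, x.2.1 = η := by
      intro D hD η hη
      obtain ⟨K, hK⟩ := mem_ker_darboux_of_mem D.vec_ne_zero hη
      refine ⟨((l D.vec)⁻¹ • D.vec, (η, K)), ⟨inv_smul_mem_slice (D.vec_mem_cone hD)
        (hl _ (D.vec_mem_cone hD)), ?_⟩, rfl⟩
      rw [map_smul, LinearMap.smul_apply]
      exact smul_eq_zero_of_right _ hK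
    rintro (rfl | ⟨h0, D, hD, hDη⟩)
    · obtain ⟨D, hD⟩ := hSne
      obtain ⟨x, hx, hx0⟩ := key D hD 0 (zero_mem _)
      exact ⟨x, hx, hx0⟩
    · obtain ⟨x, hx, hxη⟩ := key D hD η ((coeffs_mk_mem_iff _ η h0).mp hDη)
      exact ⟨x, hx, hxη⟩

end Dimension

end PlaneForms

end

open MvPolynomial
noncomputable section
namespace PlaneForms

attribute [local instance] zariskiTopology zariskiTopologyProd projectiveTopology
  zariskiTopologySubmodule

/-! ### Dimension of the set of forms -/

section FormsDimension

variable {e d : ℕ} {S : Set (Curve e)} {l : Module.Dual ℂ (Hom e)} {r : ℕ}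

theorem image_snd_incidence (S : Set (Curve e)) :
    (fun p : CurveForm e d => (p.2 : Form d)) '' incidence d S = formsOf d S := by
  ext η
  constructor
  · rintro ⟨p, ⟨h1, h2⟩, rfl⟩
    exact ⟨p.1, h1, h2⟩
  · rintro ⟨D, hD, hη⟩
    exact ⟨((D, η) : CurveForm e d), ⟨hD, hη⟩, rfl⟩

theorem hasDim_of_slice (hS : IsIrreducible S) (hS' : IsLocallyClosed S) {v : Hom e}
    (hv : v ∈ cone S) (hlv : l v ≠ 0) {Y : Set (Curve e)} (hSY : S ⊆ Y) (hYS : Y ⊆ closure S) :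
    HasDim Y (vdim (slice l S)) :=
  (topologicalKrullDim_eq_vdim (E := Hom e) hS hSY hYS (isIrreducible_slice hS hv hlv)
    (isLocallyClosed_slice hS' l) isPolyMap_id (Set.image_id' _)).1

/-- The normalization `l = 1` fixes the scalar of the equation, and a nonzero equation together with
the form fixes the cofactor. Fibres over a form therefore inject into its integral curves. -/
theorem eq_of_mem_totalSpace {x y : Hom e × ((Hom d × Hom d) × gr (d - 1))}
    (hx : x ∈ totalSpace d S l) (hy : y ∈ totalSpace d S l)
    (hxy : Curve.mk x.1 hx.1.1.1 = Curve.mk y.1 hy.1.1.1) (h : x.2.1 = y.2.1) : x = y := by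
  obtain ⟨c, hc⟩ := (Projectivization.mk_eq_mk_iff' ℂ _ _ _ _).mp hxy
  have hc1 : c = 1 := by
    have := congrArg l hc
    rwa [map_smul, hx.1.2, hy.1.2, smul_eq_mul, mul_one] at this
  have h1 : x.1 = y.1 := by rw [← hc, hc1, one_smul]
  have h2 : x.2.2 - y.2.2 = 0 := by
    refine snd_eq_zero_of_darboux (d := d) hx.1.1.1 ?_
    have h3 : ((0, x.2.2 - y.2.2) : (Hom d × Hom d) × gr (d - 1)) = x.2 - y.2 :=
      Prod.ext (by rw [Prod.fst_sub, h, sub_self]) rfl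
    have h4 : darboux e d x.1 y.2 = 0 := h1 ▸ hy.2
    rw [h3, map_sub, hx.2, h4, sub_zero]
  exact Prod.ext h1 (Prod.ext h (sub_eq_zero.mp h2))

/-- A family of curves whose spaces of forms have constant dimension `r`, and some form which has
only finitely many integral curves in it: the forms make up a set of the expected dimension. -/
theorem hasDim_formsOf (hS : IsIrreducible S) (hS' : IsLocallyClosed S)
    (hl : ∀ v ∈ cone S, l v ≠ 0)
    (hr : ∀ D ∈ S, Module.finrank ℂ (integralForms D.eqn d) = r)
    {Q : Type} [AddCommGroup Q] [Module ℂ Q] [FiniteDimensional ℂ Q]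
    (hQ : Module.finrank ℂ Q = r) (q : (Hom d × Hom d) × gr (d - 1) →ₗ[ℂ] Q)
    (hq : ∀ v ∈ slice l S, ∀ w, darboux e d v w = 0 → q w = 0 → w = 0)
    (hirr : IsIrreducible (formsOf d S)) {ω : Form d} (hω : ω ∈ formsOf d S)
    (hfin : {D | D ∈ S ∧ IsIntegralCurve D ω}.Finite)
    {Y : Set (Form d)} (hSY : formsOf d S ⊆ Y) (hYS : Y ⊆ closure (formsOf d S)) :
    HasDim Y (vdim (slice l S) + r - 1) := by
  obtain ⟨C, hC, hCω⟩ := hω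
  have hv := C.vec_mem_cone hC
  have hlv := hl _ hv
  have hX := isIrreducible_totalSpace (d := d) hS hr hv hlv
  have hX' := isLocallyClosed_totalSpace (d := d) (l := l) hS'
  have hXdim := vdim_totalSpace hS hS' hr hv hlv hQ q hq
  let φ : Hom e × ((Hom d × Hom d) × gr (d - 1)) → Hom d × Hom d := fun x => x.2.1
  have hφ : IsPolyMap φ := isPolyMap_fst.comp isPolyMap_snd
  have himage : φ '' totalSpace d S l = insert 0 (cone (formsOf d S)) := image_totalSpace hl ⟨C, hC⟩
  have hω' : ω.coeffs ∈ cone (formsOf d S) :=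
    ⟨ω.coeffs_ne_zero, (congrArg (· ∈ formsOf d S) ω.mk_coeffs).mpr ⟨C, hC, hCω⟩⟩
  obtain ⟨x, hx, hxω⟩ : ω.coeffs ∈ φ '' totalSpace d S l := himage ▸ Or.inr hω'
  have hconeirr : IsIrreducible (cone (formsOf d S)) := isIrreducible_cone hirr
  have hcone : vdim (cone (formsOf d S)) = vdim (slice l S) + r := by
    have h0 : (0 : Hom d × Hom d) ∈ closure (cone (formsOf d S)) :=
      zero_mem_closure_cone hirr.nonempty
    have h1 : vdim (cone (formsOf d S)) = vdim (φ '' totalSpace d S l) := by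
      refine vdim_eq_of_closure_eq hconeirr (hX.image φ hφ.continuous.continuousOn) ?_
      rw [himage]
      exact subset_antisymm (closure_mono (Set.subset_insert _ _))
        (closure_minimal (Set.insert_subset h0 subset_closure) isClosed_closure)
    rw [h1, ← hXdim]
    refine le_antisymm (vdim_le_of_dominant hX hφ rfl) (vdim_le_of_finite_fibre hX hX' hφ hx ?_)
    classical
    refine Set.Finite.of_injOn (f := fun y => if h : y.1 ≠ 0 then Curve.mk y.1 h else C)
      (t := {D | D ∈ S ∧ IsIntegralCurve D ω}) ?_ ?_ hfin
    · rintro y ⟨hy, hyx⟩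
      have hyω : y.2.1 = ω.coeffs := hyx.trans hxω
      simp only [dif_pos hy.1.1.1]
      refine ⟨hy.1.1.2, ?_⟩
      rw [IsIntegralCurve, integralForms_mk, ← hyω]
      exact mem_integralForms_of_darboux hy.2
    · rintro y ⟨hy, hyx⟩ z ⟨hz, hzx⟩ hyz
      simp only [dif_pos hy.1.1.1, dif_pos hz.1.1.1] at hyz
      exact eq_of_mem_totalSpace hy hz hyz (hyx.trans hzx.symm)
  obtain ⟨μ, hμ⟩ : ∃ μ : Module.Dual ℂ (Hom d × Hom d), μ ω.coeffs ≠ 0 := by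
    by_contra! h
    exact ω.coeffs_ne_zero ((Module.forall_dual_apply_eq_zero_iff ℂ _).mp h)
  let μ' : Module.Dual ℂ (Hom e × ((Hom d × Hom d) × gr (d - 1))) :=
    μ ∘ₗ LinearMap.fst ℂ _ _ ∘ₗ LinearMap.snd ℂ _ _
  -- Normalizing the form as well exhibits the affine slice of the set of forms as the image of an
  -- irreducible locally closed set. Rescaling form and cofactor together stays inside the total
  -- space, which gives irreducibility.
  let X₁ : Set (Hom e × ((Hom d × Hom d) × gr (d - 1))) := totalSpace d S l ∩ {x | μ' x = 1}
  have hX₁ : X₁ = {v | ∃ w, w ∈ totalSpace d S l ∧ μ' w ≠ 0 ∧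
      v = (LinearMap.inl ℂ _ _ ∘ₗ LinearMap.fst ℂ _ _) w +
        (μ' w)⁻¹ • (LinearMap.inr ℂ _ _ ∘ₗ LinearMap.snd ℂ _ _) w} := by
    ext x
    constructor
    · rintro ⟨hx, hx1⟩
      have hx1 : μ' x = 1 := hx1
      exact ⟨x, hx, by rw [hx1]; exact one_ne_zero, by rw [hx1]; simp⟩
    · rintro ⟨w, ⟨hw, hw'⟩, hμw, rfl⟩
      have h1 : (LinearMap.inl ℂ (Hom e) ((Hom d × Hom d) × gr (d - 1)) ∘ₗ
          LinearMap.fst ℂ _ _) w + (μ' w)⁻¹ • (LinearMap.inr ℂ _ _ ∘ₗ LinearMap.snd ℂ _ _) w =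
          (w.1, (μ' w)⁻¹ • w.2) := by simp
      rw [h1]
      refine ⟨⟨hw, ?_⟩, ?_⟩
      · change darboux e d w.1 ((μ' w)⁻¹ • w.2) = 0
        rw [map_smul, hw', smul_zero]
      · change μ ((μ' w)⁻¹ • w.2.1) = 1
        rw [map_smul, smul_eq_mul]
        exact inv_mul_cancel₀ hμw
  have himage₁ : φ '' X₁ = slice μ (formsOf d S) := by
    ext η
    constructor
    · rintro ⟨y, ⟨hy, hy1⟩, rfl⟩
      have hy1 : μ (φ y) = 1 := hy1
      have h1 : φ y ∈ insert 0 (cone (formsOf d S)) := himage ▸ ⟨y, hy, rfl⟩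
      refine ⟨h1.resolve_left fun h0 => ?_, hy1⟩
      rw [h0, map_zero] at hy1
      exact zero_ne_one hy1
    · rintro ⟨hη, hη1⟩
      obtain ⟨y, hy, rfl⟩ : η ∈ φ '' totalSpace d S l := himage ▸ Or.inr hη
      exact ⟨y, ⟨hy, hη1⟩, rfl⟩
  have hX₁irr : IsIrreducible X₁ := by
    refine ⟨?_, ?_⟩
    · have h1 : (μ ω.coeffs)⁻¹ • ω.coeffs ∈ φ '' X₁ := himage₁ ▸ inv_smul_mem_slice hω' hμ
      obtain ⟨y, hy, -⟩ := h1
      exact ⟨y, hy⟩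
    · rw [hX₁]
      exact isPreirreducible_normalization hX.isPreirreducible μ' _ _
  have hX₁cl : IsLocallyClosed X₁ := by
    refine hX'.inter (IsClosed.isLocallyClosed ?_)
    rw [← isOpen_compl_iff]
    have : {x | μ' x = 1}ᶜ = {x | μ' x - 1 ≠ 0} := by
      ext x
      exact sub_ne_zero.symm
    rw [this]
    exact isOpen_ne_zero
      (sub_mem (dual_mem_polynomialFunctions μ') (const_mem_polynomialFunctions 1))
  obtain ⟨h1, h2⟩ := topologicalKrullDim_eq_vdim (E := Hom d × Hom d) hirr hSY hYS hX₁irr hX₁cl hφ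
    himage₁
  have h3 : vdim (slice μ (formsOf d S)) = vdim (slice l S) + r - 1 := by
    rw [← hcone, h2, Nat.add_sub_cancel]
  rw [h3] at h1
  exact h1

end FormsDimension

end PlaneForms

end

open MvPolynomial
noncomputable section
namespace PlaneForms

attribute [local instance] zariskiTopology zariskiTopologyProd projectiveTopology
  zariskiTopologySubmodule

/-! ### The component through the given pair -/

section Main

variable {e d t : ℕ}

theorem incidence_inter_preimage (B U : Set (Curve e)) :
    incidence d B ∩ (fun p : CurveForm e d => (p.1 : Curve e)) ⁻¹' U = incidence d (B ∩ U) := by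
  ext p
  exact ⟨fun ⟨⟨h1, h2⟩, h3⟩ => ⟨⟨h1, h3⟩, h2⟩, fun ⟨⟨h1, h3⟩, h2⟩ => ⟨⟨h1, h2⟩, h3⟩⟩

theorem exists_component (B : Set (Curve e)) (hB : IsEquisingularFamily B t)
    (C : Curve e) (hCB : C ∈ B) (ω : Form d) (hω : IsIntegralCurve C ω)
    (hfin : {D : Curve e | IsReducedAffine D ∧ IsIntegralCurve D ω}.Finite)
    (hdeg : SingSchemeFiniteOfDegree C.eqn t)
    (hdim : (Module.finrank ℂ (integralForms C.eqn d) : ℤ) = expectedDim d e t) :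
    ∃ (b n : ℕ) (Z : Set (CurveForm e d)), HasDim B b ∧ (n : ℤ) = b + expectedDim d e t - 1 ∧
      IsComponentOf Z (incidence d B) ∧ ((C, ω) : CurveForm e d) ∈ Z ∧
      (∀ Z' : Set (CurveForm e d), IsComponentOf Z' (incidence d B) →
        ((C, ω) : CurveForm e d) ∈ Z' → Z' = Z) ∧
      HasDim (formsIn Z) n ∧
      (∀ T : Set (Form d), IsComponentOf T (formsOf d B) → ω ∈ T →
        ¬ T ⊆ closure (formsOf d {D ∈ B | ¬ IsGenericCurve d t D}) →
        T = closure (formsIn Z) ∩ formsOf d B ∧ HasDim T n) := by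
  obtain ⟨r, hr⟩ : ∃ r, r = Module.finrank ℂ (integralForms C.eqn d) := ⟨_, rfl⟩
  have hr0 : r ≠ 0 := fun h0 => by
    have h1 := Submodule.finrank_eq_zero.mp (hr.symm.trans h0)
    have h2 : ω.coeffs ∈ integralForms C.eqn d := hω
    rw [h1] at h2
    exact ω.coeffs_ne_zero h2
  rw [← hr] at hdim
  let U : Set (Curve e) := {D | Module.finrank ℂ (integralForms D.eqn d) ≤ r}
  have hU : IsOpen U := isOpen_finrank_le e d r
  have hCU : C ∈ U := hr.ge
  -- Semicontinuity and the lower bound meet, so the rank is constant on the open part.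
  have hBU : ∀ D ∈ B ∩ U, Module.finrank ℂ (integralForms D.eqn d) = r := fun D hD => by
    have h1 := expectedDim_le_of_mem hB hCB hdeg (hr ▸ hdim) hD.1
    rw [← hdim] at h1
    exact le_antisymm hD.2 (by exact_mod_cast h1)
  -- the component through the given pair
  let π : CurveForm e d → Curve e := fun p => p.1
  let ρ : CurveForm e d → Form d := fun p => p.2
  have hπ : Continuous π := continuous_fst_curveForm
  have hρ : Continuous ρ := continuous_snd_curveForm
  have hUirr : IsIrreducible (B ∩ U) := isIrreducible_inter_isOpen hB.isIrreducible hU ⟨C, hCB, hCU⟩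
  have hFU : incidence d B ∩ π ⁻¹' U = incidence d (B ∩ U) := incidence_inter_preimage B U
  have hFUirr : IsIrreducible (incidence d B ∩ π ⁻¹' U) := by
    rw [hFU]
    exact isIrreducible_incidence hUirr hBU hr0
  let Z := closure (incidence d B ∩ π ⁻¹' U) ∩ incidence d B
  have hZ : IsComponentOf Z (incidence d B) := isComponentOf_closure_inter (hU.preimage hπ) hFUirr
  have hCZ : ((C, ω) : CurveForm e d) ∈ Z := ⟨subset_closure ⟨⟨hCB, hω⟩, hCU⟩, hCB, hω⟩
  -- a neighbourhood of the given curve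
  obtain ⟨l, hlC⟩ : ∃ l : Module.Dual ℂ (Hom e), l C.vec ≠ 0 := by
    by_contra! h
    exact C.vec_ne_zero ((Module.forall_dual_apply_eq_zero_iff ℂ _).mp h)
  obtain ⟨m, hm⟩ := exists_forall_reduced C.vec_ne_zero hdeg
  obtain ⟨h, hh, hhC, ⟨q, hq⟩, -⟩ := exists_local_sections (darboux e d) C.vec
  -- Three conditions near `C`: the chart `l ≠ 0`, injectivity of one fixed `q` on all kernels, and,
  -- through the auxiliary degree `m`, reducedness without components at infinity. The last one
  -- makes the finiteness of the integral curves of `ω` applicable.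
  let O : Set (Curve e) := (nonvanishing fun v => l v) ∩ nonvanishing h ∩
    {D | Module.finrank ℂ (integralForms D.eqn m) ≤ Module.finrank ℂ (integralForms C.eqn m)}
  have hO : IsOpen O := by
    refine IsOpen.inter (IsOpen.inter ?_ ?_) (isOpen_finrank_le e m _)
    · exact isOpen_nonvanishing (dual_mem_polynomialFunctions l)
    · exact isOpen_nonvanishing hh
  have hCO : C ∈ O := ⟨⟨⟨C.vec, C.vec_ne_zero, C.mk_vec, hlC⟩, C.vec, C.vec_ne_zero, C.mk_vec, hhC⟩,
    Nat.le_refl (Module.finrank ℂ (integralForms C.eqn m))⟩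
  let S := B ∩ (U ∩ O)
  have hUO : IsOpen (U ∩ O) := hU.inter hO
  have hCS : C ∈ S := ⟨hCB, hCU, hCO⟩
  have hS : IsIrreducible S := isIrreducible_inter_isOpen hB.isIrreducible hUO ⟨C, hCS⟩
  have hS' : IsLocallyClosed S := hB.isLocallyClosed.inter hUO.isLocallyClosed
  have hSr : ∀ D ∈ S, Module.finrank ℂ (integralForms D.eqn d) = r := fun D hD =>
    hBU D ⟨hD.1, hD.2.1⟩
  have hBS : B ⊆ closure S :=
    subset_closure_inter_of_isOpen hB.isIrreducible.isPreirreducible hUO ⟨C, hCS⟩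
  have hl : ∀ v ∈ cone S, l v ≠ 0 := by
    rintro v ⟨hv, hvS⟩ hlv
    obtain ⟨u, hu, huv, hlu⟩ := hvS.2.2.1.1
    obtain ⟨c, rfl⟩ := (Projectivization.mk_eq_mk_iff' ℂ _ _ _ _).mp huv
    exact hlu (show l (c • v) = 0 by rw [map_smul, hlv, smul_zero])
  have hq' : ∀ v ∈ slice l S, ∀ w, darboux e d v w = 0 → q w = 0 → w = 0 := by
    rintro v ⟨⟨hv, hvS⟩, -⟩ w hw hqw
    obtain ⟨u, hu, huv, hhu⟩ := hvS.2.2.1.2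
    obtain ⟨c, rfl⟩ := (Projectivization.mk_eq_mk_iff' ℂ _ _ _ _).mp huv
    refine hq _ hhu w ?_ hqw
    rw [map_smul, LinearMap.smul_apply, hw, smul_zero]
  have hQ : Module.finrank ℂ (LinearMap.ker (darboux e d C.vec)) = r := by
    rw [finrank_ker_darboux _ C.vec_ne_zero, Curve.mk_vec, hr]
  have hfin' : {D | D ∈ S ∧ IsIntegralCurve D ω}.Finite :=
    hfin.subset fun D hD => ⟨hm D.vec D.vec_ne_zero hD.1.2.2.2, hD.2⟩
  have hincS : IsIrreducible (incidence d S) := isIrreducible_incidence hS hSr hr0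
  have hformsS : IsIrreducible (formsOf d S) := by
    rw [← image_snd_incidence]
    exact hincS.image ρ hρ.continuousOn
  have hωS : ω ∈ formsOf d S := ⟨C, hCS, hω⟩
  have hmain := fun (Y : Set (Form d)) => hasDim_formsOf (Y := Y) hS hS' hl hSr hQ q hq' hformsS hωS
    hfin'
  -- the forms of the component
  have h1 : formsOf d S ⊆ formsIn Z := by
    rintro η ⟨D, hD, hDη⟩
    exact ⟨D, subset_closure ⟨⟨hD.1, hDη⟩, hD.2.1⟩, hD.1, hDη⟩
  have h2 : formsIn Z ⊆ closure (formsOf d S) := by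
    -- Shrinking from `U` to `U ∩ O` keeps a nonempty open part of an irreducible set, so the
    -- closure does not change.
    have h3 : incidence d B ∩ π ⁻¹' U ⊆ closure (incidence d S) := by
      have h4 := subset_closure_inter_of_isOpen hFUirr.isPreirreducible (hO.preimage hπ)
        ⟨((C, ω) : CurveForm e d), ⟨⟨hCB, hω⟩, hCU⟩, hCO⟩
      rwa [hFU, incidence_inter_preimage, Set.inter_assoc, ← hFU] at h4
    rintro η ⟨D, hD, -⟩
    rw [← image_snd_incidence]
    exact image_closure_subset_closure_image hρ ⟨_, closure_minimal h3 isClosed_closure hD, rfl⟩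
  refine ⟨vdim (slice l S), vdim (slice l S) + r - 1, Z, ?_, ?_, hZ, hCZ, ?_, hmain _ h1 h2, ?_⟩
  · exact hasDim_of_slice hS hS' (C.vec_mem_cone hCS) hlC Set.inter_subset_left hBS
  · rw [← hdim]
    omega
  · exact fun Z' hZ' hCZ' => hZ'.eq_closure_inter (hU.preimage hπ) hFUirr ⟨_, hCZ', hCU⟩
  · intro T hT _ hTN
    have h3 : formsOf d (B ∩ U) ⊆ formsIn Z := by
      rintro η ⟨D, hD, hDη⟩
      exact ⟨D, subset_closure ⟨⟨hD.1, hDη⟩, hD.2⟩, hD.1, hDη⟩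
    -- Every form of `T` has an integral curve in `B` that is either degenerate or of rank `r`.
    -- Irreducibility of `T` selects one of the two closures, and the assumption on `T` excludes the
    -- first.
    have h4 : T ⊆ closure (formsOf d {D ∈ B | ¬ IsGenericCurve d t D}) ∪
        closure (formsOf d (B ∩ U)) := by
      intro η hη
      obtain ⟨D, hD, hDη⟩ := hT.1.2 hη
      by_cases hgen : IsGenericCurve d t D
      · have h5 := hgen.2.2
        rw [← hdim] at h5
        have h6 : Module.finrank ℂ (integralForms D.eqn d) = r := by exact_mod_cast h5
        exact Or.inr (subset_closure ⟨D, ⟨hD, h6.le⟩, hDη⟩)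
      · exact Or.inl (subset_closure ⟨D, ⟨hD, hgen⟩, hDη⟩)
    have h5 : T ⊆ closure (formsOf d (B ∩ U)) :=
      ((isPreirreducible_iff_isClosed_union_isClosed.mp hT.1.1.isPreirreducible) _ _
        isClosed_closure isClosed_closure h4).resolve_left hTN
    have h6 : formsIn Z ⊆ closure (formsIn Z) ∩ formsOf d B := by
      rintro η ⟨D, hD⟩
      exact ⟨subset_closure ⟨D, hD⟩, D, hD.2.1, hD.2.2⟩
    have h7 : IsIrreducible (formsIn Z) := isIrreducible_of_subset_closure hformsS h1 h2
    have h8 : T = closure (formsIn Z) ∩ formsOf d B := by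
      have h9 : T ⊆ closure (formsIn Z) ∩ formsOf d B := fun η hη =>
        ⟨closure_mono h3 (h5 hη), hT.1.2 hη⟩
      exact subset_antisymm h9 (hT.2 ⟨isIrreducible_of_subset_closure h7 h6 Set.inter_subset_left,
        Set.inter_subset_right⟩ h9)
    refine ⟨h8, ?_⟩
    rw [h8]
    exact hmain _ (h1.trans h6) (Set.inter_subset_left.trans (closure_minimal h2 isClosed_closure))

end Main

end PlaneForms

end

theorem proposition4p14 (e d t : ℕ) (B : Set (PlaneForms.Curve e))
    (hB : PlaneForms.IsEquisingularFamily B t)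
    (C : PlaneForms.Curve e) (hCB : C ∈ B)
    (ω : PlaneForms.Form d) (hω : PlaneForms.IsIntegralCurve C ω)
    (hred : Squarefree C.eqn)
    (hinf : ¬ (MvPolynomial.X 2 ∣ C.eqn))
    (hfin : {D : PlaneForms.Curve e |
      PlaneForms.IsReducedAffine D ∧ PlaneForms.IsIntegralCurve D ω}.Finite)
    (hdeg : PlaneForms.SingSchemeFiniteOfDegree C.eqn t)
    (hdim : (Module.finrank ℂ (PlaneForms.integralForms C.eqn d) : ℤ) =
      PlaneForms.expectedDim d e t) :
    ∃ (b n : ℕ) (Z : Set (PlaneForms.CurveForm e d)),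
      PlaneForms.HasDim B b ∧
      (n : ℤ) = b + PlaneForms.expectedDim d e t - 1 ∧
      -- `Z` is the component through `(C, ω)` of the family of pairs, and it is the only one
      PlaneForms.IsComponentOf Z (PlaneForms.incidence d B) ∧
      ((C, ω) : PlaneForms.CurveForm e d) ∈ Z ∧
      (∀ Z' : Set (PlaneForms.CurveForm e d),
        PlaneForms.IsComponentOf Z' (PlaneForms.incidence d B) →
        ((C, ω) : PlaneForms.CurveForm e d) ∈ Z' → Z' = Z) ∧
      -- the forms in it make up a set of dimension `n`
      PlaneForms.HasDim (PlaneForms.formsIn Z) n ∧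
      -- components of `Ω_B` as a set of forms that do not just come from degenerate curves
      (∀ T : Set (PlaneForms.Form d),
        PlaneForms.IsComponentOf T (PlaneForms.formsOf d B) → ω ∈ T →
        ¬ T ⊆ closure (PlaneForms.formsOf d {D ∈ B | ¬ PlaneForms.IsGenericCurve d t D}) →
        T = closure (PlaneForms.formsIn Z) ∩ PlaneForms.formsOf d B ∧
          PlaneForms.HasDim T n) := PlaneForms.exists_component B hB C hCB ω hω hfin hdeg hdim
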